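/- **Conventions.** $L$ is a countable language with a fixed numbering of its symbols, and $\mathcal B$ is a countable $L$-structure. $\mathcal A$ is a structure for a countable (numbered) relational language with basic relations $R_i$ of arity $k_i$. $\mathcal B^{<\omega}$ is the set of finite tuples from $\mathcal B$. A *generalized $L_{\omega_1\omega}$ formula* (for an $r$-ary relation on $\mathcal B^{<\omega}$) is a family of $L_{\omega_1\omega}$ formulas, one for each choice $(n_1,\dots,n_r)$ of lengths of the $r$ tuples; it defines $S\subseteq(\mathcal B^{<\omega})^r$ if for all $n_1,\dots,n_r$ the corresponding formula defines $S\cap(\mathcal B^{n_1}\times\dots\times\mathcal B^{n_r})$. It is $\Sigma_\alpha$ if each member of the family is; it is $X$-computable if the members (as labelled trees) are computable from $X$ uniformly in the lengths. Here $\Sigma_0=\Pi_0$ are the finitary quantifier-free formulas, and for $\alpha>0$ a $\Sigma_\alpha$ formula is a countable disjunction of formulas $\exists\bar u\,\psi$ with $\psi\in\Pi_\beta$, $\beta<\alpha$; dually for $\Pi_\alpha$. An *interpretation* of $\mathcal A$ in $\mathcal B$ (with parameters $\bar b$) by generalized formulas consists of $D\subseteq\mathcal B^{<\omega}$, an equivalence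 relation $\equiv$ on $D$, and relations $R_i^*\subseteq D^{k_i}$ respecting $\equiv$, all defined by generalized $L_{\omega_1\omega}$ formulas (with parameters $\bar b$), such that $(D,(R_i^*)_i)/{\equiv}\;\cong\mathcal A$. We write $\pm\!\equiv$, $\pm R_i^*$ for these relations together with their complements in $D^2$, $D^{k_i}$. **Theorem.** Suppose there is an interpretation of $\mathcal A$ in $\mathcal B$ by generalized $L_{\omega_1\omega}$ formulas with parameters $\bar b\in\mathcal B^m$. For $\bar c$ in the orbit of $\bar b$ under $\mathrm{Aut}(\mathcal B)$, let $D_{\bar c},\equiv_{\bar c},R_{i,\bar c}$ be what the same formulas define with parameters $\bar c$, and let $\mathcal A_{\bar c}=(D_{\bar c},(R_{i,\bar c})_i)/{\equiv_{\bar c}}$. Assume that there are a relation $F\subseteq(\mathcal B^{<\omega})^4$ defined without parameters by a generalized $L_{\omega_1\omega}$ formula, and isomorphisms $f_{\bar c,\bar d}:\mathcal A_{\bar c}\to\mathcal A_{\bar d}$ for all $\bar c,\bar d$ in the orbit of $\bar b$, such that for $\bar x\in D_{\bar c}$, $\bar y\in D_{\bar d}$ $$f_{\bar c,\bar d}([\bar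 x])=[\bar y]\iff(\bar c,\bar d,\bar x,\bar y)\in F,$$ and such that $f_{\bar c,\bar c}=\mathrm{id}$ and $f_{\bar d,\bar e}\circ f_{\bar c,\bar d}=f_{\bar c,\bar e}$ for all $\bar c,\bar d,\bar e$ in the orbit. Then there is an interpretation of $\mathcal A$ in $\mathcal B$ by generalized $L_{\omega_1\omega}$ formulas without parameters, given by some $D',\sim,R_i'$, which satisfies all of the following. 1. For each countable ordinal $\alpha\ge1$: if $D_{\bar b}$, $\equiv_{\bar b}$ and each $R_{i,\bar b}$ are defined by (generalized) $\Sigma_\alpha$ formulas with parameters $\bar b$, and $F$ and the orbit of $\bar b$ are defined by parameter-free $\Sigma_\alpha$ formulas (generalized in the case of $F$), then $D'$, $\sim$ and each $R_i'$ are defined by parameter-free generalized $\Sigma_\alpha$ formulas. 2. The same holds with $D_{\bar b},\pm\!\equiv_{\bar b},\pm R_{i,\bar b}$ in the hypothesis and $D',\pm\!\sim,\pm R_i'$ in the conclusion. 3. Let $X\subseteq\omega$. If $D_{\bar b}$, $\equiv_{\bar b}$ and each $R_{i,\bar b}$ are defined by $X$-computable generalized formulas with parameters $\bar b$, and $F$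 and the orbit of $\bar b$ are defined by $X$-computable parameter-free formulas (generalized in the case of $F$), then $D'$, $\sim$ and each $R_i'$ are defined by $X$-computable parameter-free generalized formulas. If the formulas for the $R_{i,\bar b}$ are $X$-computable uniformly in $i$, then so are those for the $R_i'$. Both statements also hold with $\pm\!\equiv_{\bar b},\pm R_{i,\bar b}$ and $\pm\!\sim,\pm R_i'$, and, for each countable $\alpha\ge1$, with "$X$-computable and $\Sigma_\alpha$" in place of "$X$-computable" throughout. (For every countable set of $L_{\omega_1\omega}$ formulas there is an $X$ such that all of them are $X$-computable.) 4. If $D_{\bar b}\subseteq\mathcal B^n$ for a single $n$, then $D'\subseteq\mathcal B^{n+m}$, and $D',\sim,R_i'$ are defined by (non-generalized) $L_{\omega_1\omega}$ formulas without parameters. 5. If $D_{\bar b}\subseteq\mathcal B^n$ for a single $n$, the set $D_{\bar b}$, $\equiv_{\bar b}$ and each $R_{i,\bar b}$ are defined by finitary first-order formulas with parameters $\bar b$, and $F\cap(\mathcal B^m\times\mathcal B^m\times\mathcal B^n\times\mathcal B^n)$ and the orbit of $\bar b$ are defined by finitary first-order formulas without parameters, then $D',\sim,R_i'$ are defined by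 finitary first-order formulas without parameters. -/

import Mathlib

open FirstOrder

universe u v u' v' w w'

/-! ## Formulas of `L_{ω₁ω}` -/

/-- Formulas of `L_{ω₁ω}` whose free variables are among `x_0, …, x_{n-1}`.
`ex` and `all` bind the last variable of their body. -/
inductive InfForm (L : FirstOrder.Language.{u, v}) : ℕ → Type (max u v)
  | falsum {n : ℕ} : InfForm L n
  | equal {n : ℕ} (t₁ t₂ : L.Term (Fin n)) : InfForm L n
  | rel {n k : ℕ} (R : L.Relations k) (ts : Fin k → L.Term (Fin n)) : InfForm L n
  | neg {n : ℕ} (φ : InfForm L n) : InfForm L n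
  | and {n : ℕ} (φ ψ : InfForm L n) : InfForm L n
  | or {n : ℕ} (φ ψ : InfForm L n) : InfForm L n
  | iDisj {n : ℕ} (φ : ℕ → InfForm L n) : InfForm L n
  | iConj {n : ℕ} (φ : ℕ → InfForm L n) : InfForm L n
  | ex {n : ℕ} (φ : InfForm L (n + 1)) : InfForm L n
  | all {n : ℕ} (φ : InfForm L (n + 1)) : InfForm L n

namespace InfForm

variable {L : FirstOrder.Language.{u, v}}

/-- Satisfaction of a formula by an assignment. -/
def Realize {B : Type w} [L.Structure B] : ∀ {n : ℕ}, InfForm L n → (Fin n → B) → Prop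
  | _, falsum, _ => False
  | _, equal t₁ t₂, a => t₁.realize a = t₂.realize a
  | _, rel R ts, a => FirstOrder.Language.Structure.RelMap R (fun j => (ts j).realize a)
  | _, neg φ, a => ¬ φ.Realize a
  | _, and φ ψ, a => φ.Realize a ∧ ψ.Realize a
  | _, or φ ψ, a => φ.Realize a ∨ ψ.Realize a
  | _, iDisj φ, a => ∃ i, (φ i).Realize a
  | _, iConj φ, a => ∀ i, (φ i).Realize a
  | n, ex φ, a => ∃ z : B, φ.Realize (Fin.snoc a z : Fin (n + 1) → B)
  | n, all φ, a => ∀ z : B, φ.Realize (Fin.snoc a z : Fin (n + 1) → B)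

/-- Finitary (first-order) formulas. -/
def IsFinitary : ∀ {n : ℕ}, InfForm L n → Prop
  | _, falsum => True
  | _, equal _ _ => True
  | _, rel _ _ => True
  | _, neg φ => φ.IsFinitary
  | _, and φ ψ => φ.IsFinitary ∧ ψ.IsFinitary
  | _, or φ ψ => φ.IsFinitary ∧ ψ.IsFinitary
  | _, iDisj _ => False
  | _, iConj _ => False
  | _, ex φ => φ.IsFinitary
  | _, all φ => φ.IsFinitary

/-- Finitary quantifier-free formulas. -/
def IsFinQF : ∀ {n : ℕ}, InfForm L n → Prop
  | _, falsum => True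
  | _, equal _ _ => True
  | _, rel _ _ => True
  | _, neg φ => φ.IsFinQF
  | _, and φ ψ => φ.IsFinQF ∧ ψ.IsFinQF
  | _, or φ ψ => φ.IsFinQF ∧ ψ.IsFinQF
  | _, iDisj _ => False
  | _, iConj _ => False
  | _, ex _ => False
  | _, all _ => False

/-- The block of existential quantifiers `∃ x_n … x_{n+k-1}`. -/
def exs {n : ℕ} : ∀ k : ℕ, InfForm L (n + k) → InfForm L n
  | 0, φ => φ
  | k + 1, φ => exs k (ex φ)

/-- The block of universal quantifiers `∀ x_n … x_{n+k-1}`. -/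
def alls {n : ℕ} : ∀ k : ℕ, InfForm L (n + k) → InfForm L n
  | 0, φ => φ
  | k + 1, φ => alls k (all φ)

/-- The two sides of the hierarchy of infinitary formulas. -/
inductive Side
  | sigma
  | pi

/-- The hierarchy of infinitary formulas: `Σ₀ = Π₀` are the finitary quantifier-free formulas;
for `α > 0`, a `Σ_α` formula is a countable disjunction of formulas `∃ ū ψ` with `ψ` in `Π_β`
for some `β < α`, and a `Π_α` formula is a countable conjunction of formulas `∀ ū ψ` with `ψ`
in `Σ_β` for some `β < α`. -/
inductive InHierarchy : Side → Ordinal.{0} → ∀ {n : ℕ}, InfForm L n → Prop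
  | qf (s : Side) {n : ℕ} (φ : InfForm L n) (h : φ.IsFinQF) : InHierarchy s 0 φ
  | sigma {n : ℕ} (α : Ordinal.{0}) (β : ℕ → Ordinal.{0}) (k : ℕ → ℕ)
      (ψ : ∀ i, InfForm L (n + k i)) (hβ : ∀ i, β i < α)
      (h : ∀ i, InHierarchy Side.pi (β i) (ψ i)) :
      InHierarchy Side.sigma α (iDisj fun i => exs (k i) (ψ i))
  | pi {n : ℕ} (α : Ordinal.{0}) (β : ℕ → Ordinal.{0}) (k : ℕ → ℕ)
      (ψ : ∀ i, InfForm L (n + k i)) (hβ : ∀ i, β i < α)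
      (h : ∀ i, InHierarchy Side.sigma (β i) (ψ i)) :
      InHierarchy Side.pi α (iConj fun i => alls (k i) (ψ i))

/-- The formula as a labelled well-founded tree. A position in the tree is the list of branches
taken from the root; `φ.label p` is the Gödel number of the symbol (or atomic formula) at
position `p`. Positions outside the tree get the label `⟨10, 0⟩`. -/
def label [Encodable (Σ k, L.Functions k)] [Encodable (Σ k, L.Relations k)] :
    ∀ {n : ℕ}, InfForm L n → List ℕ → ℕ
  | _, falsum, [] => Nat.pair 0 0
  | _, equal t₁ t₂, [] => Nat.pair 1 (Nat.pair (Encodable.encode t₁) (Encodable.encode t₂))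
  | _, @rel _ _ k R ts, [] =>
      Nat.pair 2 (Nat.pair (Encodable.encode (⟨k, R⟩ : Σ k, L.Relations k))
        (Encodable.encode (List.ofFn fun j => Encodable.encode (ts j))))
  | _, neg _, [] => Nat.pair 3 0
  | _, and _ _, [] => Nat.pair 4 0
  | _, or _ _, [] => Nat.pair 5 0
  | _, iDisj _, [] => Nat.pair 6 0
  | _, iConj _, [] => Nat.pair 7 0
  | _, ex _, [] => Nat.pair 8 0
  | _, all _, [] => Nat.pair 9 0
  | _, neg φ, 0 :: p => φ.label p
  | _, and φ _, 0 :: p => φ.label p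
  | _, and _ ψ, 1 :: p => ψ.label p
  | _, or φ _, 0 :: p => φ.label p
  | _, or _ ψ, 1 :: p => ψ.label p
  | _, iDisj φ, i :: p => (φ i).label p
  | _, iConj φ, i :: p => (φ i).label p
  | _, ex φ, 0 :: p => φ.label p
  | _, all φ, 0 :: p => φ.label p
  | _, _, _ => Nat.pair 10 0

end InfForm

/-! ## Computability relative to a set -/

open Classical in
/-- The characteristic function of `X`, as an oracle. -/
noncomputable def charOracle (X : Set ℕ) : ℕ →. ℕ :=
  fun n => Part.some (if n ∈ X then 1 else 0)

/-- The total function `g` is computable with oracle `X`. -/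
def XComputable {α β : Type*} [Primcodable α] [Primcodable β] (X : Set ℕ) (g : α → β) : Prop :=
  ComputableIn {charOracle X} g

/-- An `X`-computable formula of `L_{ω₁ω}`: its labelled tree is computable in `X`. -/
def InfForm.IsXComputable {L : FirstOrder.Language.{u, v}} [Encodable (Σ k, L.Functions k)]
    [Encodable (Σ k, L.Relations k)] (X : Set ℕ) {n : ℕ} (φ : InfForm L n) : Prop :=
  XComputable X φ.label

/-! ## Relations on tuples of arbitrary length, and generalized formulas -/

/-- `B^{<ω}`: finite tuples from `B`. -/
abbrev Tup (B : Type w) : Type w := Σ k : ℕ, (Fin k → B)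

/-- Concatenation of `r` tuples. -/
def concat {B : Type w} {r : ℕ} {s : Fin r → ℕ} (y : ∀ j, Fin (s j) → B) :
    Fin (∑ j, s j) → B :=
  fun i => y (finSigmaFinEquiv.symm i).1 (finSigmaFinEquiv.symm i).2

/-- A generalized `L_{ω₁ω}` formula with `m` parameter variables, for an `r`-ary relation
on `B^{<ω}`: one `L_{ω₁ω}` formula for each choice of the lengths of the `r` tuples. -/
abbrev GenForm (L : FirstOrder.Language.{u, v}) (m r : ℕ) : Type (max u v) :=
  ∀ s : Fin r → ℕ, InfForm L (m + ∑ j, s j)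

/-- Satisfaction of a generalized formula, with parameters `p`, by `r` tuples. -/
def GenForm.Realize {L : FirstOrder.Language.{u, v}} {B : Type w} [L.Structure B] {m r : ℕ}
    (Φ : GenForm L m r) (p : Fin m → B) (x : Fin r → Tup B) : Prop :=
  (Φ fun j => (x j).1).Realize (Fin.append p (concat fun j => (x j).2))

/-- A class of `L_{ω₁ω}` formulas. -/
abbrev FormClass (L : FirstOrder.Language.{u, v}) : Type (max u v) := ∀ n : ℕ, InfForm L n → Prop

/-- All `L_{ω₁ω}` formulas. -/
def allForms (L : FirstOrder.Language.{u, v}) : FormClass L := fun _ _ => True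

/-- The `Σ_α` formulas. -/
def sigmaForms (L : FirstOrder.Language.{u, v}) (α : Ordinal.{0}) : FormClass L :=
  fun _ φ => φ.InHierarchy InfForm.Side.sigma α

/-- The finitary formulas. -/
def finitaryForms (L : FirstOrder.Language.{u, v}) : FormClass L := fun _ φ => φ.IsFinitary

section Definability

variable {L : FirstOrder.Language.{u, v}} {B : Type w} [L.Structure B] {m : ℕ}

/-- `S` is defined, with parameters `p`, by a generalized formula
all of whose components are in `Γ`. -/
def GenDefinable (Γ : FormClass L) (p : Fin m → B) (r : ℕ) (S : Set (Fin r → Tup B)) : Prop :=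
  ∃ Φ : GenForm L m r, (∀ s, Γ _ (Φ s)) ∧ ∀ x, x ∈ S ↔ Φ.Realize p x

/-- The part of `S` that consists of tuples of lengths `s` is defined, with parameters `p`,
by a single (non-generalized) formula in `Γ`. -/
def DefinableAt (Γ : FormClass L) (p : Fin m → B) {r : ℕ} (s : Fin r → ℕ)
    (S : Set (Fin r → Tup B)) : Prop :=
  ∃ φ : InfForm L (m + ∑ j, s j), Γ _ φ ∧
    ∀ y : ∀ j, Fin (s j) → B,
      (fun j => (⟨s j, y j⟩ : Tup B)) ∈ S ↔ φ.Realize (Fin.append p (concat y))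

/-- A subset of `B^m` is defined, without parameters, by a formula in `Γ`. -/
def SetDefinable (Γ : FormClass L) (O : Set (Fin m → B)) : Prop :=
  ∃ φ : InfForm L m, Γ _ φ ∧ ∀ c, c ∈ O ↔ φ.Realize c

variable [Encodable (Σ k, L.Functions k)] [Encodable (Σ k, L.Relations k)]

/-- The relations `S i` are defined, with parameters `p`, by generalized formulas with components
in `Γ` that are `X`-computable, uniformly in `i` and in the lengths of the tuples. -/
def XGenDefinableFamily {ι : Type*} [Encodable ι] (X : Set ℕ) (Γ : FormClass L) (p : Fin m → B)
    (r : ι → ℕ) (S : ∀ i, Set (Fin (r i) → Tup B)) : Prop :=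
  ∃ Φ : ∀ i, GenForm L m (r i),
    (∀ i s, Γ _ (Φ i s)) ∧ (∀ i x, x ∈ S i ↔ (Φ i).Realize p x) ∧
    ∃ g : ℕ × List ℕ × List ℕ → ℕ, XComputable X g ∧
      ∀ i s pos, g (Encodable.encode i, List.ofFn s, pos) = (Φ i s).label pos

/-- `S` is defined, with parameters `p`, by a generalized formula that is `X`-computable (as a
sequence of formulas) and has its components in `Γ`. -/
def XGenDefinable (X : Set ℕ) (Γ : FormClass L) (p : Fin m → B) (r : ℕ)
    (S : Set (Fin r → Tup B)) : Prop :=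
  XGenDefinableFamily X Γ p (fun _ : Unit => r) (fun _ => S)

/-- A subset of `B^m` is defined, without parameters, by an `X`-computable formula in `Γ`. -/
def XSetDefinable (X : Set ℕ) (Γ : FormClass L) (O : Set (Fin m → B)) : Prop :=
  ∃ φ : InfForm L m, Γ _ φ ∧ φ.IsXComputable X ∧ ∀ c, c ∈ O ↔ φ.Realize c

end Definability

/-- The orbit of a tuple under the automorphism group. -/
def tupOrbit (L : FirstOrder.Language.{u, v}) {B : Type w} [L.Structure B] {m : ℕ} (b : Fin m → B) :
    Set (Fin m → B) :=
  {c | ∃ σ : B ≃[L] B, ∀ i, σ (b i) = c i}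

/-! ## Interpretations -/

/-- The data `D ⊆ B^{<ω}`, `≡` and `R*` of an interpretation in `B` of a structure for the
relational language `LA`. -/
structure TupPresentation (LA : FirstOrder.Language.{u', v'}) (B : Type w) where
  dom : Set (Tup B)
  eqv : Tup B → Tup B → Prop
  rel : ∀ {k : ℕ}, LA.Relations k → Set (Fin k → Tup B)

namespace TupPresentation

variable {LA : FirstOrder.Language.{u', v'}} {B : Type w} (P : TupPresentation LA B)

/-- The quotient `D/≡`. -/
def Carrier : Type w := Quot fun x y : P.dom => P.eqv x y

/-- The class of `x`. -/
def cls (x : P.dom) : P.Carrier := Quot.mk _ x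

/-- The quotient structure `(D, (R*))/≡`. -/
instance [LA.IsRelational] : LA.Structure P.Carrier where
  funMap g := isEmptyElim g
  RelMap R q := ∃ x : Fin _ → P.dom, (∀ j, P.cls (x j) = q j) ∧ (fun j => (x j : Tup B)) ∈ P.rel R

/-- `≡` is an equivalence relation on `D`, the `R*` are relations on `D` that respect `≡`,
and the quotient structure is isomorphic to `A`. -/
structure Interprets [LA.IsRelational] (A : Type w') [LA.Structure A] : Prop where
  eqv_dom : ∀ x y, P.eqv x y → x ∈ P.dom ∧ y ∈ P.dom
  eqv_refl : ∀ x ∈ P.dom, P.eqv x x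
  eqv_symm : ∀ x y, P.eqv x y → P.eqv y x
  eqv_trans : ∀ x y z, P.eqv x y → P.eqv y z → P.eqv x z
  rel_dom : ∀ (k : ℕ) (R : LA.Relations k), ∀ x ∈ P.rel R, ∀ j, x j ∈ P.dom
  rel_congr : ∀ (k : ℕ) (R : LA.Relations k) (x y : Fin k → Tup B),
    (∀ j, P.eqv (x j) (y j)) → x ∈ P.rel R → y ∈ P.rel R
  iso : Nonempty (P.Carrier ≃[LA] A)

/-- `D`, as a unary relation on tuples. -/
def domRel : Set (Fin 1 → Tup B) := {x | x 0 ∈ P.dom}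

/-- `≡`, as a binary relation on tuples. -/
def eqvRel : Set (Fin 2 → Tup B) := {x | P.eqv (x 0) (x 1)}

/-- The complement of `≡` in `D²`. -/
def neqvRel : Set (Fin 2 → Tup B) := {x | x 0 ∈ P.dom ∧ x 1 ∈ P.dom ∧ ¬ P.eqv (x 0) (x 1)}

/-- The complement of `R*` in `D^k`. -/
def nrel {k : ℕ} (R : LA.Relations k) : Set (Fin k → Tup B) :=
  {x | (∀ j, x j ∈ P.dom) ∧ x ∉ P.rel R}

/-- `D`, `≡` and each `R*` have the property `Q`. -/
def Each (Q : ∀ r : ℕ, Set (Fin r → Tup B) → Prop) : Prop :=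
  Q 1 P.domRel ∧ Q 2 P.eqvRel ∧ ∀ (k : ℕ) (R : LA.Relations k), Q k (P.rel R)

/-- `D`, `±≡` and each `±R*` have the property `Q`. -/
def EachPM (Q : ∀ r : ℕ, Set (Fin r → Tup B) → Prop) : Prop :=
  P.Each Q ∧ Q 2 P.neqvRel ∧ ∀ (k : ℕ) (R : LA.Relations k), Q k (P.nrel R)

/-- All tuples in `D` have length `n`. -/
def DomIn (n : ℕ) : Prop := ∀ x ∈ P.dom, x.1 = n

section Uniform

variable {L : FirstOrder.Language.{u, v}} [L.Structure B] {m : ℕ} [Encodable (Σ k, L.Functions k)]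
  [Encodable (Σ k, L.Relations k)] [Encodable (Σ k, LA.Relations k)]

/-- `D`, `≡` and the `R*` are defined by generalized formulas with components in `Γ`
that are computable uniformly in `X`. -/
def UniformlyX (X : Set ℕ) (Γ : FormClass L) (p : Fin m → B) : Prop :=
  XGenDefinable X Γ p 1 P.domRel ∧ XGenDefinable X Γ p 2 P.eqvRel ∧
    XGenDefinableFamily X Γ p (fun R : Σ k, LA.Relations k => R.1) (fun R => P.rel R.2)

/-- `D`, `±≡` and the `±R*` are defined by generalized formulas with components in `Γ`
that are computable uniformly in `X`. -/
def UniformlyXPM (X : Set ℕ) (Γ : FormClass L) (p : Fin m → B) : Prop :=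
  P.UniformlyX X Γ p ∧ XGenDefinable X Γ p 2 P.neqvRel ∧
    XGenDefinableFamily X Γ p (fun R : Σ k, LA.Relations k => R.1) (fun R => P.nrel R.2)

end Uniform

end TupPresentation

/-- The formulas, with `m` parameter variables, that are used in an interpretation by generalized
`L_{ω₁ω}` formulas. -/
structure InterpForms (LA : FirstOrder.Language.{u', v'}) (L : FirstOrder.Language.{u, v}) (m : ℕ) where
  dom : GenForm L m 1
  eqv : GenForm L m 2
  rel : ∀ {k : ℕ}, LA.Relations k → GenForm L m k

/-- What the formulas define in `B` with parameters `c`. -/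
def InterpForms.at {LA : FirstOrder.Language.{u', v'}} {L : FirstOrder.Language.{u, v}} {m : ℕ}
    (I : InterpForms LA L m) {B : Type w} [L.Structure B] (c : Fin m → B) :
    TupPresentation LA B where
  dom := {x | I.dom.Realize c ![x]}
  eqv x y := I.eqv.Realize c ![x, y]
  rel R := {x | (I.rel R).Realize c x}

/-!
The elements of `D'` are the pairs `(c, x)` with `c` in the orbit of `b` and `x ∈ D_c`, written as
concatenated tuples. Two pairs `(c, x)` and `(d, y)` are identified when `f c d` sends the class of
`x` to that of `y`; coherence of the `f c d` makes this an equivalence relation, with quotient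
`A_b ≅ A`. A relation holds of `(c_j, x_j)` when there are `e` in the orbit and `y_j ∈ D_e` with
`F (c_j, e, x_j, y_j)` such that the relation computed in `A_e` holds of the `y_j`. Since all `A_e`
are isomorphic to each other along `F`, the choice of `e` does not matter, and complements are
transferred in the same way.

So `D'`, `∼` and `R'` arise from the given relations by finite conjunctions, existential
quantification over tuples and countable disjunctions. The `Σ_α` formulas are closed under these
operations, with indices computable from those of the given formulas: write each formula as a
disjunction of `∃ ū, ψ` and distribute the conjunction. Formulas without a bound on their complexity
are treated by the same operations, and the statements about `Σ_α` formulas follow from those about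
`X`-computable ones on choosing `X` to compute all formulas involved. When nothing is assumed about
the orbit of `b`, it is `L_{ω₁ω}`-definable by the back-and-forth analysis of `(B, b)`.
-/

section RelativeComputability

variable {α β γ σ : Type*} [Primcodable α] [Primcodable β] [Primcodable γ] [Primcodable σ]
  {O : Set (ℕ →. ℕ)}

theorem computableIn_comp {f : β → σ} {g : α → β} (hf : ComputableIn O f)
    (hg : ComputableIn O g) : ComputableIn O fun a => f (g a) :=
  (Nat.RecursiveIn.comp hf hg).of_eq fun n => by
    rcases Encodable.decode (α := α) n with - | a <;> simp [Encodable.encodek]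

theorem computableIn_pair {f : α → β} {g : α → γ} (hf : ComputableIn O f)
    (hg : ComputableIn O g) : ComputableIn O fun a => (f a, g a) :=
  (Nat.RecursiveIn.pair hf hg).of_eq fun n => by
    rcases Encodable.decode (α := α) n with - | a <;> simp [Seq.seq]

theorem computableIn_comp_primrec {f : β → σ} {g : α → β} (hf : ComputableIn O f)
    (hg : Primrec g) : ComputableIn O fun a => f (g a) :=
  computableIn_comp hf hg.computableIn

theorem computableIn_primrec₂_comp {f : β → γ → σ} {g : α → β} {h : α → γ} (hf : Primrec₂ f)
    (hg : ComputableIn O g) (hh : ComputableIn O h) : ComputableIn O fun a => f (g a) (h a) :=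
  computableIn_comp (hf.computableIn₂ (O := O)) (computableIn_pair hg hh)

theorem computableIn_cond {c : α → Bool} {f g : α → σ} (hc : ComputableIn O c)
    (hf : ComputableIn O f) (hg : ComputableIn O g) :
    ComputableIn O fun a => cond (c a) (f a) (g a) := by
  have h : Primrec fun p : Bool × σ × σ => cond p.1 p.2.1 p.2.2 :=
    Primrec.cond .fst (Primrec.fst.comp .snd) (Primrec.snd.comp .snd)
  exact computableIn_comp h.computableIn (computableIn_pair hc (computableIn_pair hf hg))

theorem computableIn_ite {c : α → Prop} [DecidablePred c] {f g : α → σ} (hc : PrimrecPred c)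
    (hf : ComputableIn O f) (hg : ComputableIn O g) :
    ComputableIn O fun a => if c a then f a else g a := by
  simpa only [Bool.cond_decide] using computableIn_cond hc.decide.computableIn hf hg

theorem computableIn_nat_rec {f : α → σ} {h : α × ℕ × σ → σ} (hf : ComputableIn O f)
    (hh : ComputableIn O h) :
    ComputableIn O fun p : α × ℕ => p.2.rec (motive := fun _ => σ) (f p.1)
      fun y IH => h (p.1, y, IH) :=
  (Nat.RecursiveIn.prec hf hh).of_eq fun n => by
    simp only [Encodable.decode_prod_val, Encodable.decode_nat]
    rcases e : Encodable.decode (α := α) n.unpair.1 with - | a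
    · induction n.unpair.2 <;> simp_all [Part.bind_none]
    · suffices H : ∀ k, Nat.rec (motive := fun _ => Part ℕ) (Part.some (Encodable.encode (f a)))
          (fun y IH => IH.bind fun i =>
            (↑(Option.map (Prod.mk a ∘ Prod.mk y) (Encodable.decode (α := σ) i)) :
              Part (α × ℕ × σ)).bind fun a => Part.some (Encodable.encode (h a))) k =
          Part.some (Encodable.encode (Nat.rec (motive := fun _ => σ) (f a)
            (fun y IH => h (a, y, IH)) k)) by
        simpa [e] using H _
      intro k
      induction k with
      | zero => simp
      | succ k ih => simp [ih, Encodable.encodek]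

theorem computableIn_map_range {g : α × ℕ → σ} (hg : ComputableIn O g) :
    ComputableIn O fun p : α × ℕ => (List.range p.2).map fun i => g (p.1, i) := by
  have hrec : ComputableIn O fun p : α × ℕ => p.2.rec (motive := fun _ => List σ) []
      fun i l => l ++ [g (p.1, i)] :=
    computableIn_nat_rec (h := fun p : α × ℕ × List σ => p.2.2 ++ [g (p.1, p.2.1)]) (.const [])
      (computableIn_primrec₂_comp (f := fun (l : List σ) a => l ++ [a]) Primrec.list_concat
        (Primrec.snd.comp .snd).computableIn
        (computableIn_comp_primrec hg (Primrec.fst.pair (Primrec.fst.comp .snd))))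
  refine cast (congrArg _ (funext fun p => ?_)) hrec
  induction p.2 with
  | zero => rfl
  | succ k ih => simp [List.range_succ, ← ih]

theorem computableIn_find {p : α × ℕ → Bool} (hp : ComputableIn O p) (k : α → ℕ)
    (hk : ∀ a, p (a, k a) = true) (hmin : ∀ a, ∀ j < k a, p (a, j) = false) :
    ComputableIn O k := by
  have hq : ComputableIn O fun x => cond (p x) 0 1 :=
    computableIn_cond hp (.const 0) (.const 1)
  refine (Nat.RecursiveIn.rfind hq).of_eq fun n => ?_
  rcases e : Encodable.decode (α := α) n with - | a
  · exact (Nat.rfind_zero_none _ (by simp [e])).trans (by simp)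
  · simp only [Part.coe_some, Part.bind_some, Part.map_some]
    refine Part.eq_some_iff.2 (Nat.mem_rfind.2 ⟨?_, fun {j} hj => ?_⟩)
    · simp [e, hk a]
    · simp [e, hmin a j hj]

end RelativeComputability

theorem exists_xComputable_indicator (X : Set ℕ) :
    ∃ χ : ℕ → Bool, XComputable X χ ∧ ∀ n, χ n = true ↔ n ∈ X := by
  classical
  have h : XComputable X fun n => if n ∈ X then 1 else 0 := RecursiveIn.iff_nat.2 (.oracle _ rfl)
  refine ⟨fun n => (if n ∈ X then 1 else 0) == 1,
    computableIn_primrec₂_comp Primrec.beq h (.const 1), fun n => ?_⟩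
  by_cases hn : n ∈ X <;> simp [hn]

theorem exists_xComputable (h : ℕ → ℕ) : ∃ X : Set ℕ, XComputable X h := by
  obtain ⟨χ, hχ, hX⟩ := exists_xComputable_indicator {x | x.unpair.2 = h x.unpair.1}
  refine ⟨_, computableIn_find (p := fun p : ℕ × ℕ => χ (Nat.pair p.1 p.2))
    (computableIn_comp hχ Primrec₂.natPair.computableIn₂) h (fun a => ?_) fun a j hj => ?_⟩
  · simp [hX]
  · rw [← Bool.not_eq_true, hX]; simp [hj.ne]

theorem exists_forall_xComputable {κ : Type*} [Primcodable κ] (h : ℕ → κ → ℕ) :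
    ∃ X : Set ℕ, ∀ i, XComputable X (h i) := by
  obtain ⟨X, hX⟩ := exists_xComputable fun n =>
    ((Encodable.decode (α := κ) n.unpair.2).map (h n.unpair.1)).getD 0
  refine ⟨X, fun i => ?_⟩
  simpa only [XComputable, Nat.unpair_pair, Encodable.encodek, Option.map_some,
    Option.getD_some] using computableIn_comp_primrec
      (g := fun a : κ => Nat.pair i (Encodable.encode a)) hX
      (Primrec₂.natPair.comp (.const i) .encode)

namespace InfForm

variable {L : FirstOrder.Language.{u, v}}

/-- The extension of a renaming of variables to the scope of a quantifier. -/
def liftMap {n n' : ℕ} (ρ : Fin n → Fin n') : Fin (n + 1) → Fin (n' + 1) :=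
  Fin.snoc (α := fun _ => Fin (n' + 1)) (fun i => (ρ i).castSucc) (Fin.last n')

/-- The extension of a renaming of variables to the scope of a block of `k` quantifiers. -/
def liftMaps {n n' : ℕ} (ρ : Fin n → Fin n') : ∀ k : ℕ, Fin (n + k) → Fin (n' + k)
  | 0 => ρ
  | k + 1 => liftMap (liftMaps ρ k)

/-- Renaming of the free variables. -/
def rename : ∀ {n n' : ℕ}, (Fin n → Fin n') → InfForm L n → InfForm L n'
  | _, _, _, falsum => falsum
  | _, _, ρ, equal t₁ t₂ => equal (t₁.relabel ρ) (t₂.relabel ρ)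
  | _, _, ρ, rel R ts => rel R fun j => (ts j).relabel ρ
  | _, _, ρ, neg φ => neg (φ.rename ρ)
  | _, _, ρ, and φ ψ => and (φ.rename ρ) (ψ.rename ρ)
  | _, _, ρ, or φ ψ => or (φ.rename ρ) (ψ.rename ρ)
  | _, _, ρ, iDisj φ => iDisj fun i => (φ i).rename ρ
  | _, _, ρ, iConj φ => iConj fun i => (φ i).rename ρ
  | _, _, ρ, ex φ => ex (φ.rename (liftMap ρ))
  | _, _, ρ, all φ => all (φ.rename (liftMap ρ))

theorem snoc_comp_liftMap {B : Type w} {n n' : ℕ} (ρ : Fin n → Fin n') (v : Fin n' → B) (z : B) :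
    (Fin.snoc v z : Fin (n' + 1) → B) ∘ liftMap ρ = (Fin.snoc (v ∘ ρ) z : Fin (n + 1) → B) := by
  funext i
  refine Fin.lastCases ?_ (fun j => ?_) i <;> simp [liftMap]

theorem realize_rename {B : Type w} [L.Structure B] : ∀ {n n' : ℕ} (ρ : Fin n → Fin n')
    (φ : InfForm L n) (v : Fin n' → B), (φ.rename ρ).Realize v ↔ φ.Realize (v ∘ ρ)
  | _, _, _, falsum, _ => Iff.rfl
  | _, _, ρ, equal t₁ t₂, v => by simp [rename, Realize]
  | _, _, ρ, rel R ts, v => by simp [rename, Realize]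
  | _, _, ρ, neg φ, v => not_congr (realize_rename ρ φ v)
  | _, _, ρ, and φ ψ, v => and_congr (realize_rename ρ φ v) (realize_rename ρ ψ v)
  | _, _, ρ, or φ ψ, v => or_congr (realize_rename ρ φ v) (realize_rename ρ ψ v)
  | _, _, ρ, iDisj φ, v => exists_congr fun i => realize_rename ρ (φ i) v
  | _, _, ρ, iConj φ, v => forall_congr' fun i => realize_rename ρ (φ i) v
  | _, _, ρ, ex φ, v => exists_congr fun z => by
      rw [realize_rename (liftMap ρ) φ, snoc_comp_liftMap]
  | _, _, ρ, all φ, v => forall_congr' fun z => by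
      rw [realize_rename (liftMap ρ) φ, snoc_comp_liftMap]

theorem realize_equiv {B : Type w} [L.Structure B] (σ : B ≃[L] B) : ∀ {n : ℕ}
    (φ : InfForm L n) (v : Fin n → B), φ.Realize (σ ∘ v) ↔ φ.Realize v
  | _, falsum, _ => Iff.rfl
  | _, equal t₁ t₂, v => by simp [Realize, FirstOrder.Language.HomClass.realize_term]
  | _, rel R ts, v => by
      simp only [Realize, FirstOrder.Language.HomClass.realize_term]
      exact FirstOrder.Language.StrongHomClass.map_rel σ R _
  | _, neg φ, v => not_congr (realize_equiv σ φ v)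
  | _, and φ ψ, v => and_congr (realize_equiv σ φ v) (realize_equiv σ ψ v)
  | _, or φ ψ, v => or_congr (realize_equiv σ φ v) (realize_equiv σ ψ v)
  | _, iDisj φ, v => exists_congr fun i => realize_equiv σ (φ i) v
  | _, iConj φ, v => forall_congr' fun i => realize_equiv σ (φ i) v
  | n, ex φ, v => by
      refine (σ.toEquiv.exists_congr fun z => ?_).symm
      rw [← realize_equiv σ φ, Fin.comp_snoc]; rfl
  | n, all φ, v => by
      refine (σ.toEquiv.forall_congr fun z => ?_).symm
      rw [← realize_equiv σ φ, Fin.comp_snoc]; rfl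

theorem realize_exs {B : Type w} [L.Structure B] {n : ℕ} : ∀ (k : ℕ) (φ : InfForm L (n + k))
    (v : Fin n → B), (exs k φ).Realize v ↔ ∃ z : Fin k → B, φ.Realize (Fin.append v z)
  | 0, φ, v => by
      constructor
      · intro h; exact ⟨Fin.elim0, by simpa [exs] using h⟩
      · rintro ⟨z, h⟩
        have hz : z = Fin.elim0 := Subsingleton.elim _ _
        subst hz; simpa [exs] using h
  | k + 1, φ, v => by
      rw [exs, realize_exs k]
      constructor
      · rintro ⟨z, y, h⟩
        exact ⟨Fin.snoc z y, by rwa [Fin.append_snoc]⟩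
      · rintro ⟨z, h⟩
        refine ⟨Fin.init z, z (Fin.last k), ?_⟩
        rwa [← Fin.append_snoc, Fin.snoc_init_self]

theorem rename_exs {n n' : ℕ} (ρ : Fin n → Fin n') : ∀ (k : ℕ) (φ : InfForm L (n + k)),
    (exs k φ).rename ρ = exs k (φ.rename (liftMaps ρ k))
  | 0, _ => rfl
  | k + 1, φ => by rw [exs, rename_exs ρ k]; rfl

theorem rename_alls {n n' : ℕ} (ρ : Fin n → Fin n') : ∀ (k : ℕ) (φ : InfForm L (n + k)),
    (alls k φ).rename ρ = alls k (φ.rename (liftMaps ρ k))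
  | 0, _ => rfl
  | k + 1, φ => by rw [alls, rename_alls ρ k]; rfl

theorem IsFinQF.rename : ∀ {n n' : ℕ} (ρ : Fin n → Fin n') {φ : InfForm L n}, φ.IsFinQF →
    (φ.rename ρ).IsFinQF
  | _, _, _, falsum, _ => trivial
  | _, _, _, equal _ _, _ => trivial
  | _, _, _, rel _ _, _ => trivial
  | _, _, ρ, neg φ, h => IsFinQF.rename ρ (φ := φ) h
  | _, _, ρ, and _ _, h => ⟨h.1.rename ρ, h.2.rename ρ⟩
  | _, _, ρ, or _ _, h => ⟨h.1.rename ρ, h.2.rename ρ⟩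

theorem IsFinitary.rename : ∀ {n n' : ℕ} (ρ : Fin n → Fin n') {φ : InfForm L n}, φ.IsFinitary →
    (φ.rename ρ).IsFinitary
  | _, _, _, falsum, _ => trivial
  | _, _, _, equal _ _, _ => trivial
  | _, _, _, rel _ _, _ => trivial
  | _, _, ρ, neg φ, h => IsFinitary.rename ρ (φ := φ) h
  | _, _, ρ, and _ _, h => ⟨h.1.rename ρ, h.2.rename ρ⟩
  | _, _, ρ, or _ _, h => ⟨h.1.rename ρ, h.2.rename ρ⟩
  | _, _, ρ, ex φ, h => IsFinitary.rename (liftMap ρ) (φ := φ) h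
  | _, _, ρ, all φ, h => IsFinitary.rename (liftMap ρ) (φ := φ) h

theorem IsFinitary.exs {n : ℕ} : ∀ (k : ℕ) {φ : InfForm L (n + k)}, φ.IsFinitary →
    (InfForm.exs k φ).IsFinitary
  | 0, _, h => h
  | k + 1, φ, h => IsFinitary.exs k (φ := ex φ) h

theorem InHierarchy.rename {s : Side} {α : Ordinal.{0}} {n : ℕ} {φ : InfForm L n}
    (h : InHierarchy s α φ) : ∀ {n' : ℕ} (ρ : Fin n → Fin n'), InHierarchy s α (φ.rename ρ) := by
  induction h with
  | qf s φ h => exact fun ρ => .qf s _ (h.rename ρ)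
  | sigma α β k ψ hβ _ ih =>
    intro n' ρ
    have := InHierarchy.sigma α β k (fun i => (ψ i).rename (liftMaps ρ (k i))) hβ
      fun i => ih i _
    simpa only [InfForm.rename, rename_exs] using this
  | pi α β k ψ hβ _ ih =>
    intro n' ρ
    have := InHierarchy.pi α β k (fun i => (ψ i).rename (liftMaps ρ (k i))) hβ
      fun i => ih i _
    simpa only [InfForm.rename, rename_alls] using this

/-- The labels of `exs k φ`, in terms of the labels `f` of `φ`. -/
def exsLabel : ℕ → (List ℕ → ℕ) → List ℕ → ℕ
  | 0, f, p => f p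
  | _ + 1, _, [] => Nat.pair 8 0
  | k + 1, f, 0 :: p => exsLabel k f p
  | _ + 1, _, (_ + 1) :: _ => Nat.pair 10 0

theorem exsLabel_exsLabel_one (f : List ℕ → ℕ) : ∀ (k : ℕ) (p : List ℕ),
    exsLabel k (exsLabel 1 f) p = exsLabel (k + 1) f p
  | 0, _ => rfl
  | _ + 1, [] => rfl
  | k + 1, 0 :: p => exsLabel_exsLabel_one f k p
  | _ + 1, (_ + 1) :: _ => rfl

theorem exsLabel_eq_ite (f : List ℕ → ℕ) : ∀ (k : ℕ) (p : List ℕ),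
    exsLabel k f p = if p.take k = List.replicate k 0 then f (p.drop k)
      else if p = List.replicate p.length 0 then Nat.pair 8 0 else Nat.pair 10 0
  | 0, _ => by simp [exsLabel]
  | _ + 1, [] => by simp [exsLabel, List.replicate_succ]
  | k + 1, 0 :: p => by simp [exsLabel, List.replicate_succ, exsLabel_eq_ite f k p]
  | _ + 1, (_ + 1) :: _ => by simp [exsLabel, List.replicate_succ]

theorem exsLabel_replicate_append (f : List ℕ → ℕ) (p : List ℕ) : ∀ k : ℕ,
    exsLabel k f (List.replicate k 0 ++ p) = f p
  | 0 => rfl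
  | k + 1 => exsLabel_replicate_append f p k

theorem exsLabel_replicate_of_lt (f : List ℕ → ℕ) : ∀ {k j : ℕ}, j < k →
    exsLabel k f (List.replicate j 0) = Nat.pair 8 0
  | _ + 1, 0, _ => rfl
  | k + 1, j + 1, h => exsLabel_replicate_of_lt f (k := k) (j := j) (by omega)

section Code

open Encodable

/-- The code of the term that is obtained from the term with code `e` by the renaming `σ`. -/
def renameTermCode (σ : ℕ → ℕ) (e : ℕ) : ℕ :=
  encode ((Denumerable.ofNat (List ℕ) e).map fun c => if c % 2 = 0 then 2 * σ (c / 2) else c)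

/-- The label that is obtained from the label `a` by the renaming `σ`. -/
def renameLabel (σ : ℕ → ℕ) (a : ℕ) : ℕ :=
  if a.unpair.1 = 1 then
    Nat.pair 1 (Nat.pair (renameTermCode σ a.unpair.2.unpair.1)
      (renameTermCode σ a.unpair.2.unpair.2))
  else if a.unpair.1 = 2 then
    Nat.pair 2 (Nat.pair a.unpair.2.unpair.1
      (encode ((Denumerable.ofNat (List ℕ) a.unpair.2.unpair.2).map (renameTermCode σ))))
  else a

/-- The renaming of variables that is coded by the list `ρ`: it sends `i` to the `i`-th entry of
`ρ`, and the variables after those in `ρ`, which are the bound ones, to the variables from `x_{n'}`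
on. -/
def listRenaming (ρ : List ℕ) (n' : ℕ) (x : ℕ) : ℕ := ρ.getD x (x - ρ.length + n')

theorem listRenaming_primrec :
    Primrec fun q : (List ℕ × ℕ) × ℕ => listRenaming q.1.1 q.1.2 q.2 := by
  have h : Primrec fun q : (List ℕ × ℕ) × ℕ =>
      (q.1.1[q.2]?).getD (q.2 - q.1.1.length + q.1.2) := by
    refine Primrec.option_getD.comp (Primrec.list_getElem?.comp (Primrec.fst.comp .fst) .snd)
      (Primrec.nat_add.comp (Primrec.nat_sub.comp .snd
        (Primrec.list_length.comp (Primrec.fst.comp .fst))) (Primrec.snd.comp .fst))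
  exact h.of_eq fun q => by simp [listRenaming]

theorem renameTermCode_primrec :
    Primrec fun q : (List ℕ × ℕ) × ℕ => renameTermCode (listRenaming q.1.1 q.1.2) q.2 := by
  refine Primrec.encode.comp (Primrec.list_map ((Primrec.ofNat (List ℕ)).comp .snd) ?_)
  refine Primrec.ite (Primrec.eq.comp (Primrec.nat_mod.comp .snd (.const 2)) (.const 0))
    (Primrec.nat_mul.comp (.const 2) ?_) .snd
  exact listRenaming_primrec.comp ((Primrec.fst.comp .fst).pair
    (Primrec.nat_div.comp .snd (.const 2)))

theorem renameLabel_primrec :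
    Primrec fun q : (List ℕ × ℕ) × ℕ => renameLabel (listRenaming q.1.1 q.1.2) q.2 := by
  have htag : Primrec fun q : (List ℕ × ℕ) × ℕ => q.2.unpair.1 :=
    Primrec.fst.comp (Primrec.unpair.comp .snd)
  have hargs : Primrec fun q : (List ℕ × ℕ) × ℕ => q.2.unpair.2 :=
    Primrec.snd.comp (Primrec.unpair.comp .snd)
  have hargs_fst : Primrec fun q : (List ℕ × ℕ) × ℕ => q.2.unpair.2.unpair.1 :=
    Primrec.fst.comp (Primrec.unpair.comp hargs)
  have hargs_snd : Primrec fun q : (List ℕ × ℕ) × ℕ => q.2.unpair.2.unpair.2 :=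
    Primrec.snd.comp (Primrec.unpair.comp hargs)
  refine Primrec.ite (Primrec.eq.comp htag (.const 1)) ?_
    (Primrec.ite (Primrec.eq.comp htag (.const 2)) ?_ .snd)
  · exact Primrec₂.natPair.comp (.const 1) (Primrec₂.natPair.comp
      (renameTermCode_primrec.comp (Primrec.fst.pair hargs_fst))
      (renameTermCode_primrec.comp (Primrec.fst.pair hargs_snd)))
  · refine Primrec₂.natPair.comp (.const 2) (Primrec₂.natPair.comp hargs_fst (Primrec.encode.comp
      (Primrec.list_map ((Primrec.ofNat (List ℕ)).comp hargs_snd) ?_)))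
    exact renameTermCode_primrec.comp ((Primrec.fst.comp .fst).pair .snd)

theorem ofNat_encode_list {α : Type*} [Encodable α] (l : List α) :
    Denumerable.ofNat (List ℕ) (encode l) = l.map encode := by
  have h : encode l = encode (l.map encode) := by
    induction l with
    | nil => rfl
    | cons a l ih => simp [ih]
  rw [h, Denumerable.ofNat_encode]

theorem encode_list_map_encode {α : Type*} [Encodable α] (l : List α) :
    encode (l.map encode) = encode l := by
  induction l with
  | nil => rfl
  | cons a l ih => simp [ih]

theorem listEncode_relabel {α β : Type*} (f : α → β) (t : L.Term α) :
    (t.relabel f).listEncode = t.listEncode.map (Sum.map f id) := by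
  induction t with
  | var => rfl
  | func g ts ih => simp [FirstOrder.Language.Term.listEncode, List.map_flatMap, ih]

variable [Encodable (Σ k, L.Functions k)]

theorem encode_relabel {n n' : ℕ} (ρ : Fin n → Fin n') (σ : ℕ → ℕ) (h : ∀ i : Fin n, σ i = ρ i)
    (t : L.Term (Fin n)) : encode (t.relabel ρ) = renameTermCode σ (encode t) := by
  have encode_term : ∀ {k : ℕ} (t : L.Term (Fin k)), encode t = encode t.listEncode :=
    fun _ => rfl
  have encode_fin : ∀ {k : ℕ} (a : Fin k), encode a = (a : ℕ) := fun _ => rfl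
  rw [encode_term, encode_term, renameTermCode, ofNat_encode_list, listEncode_relabel,
    List.map_map, ← encode_list_map_encode, List.map_map]
  refine congrArg encode (List.map_congr_left ?_)
  rintro (i | g) _
  · simp [encode_fin, h]
  · simp

variable [Encodable (Σ k, L.Relations k)]

theorem label_exs {n : ℕ} : ∀ (k : ℕ) (φ : InfForm L (n + k)) (p : List ℕ),
    (exs k φ).label p = exsLabel k φ.label p
  | 0, φ, p => rfl
  | k + 1, φ, p => by
    rw [exs, label_exs k, ← exsLabel_exsLabel_one]
    congr 1
    funext p
    rcases p with _ | ⟨_ | i, p⟩ <;> rfl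

theorem renameLabel_pair_of_ne (σ : ℕ → ℕ) {a : ℕ} (ha : a ≠ 1) (ha' : a ≠ 2) (c : ℕ) :
    renameLabel σ (Nat.pair a c) = Nat.pair a c := by
  simp [renameLabel, ha, ha']

theorem label_rename_nil {n n' : ℕ} (ρ : Fin n → Fin n') (σ : ℕ → ℕ)
    (h : ∀ i : Fin n, σ i = ρ i) (φ : InfForm L n) :
    (φ.rename ρ).label [] = renameLabel σ (φ.label []) := by
  cases φ with
  | equal t₁ t₂ => simp [rename, label, renameLabel, encode_relabel ρ σ h]
  | rel R ts =>
    simp only [rename, label, renameLabel, encode_relabel ρ σ h, Nat.unpair_pair,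
      OfNat.ofNat_ne_one, if_false, if_true, Denumerable.ofNat_encode, List.map_ofFn]
    rfl
  | _ => exact (renameLabel_pair_of_ne σ (by decide) (by decide) 0).symm

theorem eq_liftMap {n n' : ℕ} {ρ : Fin n → Fin n'} {σ : ℕ → ℕ} (h : ∀ i : Fin n, σ i = ρ i)
    (h' : ∀ d, σ (n + d) = n' + d) (i : Fin (n + 1)) : σ i = liftMap ρ i := by
  refine Fin.lastCases ?_ (fun j => ?_) i
  · simpa [liftMap] using h' 0
  · simp [liftMap, h]

theorem label_rename {n n' : ℕ} (ρ : Fin n → Fin n') (σ : ℕ → ℕ) (h : ∀ i : Fin n, σ i = ρ i)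
    (h' : ∀ d, σ (n + d) = n' + d) (φ : InfForm L n) (p : List ℕ) :
    (φ.rename ρ).label p = renameLabel σ (φ.label p) := by
  have hout : Nat.pair 10 0 = renameLabel σ (Nat.pair 10 0) :=
    (renameLabel_pair_of_ne σ (by decide) (by decide) 0).symm
  induction p generalizing n n' with
  | nil => exact label_rename_nil ρ σ h φ
  | cons i p ih =>
    cases φ with
    | falsum | equal | rel => exact hout
    | neg φ =>
      rcases i with _ | -
      · exact ih ρ h h' φ
      · exact hout
    | and φ ψ | or φ ψ =>
      rcases i with _ | _ | -
      · exact ih ρ h h' φ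
      · exact ih ρ h h' ψ
      · exact hout
    | iDisj φ | iConj φ => exact ih ρ h h' (φ i)
    | ex φ | all φ =>
      rcases i with _ | -
      · exact ih (liftMap ρ) (eq_liftMap h h') (fun d => by rw [add_assoc, h', add_assoc]) φ
      · exact hout

theorem label_rename_ofFn {n n' : ℕ} (ρ : Fin n → Fin n') (φ : InfForm L n) (p : List ℕ) :
    (φ.rename ρ).label p =
      renameLabel (listRenaming (List.ofFn fun i => (ρ i : ℕ)) n') (φ.label p) :=
  label_rename ρ _ (fun i => by simp [listRenaming]) (fun d => by simp [listRenaming, add_comm])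
    φ p

end Code

end InfForm

section Classes

variable {L : FirstOrder.Language.{u, v}}

namespace InfForm

/-- The true formula. -/
def top {n : ℕ} : InfForm L n := neg falsum

/-- The labels of `falsum`. -/
def falsumLabel (p : List ℕ) : ℕ := if p = [] then Nat.pair 0 0 else Nat.pair 10 0

/-- The labels of `top`. -/
def topLabel (p : List ℕ) : ℕ :=
  if p = [] then Nat.pair 3 0 else if p = [0] then Nat.pair 0 0 else Nat.pair 10 0

theorem falsumLabel_primrec : Primrec falsumLabel :=
  Primrec.ite (Primrec.eq.comp .id (.const [])) (.const _) (.const _)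

theorem topLabel_primrec : Primrec topLabel :=
  Primrec.ite (Primrec.eq.comp .id (.const [])) (.const _)
    (Primrec.ite (Primrec.eq.comp .id (.const [0])) (.const _) (.const _))

/-- The conjunction of finitely many formulas. -/
def finAnd {n : ℕ} : ∀ {N : ℕ}, (Fin N → InfForm L n) → InfForm L n
  | 0, _ => top
  | _ + 1, θ => and (θ 0) (finAnd fun a => θ a.succ)

theorem realize_finAnd {B : Type w} [L.Structure B] {n : ℕ} (v : Fin n → B) : ∀ {N : ℕ}
    (θ : Fin N → InfForm L n), (finAnd θ).Realize v ↔ ∀ a, (θ a).Realize v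
  | 0, _ => by simp [finAnd, top, Realize]
  | _ + 1, θ => by simp [finAnd, Realize, realize_finAnd v, Fin.forall_fin_succ]

theorem isFinQF_finAnd {n : ℕ} : ∀ {N : ℕ} (θ : Fin N → InfForm L n), (∀ a, (θ a).IsFinQF) →
    (finAnd θ).IsFinQF
  | 0, _, _ => trivial
  | _ + 1, _, h => ⟨h 0, isFinQF_finAnd _ fun a => h a.succ⟩

theorem isFinitary_finAnd {n : ℕ} : ∀ {N : ℕ} (θ : Fin N → InfForm L n),
    (∀ a, (θ a).IsFinitary) → (finAnd θ).IsFinitary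
  | 0, _, _ => trivial
  | _ + 1, _, h => ⟨h 0, isFinitary_finAnd _ fun a => h a.succ⟩

/-- The labels of `finAnd`, in terms of those of the conjuncts: the run of `1`s at the beginning of
a position selects the conjunct. -/
def finAndLabel (N : ℕ) (f : ℕ → List ℕ → ℕ) (p : List ℕ) : ℕ :=
  if N ≤ (p.takeWhile (· == 1)).length then topLabel (p.drop N)
  else if p.dropWhile (· == 1) = [] then Nat.pair 4 0
  else if (p.dropWhile (· == 1)).headI = 0 then
    f (p.takeWhile (· == 1)).length (p.dropWhile (· == 1)).tail
  else Nat.pair 10 0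

/-- The `j`-th component of a formula that is viewed as a countable conjunction, which has only one
component if it is not an `iConj`. -/
def component : ∀ {n : ℕ}, InfForm L n → ℕ → InfForm L n
  | _, iConj φ, j => φ j
  | _, φ, _ => φ

theorem realize_component {B : Type w} [L.Structure B] {n : ℕ} (φ : InfForm L n) (v : Fin n → B) :
    φ.Realize v ↔ ∀ j, (φ.component j).Realize v := by
  cases φ <;> simp [component, Realize]

theorem InHierarchy.component {n : ℕ} {β γ : Ordinal.{0}} {φ : InfForm L n}
    (h : InHierarchy Side.pi β φ) (hβ : β ≤ γ) (hγ : 0 < γ) (j : ℕ) :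
    ∃ δ < γ, ∃ (k : ℕ) (ψ : InfForm L (n + k)), φ.component j = alls k ψ ∧
      InHierarchy Side.sigma δ ψ := by
  cases h with
  | qf _ _ h =>
    refine ⟨0, hγ, 0, φ, ?_, .qf _ _ h⟩
    cases φ <;> first | rfl | exact h.elim
  | pi _ β' k ψ hβ' h => exact ⟨β' j, (hβ' j).trans_le hβ, k j, ψ j, rfl, h j⟩

/-- The conjunction of finitely many formulas, as the countable conjunction of all their components.
Unlike `finAnd` it does not leave the class `Π_β`. -/
def finIConj {n N : ℕ} (θ : Fin N → InfForm L n) : InfForm L n :=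
  iConj fun t => if h : t.unpair.1 < N then (θ ⟨t.unpair.1, h⟩).component t.unpair.2 else top

theorem realize_finIConj {B : Type w} [L.Structure B] {n N : ℕ} (θ : Fin N → InfForm L n)
    (v : Fin n → B) : (finIConj θ).Realize v ↔ ∀ a, (θ a).Realize v := by
  constructor
  · exact fun h a => (realize_component _ v).2 fun j => by simpa using h (Nat.pair a j)
  · intro h t
    dsimp only
    split_ifs with ht
    · exact (realize_component _ v).1 (h _) _
    · exact not_false

theorem InHierarchy.finIConj {n N : ℕ} {γ : Ordinal.{0}} (hγ : 0 < γ) {θ : Fin N → InfForm L n}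
    (hθ : ∀ a, ∃ β ≤ γ, InHierarchy Side.pi β (θ a)) :
    InHierarchy Side.pi γ (InfForm.finIConj θ) := by
  have hcomp : ∀ t : ℕ, ∃ δ < γ, ∃ (k : ℕ) (ψ : InfForm L (n + k)),
      (if h : t.unpair.1 < N then (θ ⟨t.unpair.1, h⟩).component t.unpair.2 else top) =
        alls k ψ ∧ InHierarchy Side.sigma δ ψ := by
    intro t
    split_ifs with ht
    · obtain ⟨β, hβ, h⟩ := hθ ⟨t.unpair.1, ht⟩
      exact h.component hβ hγ _
    · exact ⟨0, hγ, 0, top, rfl, .qf _ _ trivial⟩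
  choose δ hδ k ψ e hψ using hcomp
  simp only [InfForm.finIConj, e]
  exact .pi γ δ k ψ hδ hψ

theorem InHierarchy.isFinQF {n : ℕ} {β : Ordinal.{0}} {φ : InfForm L n}
    (h : InHierarchy Side.pi β φ) (hβ : β < 1) : φ.IsFinQF := by
  cases h with
  | qf _ _ h => exact h
  | pi _ β' _ _ hβ' => exact absurd (hβ' 0) (by simp [Order.lt_one_iff.1 hβ])

theorem InHierarchy.exists_eq_iDisj {n : ℕ} {α : Ordinal.{0}} (hα : 1 ≤ α) {φ : InfForm L n}
    (h : InHierarchy Side.sigma α φ) : ∃ (k : ℕ → ℕ) (ψ : ∀ i, InfForm L (n + k i)),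
      φ = iDisj (fun i => exs (k i) (ψ i)) ∧ ∀ i, ∃ β < α, InHierarchy Side.pi β (ψ i) := by
  cases h with
  | qf => exact absurd hα (by simp)
  | sigma _ β k ψ hβ h => exact ⟨k, ψ, rfl, fun i => ⟨β i, hβ i, h i⟩⟩

variable [Encodable (Σ k, L.Functions k)] [Encodable (Σ k, L.Relations k)]

theorem label_falsum {n : ℕ} (p : List ℕ) : (falsum : InfForm L n).label p = falsumLabel p := by
  rcases p with _ | ⟨_, _⟩ <;> rfl

theorem label_top {n : ℕ} (p : List ℕ) : (top : InfForm L n).label p = topLabel p := by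
  rcases p with _ | ⟨_ | _, _ | ⟨_, _⟩⟩ <;> rfl

theorem label_finAnd {n : ℕ} : ∀ {N : ℕ} (θ : Fin N → InfForm L n) (f : ℕ → List ℕ → ℕ)
    (_ : ∀ a p, f a.1 p = (θ a).label p) (p : List ℕ), (finAnd θ).label p = finAndLabel N f p
  | 0, _, _, _, p => by simp [finAnd, finAndLabel, label_top]
  | N + 1, θ, f, h, p => by
    rcases p with _ | ⟨_ | _ | i, p⟩
    · rfl
    · simpa [finAndLabel, finAnd, label] using (h 0 p).symm
    · have := label_finAnd (fun a => θ a.succ) (fun a => f (a + 1)) (fun a p => h a.succ p) p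
      simpa [finAndLabel, finAnd, label] using this
    · simp [finAndLabel, finAnd, label]

theorem label_component {n : ℕ} (φ : InfForm L n) (j : ℕ) (p : List ℕ) :
    (φ.component j).label p =
      if φ.label [] = Nat.pair 7 0 then φ.label (j :: p) else φ.label p := by
  cases φ <;> simp [component, label, Nat.pair_eq_pair]

theorem InHierarchy.label_ne {n : ℕ} {β : Ordinal.{0}} {φ : InfForm L n}
    (h : InHierarchy Side.pi β φ) : φ.label [] ≠ Nat.pair 8 0 := by
  cases h with
  | qf _ _ h => cases φ <;> first | exact h.elim | simp [label, Nat.pair_eq_pair]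
  | pi => simp [label, Nat.pair_eq_pair]

/-- The test whether exactly `k` existential quantifiers stand at the position `[j]` of a tree with
labels `f`. -/
def exCountIs (f : List ℕ → ℕ) (j k : ℕ) : Bool :=
  decide ((List.range (k + 1)).map (fun i => decide (f (j :: List.replicate i 0) = Nat.pair 8 0)) =
    List.replicate k true ++ [false])

theorem exCountIs_iff (f : List ℕ → ℕ) (j k : ℕ) : exCountIs f j k = true ↔
    (∀ i < k, f (j :: List.replicate i 0) = Nat.pair 8 0) ∧
      f (j :: List.replicate k 0) ≠ Nat.pair 8 0 := by
  simp [exCountIs, List.range_succ, List.eq_replicate_iff]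

theorem exCountIs_label_iff {n k : ℕ} {φ : ℕ → InfForm L n} {ψ : InfForm L (n + k)} {j : ℕ}
    (hφ : φ j = exs k ψ) (hψ : ψ.label [] ≠ Nat.pair 8 0) (K : ℕ) :
    exCountIs (iDisj φ).label j K = true ↔ K = k := by
  have hlabel : ∀ i, (iDisj φ).label (j :: List.replicate i 0) =
      exsLabel k ψ.label (List.replicate i 0) := fun i =>
    (congrArg (fun χ => label χ (List.replicate i 0)) hφ).trans (label_exs _ _ _)
  have hlabel_k : exsLabel k ψ.label (List.replicate k 0) = ψ.label [] := by
    simpa using exsLabel_replicate_append ψ.label [] k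
  simp only [exCountIs_iff, hlabel]
  constructor
  · rintro ⟨hbelow, hat⟩
    rcases lt_trichotomy k K with hlt | heq | hgt
    · exact absurd (hlabel_k.symm.trans (hbelow _ hlt)) hψ
    · exact heq.symm
    · exact absurd (exsLabel_replicate_of_lt _ hgt) hat
  · rintro rfl
    exact ⟨fun i hi => exsLabel_replicate_of_lt _ hi, hlabel_k ▸ hψ⟩

end InfForm

open InfForm

/-- The class of the `Σ_α` formulas, or of all formulas (for `none`), so that both cases can be
treated together. -/
def sigmaClass (L : FirstOrder.Language.{u, v}) : Option Ordinal.{0} → FormClass L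
  | none => allForms L
  | some α => sigmaForms L α

/-- The class of the formulas `ψ` such that the countable disjunctions of formulas `∃ ū ψ` are in
`sigmaClass`. -/
def matrixClass (L : FirstOrder.Language.{u, v}) : Option Ordinal.{0} → FormClass L
  | none => allForms L
  | some α => fun _ φ => ∃ β < α, φ.InHierarchy Side.pi β

/-- Closure of a class of formulas under renaming of the free variables. -/
def RenameClosed (Γ : FormClass L) : Prop :=
  ∀ {n n' : ℕ} {φ : InfForm L n} (ρ : Fin n → Fin n'), Γ n φ → Γ n' (φ.rename ρ)

variable {o : Option Ordinal.{0}}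

theorem renameClosed_sigmaClass : RenameClosed (sigmaClass L o) := fun ρ h => by
  cases o with
  | none => trivial
  | some α => exact InHierarchy.rename h ρ

theorem renameClosed_matrixClass : RenameClosed (matrixClass L o) := fun ρ h => by
  cases o with
  | none => trivial
  | some α => obtain ⟨β, hβ, h⟩ := h; exact ⟨β, hβ, h.rename ρ⟩

theorem matrixClass_falsum (ho : ∀ α ∈ o, 1 ≤ α) {n : ℕ} : matrixClass L o n falsum := by
  cases o with
  | none => trivial
  | some α => exact ⟨0, zero_lt_one.trans_le (ho α rfl), .qf _ _ trivial⟩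

theorem sigmaClass_iDisj {n : ℕ} {k : ℕ → ℕ} {ψ : ∀ j, InfForm L (n + k j)}
    (h : ∀ j, matrixClass L o _ (ψ j)) :
    sigmaClass L o n (iDisj fun j => exs (k j) (ψ j)) := by
  cases o with
  | none => trivial
  | some α => choose β hβ h using h; exact .sigma α β k ψ hβ h

theorem matrixClass_finIConj {α : Ordinal.{0}} (hα : 1 < α) {n N : ℕ} {θ : Fin N → InfForm L n}
    (h : ∀ a, matrixClass L (some α) n (θ a)) : matrixClass L (some α) n (finIConj θ) := by
  choose β hβ h using h
  refine ⟨max 1 (Finset.univ.sup β), max_lt hα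
    ((Finset.sup_lt_iff (zero_lt_one.trans hα)).2 fun a _ => hβ a), ?_⟩
  exact .finIConj (zero_lt_one.trans_le (le_max_left _ _)) fun a =>
    ⟨β a, (Finset.le_sup (Finset.mem_univ a)).trans (le_max_right _ _), h a⟩

theorem matrixClass_finAnd (ho : ∀ α ∈ o, α = 1) {n N : ℕ} {θ : Fin N → InfForm L n}
    (h : ∀ a, matrixClass L o n (θ a)) : matrixClass L o n (finAnd θ) := by
  cases o with
  | none => trivial
  | some α =>
    obtain rfl := ho α rfl
    refine ⟨0, zero_lt_one, .qf _ _ (isFinQF_finAnd θ fun a => ?_)⟩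
    obtain ⟨β, hβ, h⟩ := h a
    exact h.isFinQF hβ

end Classes

open InfForm

section ComputableVia

variable {ι ι' κ κ' σ τ : Type*} [Primcodable κ] [Primcodable κ'] [Primcodable σ] [Primcodable τ]
  {X : Set ℕ} {code : ι → κ}

/-- The function `f` factors through `code` and an `X`-computable function: `f i` is computable
from `X` and `code i`, uniformly in `i`. -/
def ComputableVia (X : Set ℕ) (code : ι → κ) (f : ι → σ) : Prop :=
  ∃ g : κ → σ, XComputable X g ∧ ∀ i, g (code i) = f i

theorem ComputableVia.of_primrec {g : κ → σ} (hg : Primrec g) {f : ι → σ}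
    (h : ∀ i, g (code i) = f i) : ComputableVia X code f :=
  ⟨g, hg.computableIn, h⟩

theorem ComputableVia.congr {f f' : ι → σ} (hf : ComputableVia X code f) (h : ∀ i, f i = f' i) :
    ComputableVia X code f' :=
  funext h ▸ hf

theorem ComputableVia.pair {f : ι → σ} {f' : ι → τ} (hf : ComputableVia X code f)
    (hf' : ComputableVia X code f') : ComputableVia X code fun i => (f i, f' i) := by
  obtain ⟨g, hg, e⟩ := hf
  obtain ⟨g', hg', e'⟩ := hf'
  exact ⟨_, computableIn_pair hg hg', fun i => by simp only [e, e']⟩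

theorem ComputableVia.reindex {f : ι → σ} (hf : ComputableVia X code f) {code' : ι' → κ'}
    {e : ι' → ι} (he : ComputableVia X code' fun i => code (e i)) :
    ComputableVia X code' fun i => f (e i) := by
  obtain ⟨g, hg, hf⟩ := hf
  obtain ⟨c, hc, he⟩ := he
  exact ⟨_, computableIn_comp hg hc, fun i => by rw [he, hf]⟩

theorem ComputableVia.primrec_comp {g : σ → τ} (hg : Primrec g) {f : ι → σ}
    (hf : ComputableVia X code f) : ComputableVia X code fun i => g (f i) := by
  obtain ⟨g', hg', e⟩ := hf
  exact ⟨_, computableIn_comp hg.computableIn hg', fun i => by rw [e]⟩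

theorem ComputableVia.primrec₂_comp {υ : Type*} [Primcodable υ] {g : σ → τ → υ} (hg : Primrec₂ g)
    {f : ι → σ} {f' : ι → τ} (hf : ComputableVia X code f) (hf' : ComputableVia X code f') :
    ComputableVia X code fun i => g (f i) (f' i) :=
  (hf.pair hf').primrec_comp hg

end ComputableVia

section LabelComputable

variable {L : FirstOrder.Language.{u, v}} {ι ι' κ κ' : Type*} [Primcodable κ] [Primcodable κ']
  [Encodable (Σ k, L.Functions k)] [Encodable (Σ k, L.Relations k)] {X : Set ℕ} {n : ι → ℕ}
  {code : ι → κ} {code' : ι' → κ'}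

/-- The labelled trees of the formulas `φ i` are computable in `X`, uniformly in `code i`. -/
def LabelComputable (X : Set ℕ) (code : ι → κ) (φ : ∀ i, InfForm L (n i)) : Prop :=
  ComputableVia X (fun q : ι × List ℕ => (code q.1, q.2)) fun q => (φ q.1).label q.2

theorem LabelComputable.reindex {φ : ∀ i, InfForm L (n i)} (hφ : LabelComputable X code φ)
    {e : ι' → ι} (he : ComputableVia X code' fun i => code (e i)) :
    LabelComputable X code' fun i => φ (e i) :=
  ComputableVia.reindex (e := fun q : ι' × List ℕ => (e q.1, q.2)) hφ
    ((he.reindex (.of_primrec .fst fun _ => rfl)).pair (.of_primrec .snd fun _ => rfl))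

theorem labelComputable_falsum : LabelComputable X code fun i => (falsum : InfForm L (n i)) :=
  .of_primrec (falsumLabel_primrec.comp .snd) fun q => (label_falsum q.2).symm

theorem labelComputable_top : LabelComputable X code fun i => (top : InfForm L (n i)) :=
  .of_primrec (topLabel_primrec.comp .snd) fun q => (label_top q.2).symm

theorem LabelComputable.rename {φ : ∀ i, InfForm L (n i)} (hφ : LabelComputable X code φ)
    {n' : ι → ℕ} {ρ : ∀ i, Fin (n i) → Fin (n' i)} (hn' : ComputableVia X code n')
    (hρ : ComputableVia X code fun i => List.ofFn fun x => (ρ i x : ℕ)) :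
    LabelComputable X code fun i => (φ i).rename (ρ i) := by
  obtain ⟨r, hr, er⟩ := (hρ.pair hn').reindex (code' := fun q : ι × List ℕ => (code q.1, q.2))
    (.of_primrec .fst fun _ => rfl)
  obtain ⟨g, hg, e⟩ := hφ
  refine ⟨_, computableIn_comp renameLabel_primrec.computableIn (computableIn_pair hr hg),
    fun q => ?_⟩
  simp only [er, e, label_rename_ofFn]

theorem LabelComputable.dite {p : ι → Prop} [DecidablePred p]
    (hp : ComputableVia X code fun i => decide (p i)) {φ : ∀ i : {i // p i}, InfForm L (n i)}
    (hφ : LabelComputable X (fun i : {i // p i} => code i) φ) {ψ : ∀ i, InfForm L (n i)}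
    (hψ : LabelComputable X code ψ) :
    LabelComputable X code fun i => if h : p i then φ ⟨i, h⟩ else ψ i := by
  obtain ⟨c, hc, ec⟩ := hp
  obtain ⟨g, hg, e⟩ := hφ
  obtain ⟨g', hg', e'⟩ := hψ
  refine ⟨_, computableIn_cond (computableIn_comp_primrec hc .fst) hg hg', fun q => ?_⟩
  by_cases h : p q.1
  · simpa [ec, h] using e (⟨q.1, h⟩, q.2)
  · simpa [ec, h] using e' q

theorem LabelComputable.component {φ : ∀ i, InfForm L (n i)} (hφ : LabelComputable X code φ) :
    LabelComputable X (fun q : ι × ℕ => (code q.1, q.2)) fun q => (φ q.1).component q.2 := by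
  obtain ⟨g, hg, e⟩ := hφ
  have hc : Primrec fun q : (κ × ℕ) × List ℕ => q.1.1 := Primrec.fst.comp .fst
  refine ⟨fun q => bif decide (g (q.1.1, []) = Nat.pair 7 0) then g (q.1.1, q.1.2 :: q.2)
      else g (q.1.1, q.2), computableIn_cond ?_ ?_ ?_, fun q => ?_⟩
  · exact computableIn_primrec₂_comp Primrec.eq.decide
      (computableIn_comp_primrec hg (hc.pair (.const []))) (.const _)
  · exact computableIn_comp_primrec hg
      (hc.pair (Primrec.list_cons.comp (Primrec.snd.comp .fst) .snd))
  · exact computableIn_comp_primrec hg (hc.pair .snd)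
  · simp only [fun p => e (q.1.1, p), label_component, Bool.cond_eq_ite, decide_eq_true_eq]

theorem labelComputable_iConj {φ : ∀ i, ℕ → InfForm L (n i)}
    (hφ : LabelComputable X (fun q : ι × ℕ => (code q.1, q.2)) fun q => φ q.1 q.2) :
    LabelComputable X code fun i => iConj (φ i) := by
  obtain ⟨g, hg, e⟩ := hφ
  refine ⟨_, computableIn_ite (c := fun q : κ × List ℕ => q.2 = [])
    (Primrec.eq.comp .snd (.const [])) (.const (Nat.pair 7 0))
    (computableIn_comp_primrec (g := fun q => ((q.1, q.2.headI), q.2.tail)) hg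
      ((Primrec.fst.pair (Primrec.list_headI.comp .snd)).pair (Primrec.list_tail.comp .snd))), ?_⟩
  rintro ⟨i, _ | ⟨j, p⟩⟩
  · rfl
  · exact e ((i, j), p)

theorem labelComputable_iDisj {φ : ∀ i, ℕ → InfForm L (n i)}
    (hφ : LabelComputable X (fun q : ι × ℕ => (code q.1, q.2)) fun q => φ q.1 q.2) :
    LabelComputable X code fun i => iDisj (φ i) := by
  obtain ⟨g, hg, e⟩ := hφ
  refine ⟨_, computableIn_ite (c := fun q : κ × List ℕ => q.2 = [])
    (Primrec.eq.comp .snd (.const [])) (.const (Nat.pair 6 0))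
    (computableIn_comp_primrec (g := fun q => ((q.1, q.2.headI), q.2.tail)) hg
      ((Primrec.fst.pair (Primrec.list_headI.comp .snd)).pair (Primrec.list_tail.comp .snd))), ?_⟩
  rintro ⟨i, _ | ⟨j, p⟩⟩
  · rfl
  · exact e ((i, j), p)

theorem replicate_zero_primrec : Primrec fun k : ℕ => List.replicate k 0 :=
  (Primrec.list_map Primrec.list_range ((Primrec.const 0).to₂)).of_eq fun k => by simp

theorem computableIn_exsLabel {α : Type*} [Primcodable α] {O : Set (ℕ →. ℕ)} {k : α → ℕ}
    {g : α × List ℕ → ℕ} (hk : ComputableIn O k) (hg : ComputableIn O g) :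
    ComputableIn O fun a : α × List ℕ => exsLabel (k a.1) (fun q => g (a.1, q)) a.2 := by
  have hk' : ComputableIn O fun a : α × List ℕ => k a.1 := computableIn_comp_primrec hk .fst
  have hdrop : ComputableIn O fun a : α × List ℕ => g (a.1, a.2.drop (k a.1)) :=
    computableIn_comp hg (computableIn_pair .fst
      (computableIn_primrec₂_comp Primrec.list_drop hk' .snd))
  have htake : ComputableIn O fun a : α × List ℕ =>
      decide (a.2.take (k a.1) = List.replicate (k a.1) 0) :=
    computableIn_primrec₂_comp Primrec.eq.decide
      (computableIn_primrec₂_comp Primrec.list_take hk' .snd)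
      (computableIn_comp replicate_zero_primrec.computableIn hk')
  have hzeros : PrimrecPred fun a : α × List ℕ => a.2 = List.replicate a.2.length 0 :=
    Primrec.eq.comp .snd (replicate_zero_primrec.comp (Primrec.list_length.comp .snd))
  refine cast (congrArg _ (funext fun a => ?_)) (computableIn_cond htake hdrop
    (computableIn_ite hzeros (.const (Nat.pair 8 0)) (.const (Nat.pair 10 0))))
  simp only [exsLabel_eq_ite, Bool.cond_eq_ite, decide_eq_true_eq]

theorem labelComputable_exs {k : ι → ℕ} (hk : ComputableVia X code k)
    {ψ : ∀ i, InfForm L (n i + k i)} (hψ : LabelComputable X code ψ) :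
    LabelComputable X code fun i => exs (k i) (ψ i) := by
  obtain ⟨gk, hgk, ek⟩ := hk
  obtain ⟨g, hg, e⟩ := hψ
  refine ⟨_, computableIn_exsLabel hgk hg, fun q => ?_⟩
  simp only [ek, label_exs]
  exact congrArg (exsLabel _ · q.2) (funext fun p => e (q.1, p))

variable {N : ι → ℕ} {θ : ∀ i, Fin (N i) → InfForm L (n i)}

theorem labelComputable_finIConj (hN : ComputableVia X code N)
    (hθ : LabelComputable X (fun q : Σ i, Fin (N i) => (code q.1, (q.2 : ℕ)))
      fun q => θ q.1 q.2) : LabelComputable X code fun i => finIConj (θ i) := by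
  refine labelComputable_iConj (LabelComputable.dite (code := fun q : ι × ℕ => (code q.1, q.2))
    (n := fun q => n q.1) (p := fun q : ι × ℕ => q.2.unpair.1 < N q.1)
    (φ := fun q => (θ q.1.1 ⟨q.1.2.unpair.1, q.2⟩).component q.1.2.unpair.2) ?_ ?_
    labelComputable_top)
  · exact ComputableVia.primrec₂_comp Primrec.nat_lt.decide
      (.of_primrec (Primrec.fst.comp (Primrec.unpair.comp .snd)) fun _ => rfl)
      (hN.reindex (.of_primrec .fst fun _ => rfl))
  · refine hθ.component.reindex (e := fun q : {q : ι × ℕ // q.2.unpair.1 < N q.1} =>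
      ((⟨q.1.1, q.1.2.unpair.1, q.2⟩ : Σ i, Fin (N i)), q.1.2.unpair.2))
      (.of_primrec (g := fun q => ((q.1, q.2.unpair.1), q.2.unpair.2)) ?_ fun _ => rfl)
    exact (Primrec.fst.pair (Primrec.fst.comp (Primrec.unpair.comp .snd))).pair
      (Primrec.snd.comp (Primrec.unpair.comp .snd))

theorem labelComputable_finAnd (hN : ComputableVia X code N)
    (hθ : LabelComputable X (fun q : Σ i, Fin (N i) => (code q.1, (q.2 : ℕ)))
      fun q => θ q.1 q.2) : LabelComputable X code fun i => finAnd (θ i) := by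
  obtain ⟨gN, hgN, eN⟩ := hN
  obtain ⟨g, hg, e⟩ := hθ
  have hgN' : XComputable X fun q : κ × List ℕ => gN q.1 := computableIn_comp_primrec hgN .fst
  have hone : Primrec fun x : ℕ => x == 1 := Primrec.beq.comp .id (.const 1)
  have htake : Primrec fun q : κ × List ℕ => (q.2.takeWhile (· == 1)).length :=
    Primrec.list_length.comp ((Primrec.list_takeWhile hone).comp .snd)
  have hdrop : Primrec fun q : κ × List ℕ => q.2.dropWhile (· == 1) :=
    (Primrec.list_dropWhile hone).comp .snd
  have hlabel := computableIn_cond (computableIn_primrec₂_comp Primrec.nat_le.decide hgN'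
      htake.computableIn)
    (computableIn_comp topLabel_primrec.computableIn
      (computableIn_primrec₂_comp Primrec.list_drop hgN' .snd))
    (computableIn_ite (Primrec.eq.comp hdrop (.const [])) (.const (Nat.pair 4 0))
      (computableIn_ite (Primrec.eq.comp (Primrec.list_headI.comp hdrop) (.const 0))
        (computableIn_comp_primrec hg
          ((Primrec.fst.pair htake).pair (Primrec.list_tail.comp hdrop)))
        (.const (Nat.pair 10 0))))
  refine ⟨_, hlabel, fun q => ?_⟩
  dsimp only
  rw [label_finAnd (θ q.1) (fun a p => g ((code q.1, a), p)) fun a p => e (⟨q.1, a⟩, p)]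
  simp only [finAndLabel, Bool.cond_eq_ite, decide_eq_true_eq, eN]

end LabelComputable

section UniformlyDefinable

variable {L : FirstOrder.Language.{u, v}} {B : Type w} [L.Structure B]
  [Encodable (Σ k, L.Functions k)] [Encodable (Σ k, L.Relations k)] {ι ι' κ κ' : Type*}
  [Primcodable κ] [Primcodable κ'] {X : Set ℕ} {n : ι → ℕ} {code : ι → κ} {code' : ι' → κ'}
  {Γ : FormClass L} {S : ∀ i, Set (Fin (n i) → B)}

/-- The relations `S i` are defined by formulas in `Γ` whose labelled trees are computable in `X`,
uniformly in `code i`. -/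
def UniformlyDefinable (Γ : FormClass L) (X : Set ℕ) (code : ι → κ)
    (S : ∀ i, Set (Fin (n i) → B)) : Prop :=
  ∃ φ : ∀ i, InfForm L (n i),
    (∀ i, Γ _ (φ i)) ∧ (∀ i v, v ∈ S i ↔ (φ i).Realize v) ∧ LabelComputable X code φ

theorem UniformlyDefinable.comap (hΓ : RenameClosed Γ) (hS : UniformlyDefinable Γ X code S)
    {e : ι' → ι} (he : ComputableVia X code' fun i => code (e i)) {n' : ι' → ℕ}
    (hn' : ComputableVia X code' n') {ρ : ∀ i, Fin (n (e i)) → Fin (n' i)}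
    (hρ : ComputableVia X code' fun i => List.ofFn fun x => (ρ i x : ℕ)) :
    UniformlyDefinable Γ X code' fun i => {v : Fin (n' i) → B | v ∘ ρ i ∈ S (e i)} := by
  obtain ⟨φ, hφΓ, hφ, hφX⟩ := hS
  exact ⟨fun i => (φ (e i)).rename (ρ i), fun i => hΓ _ (hφΓ _),
    fun i v => (hφ _ _).trans (realize_rename _ _ _).symm, (hφX.reindex he).rename hn' hρ⟩

theorem UniformlyDefinable.reindex (hS : UniformlyDefinable Γ X code S) {e : ι' → ι}
    (he : ComputableVia X code' fun i => code (e i)) :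
    UniformlyDefinable Γ X code' fun i => S (e i) := by
  obtain ⟨φ, hφΓ, hφ, hφX⟩ := hS
  exact ⟨fun i => φ (e i), fun i => hφΓ _, fun i => hφ _, hφX.reindex he⟩

theorem UniformlyDefinable.dite {p : ι → Prop} [DecidablePred p]
    (hp : ComputableVia X code fun i => decide (p i))
    {S : ∀ i : {i // p i}, Set (Fin (n i) → B)} {T : ∀ i, Set (Fin (n i) → B)}
    (hS : UniformlyDefinable Γ X (fun i : {i // p i} => code i) S)
    (hT : UniformlyDefinable Γ X code T) :
    UniformlyDefinable Γ X code fun i => if h : p i then S ⟨i, h⟩ else T i := by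
  obtain ⟨φ, hφΓ, hφ, hφX⟩ := hS
  obtain ⟨ψ, hψΓ, hψ, hψX⟩ := hT
  refine ⟨_, fun i => ?_, fun i v => ?_, hφX.dite hp hψX⟩
  · by_cases h : p i
    · simpa only [dif_pos h] using hφΓ ⟨i, h⟩
    · simpa only [dif_neg h] using hψΓ i
  · by_cases h : p i
    · simpa only [dif_pos h] using hφ ⟨i, h⟩ v
    · simpa only [dif_neg h] using hψ i v

variable {o : Option Ordinal.{0}}

theorem exists_matrix_of_exs (ho : ∀ α ∈ o, 1 ≤ α) {k : ι → ℕ → ℕ}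
    {ψ : ∀ i j, InfForm L (n i + k i j)} (hψ : ∀ i j, matrixClass L o _ (ψ i j))
    (hk : ComputableVia X (fun q : ι × ℕ × ℕ => (code q.1, q.2))
      fun q => decide (q.2.2 = k q.1 q.2.1))
    (hψX : LabelComputable X (fun q : ι × ℕ => (code q.1, q.2, k q.1 q.2)) fun q => ψ q.1 q.2) :
    ∃ T : ∀ q : ι × ℕ × ℕ, Set (Fin (n q.1 + q.2.2) → B),
      UniformlyDefinable (matrixClass L o) X (fun q => (code q.1, q.2)) T ∧
      ∀ i v, (∃ j z, (ψ i j).Realize (Fin.append v z)) ↔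
        ∃ j K, ∃ z : Fin K → B, Fin.append v z ∈ T (i, j, K) := by
  let χ : ∀ q : {q : ι × ℕ × ℕ // q.2.2 = k q.1 q.2.1}, InfForm L (n q.1.1 + q.1.2.2) :=
    fun q => q.2 ▸ ψ q.1.1 q.1.2.1
  have hχ : ∀ q, matrixClass L o _ (χ q) := by
    rintro ⟨⟨i, j, K⟩, hK⟩
    obtain rfl : K = k i j := hK
    exact hψ i j
  have hχX : LabelComputable X (fun q : {q : ι × ℕ × ℕ // q.2.2 = k q.1 q.2.1} =>
      (code q.1.1, q.1.2)) χ := by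
    obtain ⟨g, hg, e⟩ := hψX
    refine ⟨g, hg, ?_⟩
    rintro ⟨⟨⟨i, j, K⟩, hK⟩, p⟩
    obtain rfl : K = k i j := hK
    exact e ((i, j), p)
  let θ : ∀ q : ι × ℕ × ℕ, InfForm L (n q.1 + q.2.2) :=
    fun q => if h : q.2.2 = k q.1 q.2.1 then χ ⟨q, h⟩ else falsum
  have hθ : ∀ i j, θ (i, j, k i j) = ψ i j := fun i j => dif_pos rfl
  refine ⟨fun q => {w | (θ q).Realize w}, ⟨θ, fun q => ?_, fun _ _ => Iff.rfl,
    hχX.dite hk labelComputable_falsum⟩, fun i v => ⟨?_, ?_⟩⟩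
  · by_cases h : q.2.2 = k q.1 q.2.1
    · simpa only [θ, dif_pos h] using hχ ⟨q, h⟩
    · simpa only [θ, dif_neg h] using matrixClass_falsum ho
  · rintro ⟨j, z, h⟩
    exact ⟨j, k i j, z, by simpa only [Set.mem_ofPred_eq, hθ] using h⟩
  · rintro ⟨j, K, z, h⟩
    by_cases hK : K = k i j
    · subst hK
      exact ⟨j, z, by simpa only [Set.mem_ofPred_eq, hθ] using h⟩
    · simp [θ, hK, Realize] at h

theorem computableIn_exCountIs {α : Type*} [Primcodable α] {O : Set (ℕ →. ℕ)}
    {g : α × List ℕ → ℕ} (hg : ComputableIn O g) :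
    ComputableIn O fun q : α × ℕ × ℕ => exCountIs (fun p => g (q.1, p)) q.2.1 q.2.2 := by
  have hzeros : Primrec fun q : (α × ℕ) × ℕ => (q.1.1, q.1.2 :: List.replicate q.2 0) :=
    (Primrec.fst.comp .fst).pair (Primrec.list_cons.comp (Primrec.snd.comp .fst)
      (replicate_zero_primrec.comp .snd))
  have htest : ComputableIn O fun q : (α × ℕ) × ℕ =>
      decide (g (q.1.1, q.1.2 :: List.replicate q.2 0) = Nat.pair 8 0) :=
    computableIn_primrec₂_comp Primrec.eq.decide (computableIn_comp_primrec hg hzeros) (.const _)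
  have hcount : Primrec fun q : α × ℕ × ℕ => ((q.1, q.2.1), q.2.2 + 1) :=
    (Primrec.fst.pair (Primrec.fst.comp .snd)).pair
      (Primrec.succ.comp (Primrec.snd.comp .snd))
  have htrue : Primrec fun K : ℕ => List.replicate K true ++ [false] :=
    (Primrec.list_concat.comp (Primrec.list_map Primrec.list_range (Primrec.const true).to₂)
      (.const false)).of_eq fun K => by simp
  exact computableIn_primrec₂_comp Primrec.eq.decide
    (computableIn_comp_primrec (computableIn_map_range htest) hcount)
    (htrue.comp (Primrec.snd.comp .snd)).computableIn

/-- Normal form of a uniformly definable family of relations: the block of existential quantifiers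
in front of the matrix with index `(i, j, K)` has length `K`. -/
theorem UniformlyDefinable.exists_matrix (ho : ∀ α ∈ o, 1 ≤ α)
    (hS : UniformlyDefinable (sigmaClass L o) X code S) :
    ∃ T : ∀ q : ι × ℕ × ℕ, Set (Fin (n q.1 + q.2.2) → B),
      UniformlyDefinable (matrixClass L o) X (fun q => (code q.1, q.2)) T ∧
      ∀ i v, v ∈ S i ↔ ∃ j K, ∃ z : Fin K → B, Fin.append v z ∈ T (i, j, K) := by
  obtain ⟨φ, hφΓ, hφ, hφX⟩ := hS
  cases o with
  | none =>
    obtain ⟨T, hT, hTφ⟩ := exists_matrix_of_exs (B := B) ho (k := fun _ _ => 0)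
      (ψ := fun i _ => φ i) (fun _ _ => trivial)
      (.of_primrec (Primrec.eq.decide.comp (Primrec.snd.comp .snd) (.const 0)) fun _ => rfl)
      (hφX.reindex (.of_primrec .fst fun _ => rfl))
    refine ⟨T, hT, fun i v => (hφ i v).trans (Iff.trans ?_ (hTφ i v))⟩
    simp [Fin.append_right_nil]
  | some α =>
    choose k ψ hψ hψΓ using fun i => (hφΓ i).exists_eq_iDisj (ho α rfl)
    obtain rfl : φ = fun i => iDisj fun j => exs (k i j) (ψ i j) := funext hψ
    obtain ⟨g, hg, e⟩ := hφX
    have hk : ComputableVia X (fun q : ι × ℕ × ℕ => (code q.1, q.2))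
        fun q => decide (q.2.2 = k q.1 q.2.1) := by
      refine ⟨_, computableIn_exCountIs hg, fun q => ?_⟩
      obtain ⟨β, -, hβ⟩ := hψΓ q.1 q.2.1
      rw [Bool.eq_iff_iff, decide_eq_true_iff, ← exCountIs_label_iff
        (φ := fun j => exs (k q.1 j) (ψ q.1 j)) rfl hβ.label_ne]
      exact iff_of_eq (congrArg (exCountIs · _ _ = true) (funext fun p => e (q.1, p)))
    have hψX : LabelComputable X (fun q : ι × ℕ => (code q.1, q.2, k q.1 q.2))
        fun q => ψ q.1 q.2 := by
      refine ⟨fun q => g (q.1.1, q.1.2.1 :: (List.replicate q.1.2.2 0 ++ q.2)),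
        computableIn_comp_primrec hg ?_, fun q => (e (q.1.1, _)).trans ?_⟩
      · exact (Primrec.fst.comp .fst).pair (Primrec.list_cons.comp
          (Primrec.fst.comp (Primrec.snd.comp .fst)) (Primrec.list_append.comp
            (replicate_zero_primrec.comp (Primrec.snd.comp (Primrec.snd.comp .fst))) .snd))
      · exact (label_exs _ _ _).trans (exsLabel_replicate_append _ _ _)
    obtain ⟨T, hT, hTψ⟩ := exists_matrix_of_exs (B := B) ho hψΓ hk hψX
    refine ⟨T, hT, fun i v => (hφ i v).trans (Iff.trans ?_ (hTψ i v))⟩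
    simp only [Realize, realize_exs]

theorem UniformlyDefinable.exists_append_matrix {J : Type*} [Denumerable J] {k : ι → J → ℕ}
    (hk : ComputableVia X (fun q : ι × J => (code q.1, q.2)) fun q => k q.1 q.2)
    {T : ∀ q : ι × J, Set (Fin (n q.1 + k q.1 q.2) → B)}
    (hT : UniformlyDefinable (matrixClass L o) X (fun q : ι × J => (code q.1, q.2)) T) :
    UniformlyDefinable (sigmaClass L o) X code fun i => {v | ∃ j z, Fin.append v z ∈ T (i, j)} := by
  obtain ⟨ψ, hψΓ, hψ, hψX⟩ := hT
  have hdecode : ComputableVia X (fun q : ι × ℕ => (code q.1, q.2))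
      fun q => (code q.1, Denumerable.ofNat J q.2) :=
    .of_primrec (Primrec.fst.pair ((Primrec.ofNat J).comp .snd)) fun _ => rfl
  refine ⟨fun i => iDisj fun j => exs _ (ψ (i, Denumerable.ofNat J j)),
    fun i => sigmaClass_iDisj fun j => hψΓ (i, Denumerable.ofNat J j), fun i v => ?_,
    labelComputable_iDisj
      (labelComputable_exs (n := fun q : ι × ℕ => n q.1)
        (k := fun q => k q.1 (Denumerable.ofNat J q.2))
        (hk.reindex (e := fun q : ι × ℕ => (q.1, Denumerable.ofNat J q.2)) hdecode)
        (ψ := fun q => ψ (q.1, Denumerable.ofNat J q.2)) (hψX.reindex hdecode))⟩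
  simp only [Set.mem_ofPred_eq, Realize, realize_exs, hψ]
  exact (Denumerable.eqv J).symm.surjective.exists

theorem uniformlyDefinable_empty (ho : ∀ α ∈ o, 1 ≤ α) :
    UniformlyDefinable (sigmaClass L o) X code fun i => (∅ : Set (Fin (n i) → B)) :=
  ⟨fun i => iDisj fun _ => exs 0 falsum, fun i => sigmaClass_iDisj fun _ => matrixClass_falsum ho,
    fun i v => by simp [Realize, exs], labelComputable_iDisj labelComputable_falsum⟩

/-- The `j`-th entry of the list of natural numbers that is coded by `t`. -/
def codedEntry (t j : ℕ) : ℕ := (Denumerable.ofNat (List ℕ) t).getD j 0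

theorem codedEntry_primrec : Primrec₂ codedEntry :=
  (Primrec.list_getD 0).comp ((Primrec.ofNat (List ℕ)).comp .fst) .snd

theorem exists_codedEntry_eq {N : ℕ} (f : Fin N → ℕ) : ∃ t, ∀ a : Fin N, codedEntry t a = f a :=
  ⟨Encodable.encode (List.ofFn f), fun a => by simp [codedEntry]⟩

variable {N : ι → ℕ} {T : ∀ q : Σ i, Fin (N i), Set (Fin (n q.1) → B)}

theorem UniformlyDefinable.iInter_matrix (ho : ∀ α ∈ o, 1 ≤ α) (hN : ComputableVia X code N)
    (hT : UniformlyDefinable (matrixClass L o) X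
      (fun q : Σ i, Fin (N i) => (code q.1, (q.2 : ℕ))) T) :
    UniformlyDefinable (matrixClass L o) X code fun i => ⋂ a, T ⟨i, a⟩ := by
  obtain ⟨φ, hφΓ, hφ, hφX⟩ := hT
  by_cases hone : ∀ α ∈ o, α = 1
  · refine ⟨fun i => finAnd fun a => φ ⟨i, a⟩, fun i => matrixClass_finAnd hone fun a => hφΓ ⟨i, a⟩,
      fun i v => ?_, labelComputable_finAnd hN hφX⟩
    simp only [Set.mem_iInter, realize_finAnd, hφ]
  · push Not at hone
    obtain ⟨α, rfl, hα⟩ := hone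
    refine ⟨fun i => finIConj fun a => φ ⟨i, a⟩,
      fun i => matrixClass_finIConj ((ho α rfl).lt_of_ne' hα) fun a => hφΓ ⟨i, a⟩,
      fun i v => ?_, labelComputable_finIConj hN hφX⟩
    simp only [Set.mem_iInter, realize_finIConj, hφ]

theorem ofFn_val_eq_map_range {α : Type*} (f : ℕ → α) (a : ℕ) :
    (List.ofFn fun i : Fin a => f i) = (List.range a).map f := by
  apply List.ext_getElem <;> simp

/-- The sum of the first `j` values of `f`. -/
def prefixSum (f : ℕ → ℕ) (j : ℕ) : ℕ := ((List.range j).map f).sum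

theorem prefixSum_eq_sum (f : ℕ → ℕ) (j : ℕ) : prefixSum f j = ∑ i : Fin j, f i := by
  rw [prefixSum, ← ofFn_val_eq_map_range, List.sum_ofFn]

theorem prefixSum_primrec {α : Type*} [Primcodable α] {f : α → ℕ → ℕ} (hf : Primrec₂ f) :
    Primrec₂ fun a j => prefixSum (f a) j := by
  have hsum : Primrec (List.sum : List ℕ → ℕ) :=
    (Primrec.list_foldr .id (.const 0)
      (Primrec.nat_add.comp (Primrec.fst.comp .snd) (Primrec.snd.comp .snd)).to₂).of_eq
      fun l => by simp [List.sum]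
  exact hsum.comp (Primrec.list_map (Primrec.list_range.comp .snd)
    (hf.comp (Primrec.fst.comp .fst) .snd).to₂)

/-- The list of the indices of the `k` variables from `x_a` on. -/
def varBlock (a k : ℕ) : List ℕ := (List.range k).map fun y => a + y

theorem varBlock_primrec : Primrec₂ varBlock :=
  Primrec.list_map (Primrec.list_range.comp .snd)
    (Primrec.nat_add.comp (Primrec.fst.comp .fst) .snd).to₂

theorem ofFn_eq_varBlock {k a : ℕ} {f : Fin k → ℕ} (h : ∀ i, f i = a + i) :
    List.ofFn f = varBlock a k := by
  rw [varBlock, ← ofFn_val_eq_map_range]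
  exact congrArg _ (funext h)

theorem concat_finSigmaFinEquiv {r : ℕ} {s : Fin r → ℕ} (y : ∀ j, Fin (s j) → B)
    (j : Fin r) (x : Fin (s j)) : concat y (finSigmaFinEquiv ⟨j, x⟩) = y j x := by
  unfold concat
  rw [Equiv.symm_apply_apply]

theorem exists_eq_concat {r : ℕ} {s : Fin r → ℕ} (z : Fin (∑ j, s j) → B) :
    ∃ y : ∀ j, Fin (s j) → B, z = concat y := by
  refine ⟨fun j x => z (finSigmaFinEquiv ⟨j, x⟩), funext fun i => ?_⟩
  obtain ⟨⟨j, x⟩, rfl⟩ := finSigmaFinEquiv.surjective i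
  rw [concat_finSigmaFinEquiv]

/-- The variables of the `a`-th of several existential formulas in `x_0, …, x_{n-1}`, after their
blocks of quantifiers, of lengths `k`, have been put one after the other. -/
def blockRenaming {N : ℕ} (n : ℕ) (k : Fin N → ℕ) (a : Fin N) :
    Fin (n + k a) → Fin (n + ∑ b, k b) :=
  Fin.append (Fin.castAdd _) fun y => Fin.natAdd n (finSigmaFinEquiv ⟨a, y⟩)

theorem append_concat_comp_blockRenaming {n N : ℕ} {k : Fin N → ℕ} (v : Fin n → B)
    (z : ∀ a, Fin (k a) → B) (a : Fin N) :
    Fin.append v (concat z) ∘ blockRenaming n k a = Fin.append v (z a) := by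
  funext x
  refine Fin.addCases (fun x => ?_) (fun y => ?_) x
  · simp [blockRenaming]
  · simp [blockRenaming, concat_finSigmaFinEquiv]

theorem ofFn_blockRenaming {n N : ℕ} (k : ℕ → ℕ) (a : Fin N) :
    (List.ofFn fun x => (blockRenaming n (fun b : Fin N => k b) a x : ℕ)) =
      varBlock 0 n ++ varBlock (n + prefixSum k a) (k a) := by
  have h : (fun x => (blockRenaming n (fun b : Fin N => k b) a x : ℕ)) =
      Fin.append (fun x : Fin n => 0 + (x : ℕ)) fun y : Fin (k a) => n + prefixSum k a + y := by
    funext x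
    refine Fin.addCases (fun x => ?_) (fun y => ?_) x
    · simp [blockRenaming]
    · simp [blockRenaming, prefixSum_eq_sum, add_assoc]
  rw [h, List.ofFn_fin_append, ofFn_eq_varBlock fun _ => rfl, ofFn_eq_varBlock fun _ => rfl]

theorem computableVia_ofFn_blockRenaming (hn : ComputableVia X code n) {t : ι → ℕ}
    (ht : ComputableVia X code t) {a : ∀ i, Fin (N i)}
    (ha : ComputableVia X code fun i => (a i : ℕ)) :
    ComputableVia X code fun i => List.ofFn fun x =>
      (blockRenaming (n i) (fun b : Fin (N i) => codedEntry (t i) b) (a i) x : ℕ) :=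
  .congr (.primrec₂_comp Primrec.list_append
    (.primrec_comp (varBlock_primrec.comp (.const 0) .id) hn)
    (.primrec₂_comp varBlock_primrec (.primrec₂_comp Primrec.nat_add hn
      (.primrec₂_comp (prefixSum_primrec codedEntry_primrec) ht ha))
      (.primrec₂_comp codedEntry_primrec ht ha))) fun _ => (ofFn_blockRenaming _ _).symm

theorem exists_append_comp_blockRenaming_mem_iff {n N : ℕ}
    (M : ∀ (_ : Fin N) (_ K : ℕ), Set (Fin (n + K) → B)) (v : Fin n → B) :
    (∃ (t : ℕ × ℕ) (z : Fin (∑ a : Fin N, codedEntry t.2 a) → B), ∀ a,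
      Fin.append v z ∘ blockRenaming n (fun b => codedEntry t.2 b) a ∈
        M a (codedEntry t.1 a) (codedEntry t.2 a)) ↔
      ∀ a, ∃ j K z, Fin.append v z ∈ M a j K := by
  constructor
  · rintro ⟨t, z, h⟩ a
    obtain ⟨y, rfl⟩ := exists_eq_concat z
    exact ⟨_, _, y a,
      Set.mem_of_eq_of_mem (append_concat_comp_blockRenaming v y a).symm (h a)⟩
  · intro h
    choose j K y h using h
    obtain ⟨s, hs⟩ := exists_codedEntry_eq j
    obtain ⟨t, ht⟩ := exists_codedEntry_eq K
    obtain rfl : (fun a : Fin N => codedEntry s a) = j := funext hs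
    obtain rfl : (fun a : Fin N => codedEntry t a) = K := funext ht
    exact ⟨(s, t), concat y, fun a =>
      Set.mem_of_eq_of_mem (append_concat_comp_blockRenaming v y a) (h a)⟩

theorem UniformlyDefinable.iInter (ho : ∀ α ∈ o, 1 ≤ α) (hn : ComputableVia X code n)
    (hN : ComputableVia X code N)
    (hT : UniformlyDefinable (sigmaClass L o) X
      (fun q : Σ i, Fin (N i) => (code q.1, (q.2 : ℕ))) T) :
    UniformlyDefinable (sigmaClass L o) X code fun i => ⋂ a, T ⟨i, a⟩ := by
  obtain ⟨M, hM, hTM⟩ := hT.exists_matrix ho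
  let k : ι → ℕ × ℕ → ℕ := fun i t => ∑ a : Fin (N i), codedEntry t.2 a
  have hk : ComputableVia X (fun q : ι × ℕ × ℕ => (code q.1, q.2)) fun q => k q.1 q.2 :=
    .congr (.primrec₂_comp (prefixSum_primrec codedEntry_primrec)
      (.of_primrec (Primrec.snd.comp .snd) fun _ => rfl)
      (hN.reindex (.of_primrec .fst fun _ => rfl)))
      fun q => prefixSum_eq_sum _ _
  let M' : ∀ q : Σ p : ι × ℕ × ℕ, Fin (N p.1), Set (Fin (n q.1.1 + k q.1.1 q.1.2) → B) :=
    fun q => {w | w ∘ blockRenaming (n q.1.1) (fun b : Fin (N q.1.1) => codedEntry q.1.2.2 b) q.2 ∈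
      M (⟨q.1.1, q.2⟩, codedEntry q.1.2.1 q.2, codedEntry q.1.2.2 q.2)}
  have hM' : UniformlyDefinable (matrixClass L o) X
      (fun q : Σ p : ι × ℕ × ℕ, Fin (N p.1) => ((code q.1.1, q.1.2), (q.2 : ℕ))) M' := by
    have hs : Primrec fun q : (κ × ℕ × ℕ) × ℕ => q.1.2.1 :=
      Primrec.fst.comp (Primrec.snd.comp .fst)
    have ht : Primrec fun q : (κ × ℕ × ℕ) × ℕ => q.1.2.2 :=
      Primrec.snd.comp (Primrec.snd.comp .fst)
    exact hM.comap renameClosed_matrixClass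
      (e := fun q : Σ p : ι × ℕ × ℕ, Fin (N p.1) =>
        (⟨q.1.1, q.2⟩, codedEntry q.1.2.1 q.2, codedEntry q.1.2.2 q.2))
      (.of_primrec (((Primrec.fst.comp .fst).pair .snd).pair ((codedEntry_primrec.comp hs .snd).pair
        (codedEntry_primrec.comp ht .snd))) fun _ => rfl)
      (.primrec₂_comp Primrec.nat_add
        (hn.reindex (.of_primrec (Primrec.fst.comp .fst) fun _ => rfl))
        (hk.reindex (e := fun q : Σ p : ι × ℕ × ℕ, Fin (N p.1) => q.1)
          (.of_primrec .fst fun _ => rfl)))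
      (computableVia_ofFn_blockRenaming (hn.reindex (.of_primrec (Primrec.fst.comp .fst)
        fun _ => rfl)) (.of_primrec ht fun _ => rfl) (.of_primrec .snd fun _ => rfl))
  have hinter := UniformlyDefinable.iInter_matrix (n := fun q : ι × ℕ × ℕ => n q.1 + k q.1 q.2)
    (code := fun q => (code q.1, q.2)) (T := M') ho
    (hN.reindex (.of_primrec .fst fun _ => rfl)) hM'
  refine cast (congrArg _ (funext fun i => Set.ext fun v => ?_))
    (hinter.exists_append_matrix (J := ℕ × ℕ) (n := n) hk)
  simp only [Set.mem_ofPred_eq, Set.mem_iInter, hTM, M']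
  exact exists_append_comp_blockRenaming_mem_iff (fun a j K => M (⟨i, a⟩, j, K)) v

theorem UniformlyDefinable.inter (ho : ∀ α ∈ o, 1 ≤ α) (hn : ComputableVia X code n)
    (hS : UniformlyDefinable (sigmaClass L o) X code S) {S' : ∀ i, Set (Fin (n i) → B)}
    (hS' : UniformlyDefinable (sigmaClass L o) X code S') :
    UniformlyDefinable (sigmaClass L o) X code fun i => S i ∩ S' i := by
  let T : ∀ q : Σ _ : ι, Fin 2, Set (Fin (n q.1) → B) :=
    fun q => if q.2 = 0 then S q.1 else S' q.1
  have hT : UniformlyDefinable (sigmaClass L o) X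
      (fun q : Σ _ : ι, Fin 2 => (code q.1, (q.2 : ℕ))) T :=
    UniformlyDefinable.dite (p := fun q : Σ _ : ι, Fin 2 => q.2 = 0)
      (S := fun q => S q.1.1) (T := fun q => S' q.1)
      (.of_primrec (Primrec.eq.decide.comp .snd (.const 0)) fun q => by simp)
      (hS.reindex (.of_primrec .fst fun _ => rfl)) (hS'.reindex (.of_primrec .fst fun _ => rfl))
  refine cast (congrArg _ (funext fun i => Set.ext fun v => ?_))
    (.iInter (N := fun _ => 2) (T := T) ho hn (.of_primrec (.const 2) fun _ => rfl) hT)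
  simp [T, Fin.forall_fin_two]

theorem UniformlyDefinable.exists_append (ho : ∀ α ∈ o, 1 ≤ α) (hn : ComputableVia X code n)
    {k : ι → ℕ → ℕ} (hk : ComputableVia X (fun q : ι × ℕ => (code q.1, q.2)) fun q => k q.1 q.2)
    {T : ∀ q : ι × ℕ, Set (Fin (n q.1 + k q.1 q.2) → B)}
    (hT : UniformlyDefinable (sigmaClass L o) X (fun q : ι × ℕ => (code q.1, q.2)) T) :
    UniformlyDefinable (sigmaClass L o) X code
      fun i => {v | ∃ t z, Fin.append v z ∈ T (i, t)} := by
  obtain ⟨M, hM, hTM⟩ := hT.exists_matrix ho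
  have hk' : ComputableVia X (fun q : ι × ℕ × ℕ × ℕ => (code q.1, q.2))
      fun q => k q.1 q.2.1 + q.2.2.2 :=
    .primrec₂_comp Primrec.nat_add
      (hk.reindex (e := fun q : ι × ℕ × ℕ × ℕ => (q.1, q.2.1))
        (.of_primrec (Primrec.fst.pair (Primrec.fst.comp .snd)) fun _ => rfl))
      (.of_primrec (Primrec.snd.comp (Primrec.snd.comp .snd)) fun _ => rfl)
  have hn' : ComputableVia X (fun q : ι × ℕ × ℕ × ℕ => (code q.1, q.2))
      fun q => n q.1 + (k q.1 q.2.1 + q.2.2.2) :=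
    .primrec₂_comp Primrec.nat_add (hn.reindex (.of_primrec .fst fun _ => rfl)) hk'
  have hcode : Primrec fun q : κ × ℕ × ℕ × ℕ => ((q.1, q.2.1), q.2.2) :=
    (Primrec.fst.pair (Primrec.fst.comp .snd)).pair (Primrec.snd.comp .snd)
  have hM' := hM.comap renameClosed_matrixClass
    (code' := fun q : ι × ℕ × ℕ × ℕ => (code q.1, q.2))
    (e := fun q : ι × ℕ × ℕ × ℕ => ((q.1, q.2.1), q.2.2)) (.of_primrec hcode fun _ => rfl) hn'
    (ρ := fun q => Fin.cast (add_assoc _ _ _))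
    (.congr (.primrec_comp (varBlock_primrec.comp (.const 0) .id)
      (hn'.congr fun q => (add_assoc _ _ _).symm))
      fun q => (ofFn_eq_varBlock fun x => (zero_add _).symm).symm)
  refine cast (congrArg _ (funext fun i => Set.ext fun v => ?_))
    (hM'.exists_append_matrix (J := ℕ × ℕ × ℕ) (k := fun i q => k i q.1 + q.2.2) hk')
  simp only [Set.mem_ofPred_eq, hTM]
  constructor
  · rintro ⟨⟨t, j, K⟩, z, h⟩
    refine ⟨t, fun a => z (a.castAdd K), j, K, fun a => z (a.natAdd _), ?_⟩
    rw [Fin.append_assoc, Fin.append_castAdd_natAdd]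
    exact h
  · rintro ⟨t, z, j, K, y, h⟩
    exact ⟨(t, j, K), Fin.append z y, Set.mem_of_eq_of_mem (Fin.append_assoc v z y).symm h⟩

end UniformlyDefinable

section Tuples

variable {B C : Type*}

/-- The image of a tuple under a function. -/
def Tup.map (f : B → C) (x : Tup B) : Tup C := ⟨x.1, f ∘ x.2⟩

/-- The tuple of the first `m` entries. -/
def Tup.head (m : ℕ) (z : Tup B) (h : m ≤ z.1) : Fin m → B := fun i => z.2 (Fin.castLE h i)

/-- What remains of a tuple after its first `m` entries, which is empty if it has fewer entries. -/
def Tup.tail (m : ℕ) (z : Tup B) : Tup B := ⟨z.1 - m, fun i => z.2 ⟨m + i, by omega⟩⟩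

theorem Tup.exists_eq_mk {r : ℕ} {k : Fin r → ℕ} {y : Fin r → Tup B} (h : ∀ j, k j = (y j).1) :
    ∃ y' : ∀ j, Fin (k j) → B, y = fun j => ⟨k j, y' j⟩ := by
  obtain rfl : k = fun j => (y j).1 := funext h
  exact ⟨fun j => (y j).2, rfl⟩

theorem comp_append (f : B → C) {k l : ℕ} (a : Fin k → B) (c : Fin l → B) :
    f ∘ Fin.append a c = Fin.append (f ∘ a) (f ∘ c) := by
  funext i
  refine Fin.addCases (fun x => ?_) (fun y => ?_) i <;> simp

theorem comp_concat (f : B → C) {r : ℕ} {s : Fin r → ℕ} (y : ∀ j, Fin (s j) → B) :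
    f ∘ concat y = concat fun j => f ∘ y j := rfl

theorem GenForm.realize_map {L : FirstOrder.Language.{u, v}} {B : Type w} [L.Structure B]
    {m r M : ℕ} (Φ : GenForm L m r) (w : Fin M → B) (p : Fin m → Fin M)
    (x : Fin r → Tup (Fin M)) :
    (Φ fun j => (x j).1).Realize (w ∘ Fin.append p (concat fun j => (x j).2)) ↔
      Φ.Realize (w ∘ p) fun j => (x j).map w := by
  rw [comp_append, comp_concat]
  rfl

theorem Tup.map_vec_one (f : B → C) (x : Tup B) :
    (fun j : Fin 1 => Tup.map f (![x] j)) = ![Tup.map f x] := by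
  funext j
  fin_cases j
  rfl

theorem concat_succ {r : ℕ} {s : Fin (r + 1) → ℕ} (y : ∀ j, Fin (s j) → B) :
    concat y = Fin.append (concat fun j : Fin r => y j.castSucc) (y (Fin.last r)) ∘
      Fin.cast (Fin.sum_univ_castSucc s) := by
  funext x
  obtain ⟨⟨j, i⟩, rfl⟩ := finSigmaFinEquiv.surjective x
  rw [concat_finSigmaFinEquiv, Function.comp_apply]
  induction j using Fin.lastCases with
  | last =>
    have hi : Fin.cast (Fin.sum_univ_castSucc s) (finSigmaFinEquiv ⟨Fin.last r, i⟩) =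
        Fin.natAdd (∑ j : Fin r, s j.castSucc) i := by
      ext
      simp only [Fin.val_cast, finSigmaFinEquiv_apply, Fin.val_natAdd]
      rfl
    rw [hi, Fin.append_right]
  | cast j =>
    have hi : Fin.cast (Fin.sum_univ_castSucc s) (finSigmaFinEquiv ⟨j.castSucc, i⟩) =
        Fin.castAdd (s (Fin.last r)) (finSigmaFinEquiv (n := fun j : Fin r => s j.castSucc)
          ⟨j, i⟩) := by
      ext
      simp only [Fin.val_cast, finSigmaFinEquiv_apply, Fin.val_castAdd]
      rfl
    rw [hi, Fin.append_left, concat_finSigmaFinEquiv]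

theorem ofFn_concat : ∀ {r : ℕ} {s : Fin r → ℕ} (y : ∀ j, Fin (s j) → B),
    List.ofFn (concat y) = (List.ofFn fun j => List.ofFn (y j)).flatten
  | 0, _, _ => by simp
  | r + 1, s, y => by
    rw [List.ofFn_succ', List.concat_eq_append, List.flatten_append, ← ofFn_concat,
      List.flatten_singleton, ← List.ofFn_fin_append, concat_succ]
    exact (List.ofFn_congr (Fin.sum_univ_castSucc s) _).trans (by simp)

end Tuples

section Variables

variable {r m : ℕ}

/-- The variables for the `j`-th of `r` tuples of lengths `s`, when these are followed by
quantified variables for `m` parameters and for `r` auxiliary tuples of lengths `t`. -/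
def tupVars (s t : Fin r → ℕ) (m : ℕ) (j : Fin r) :
    Tup (Fin (0 + ∑ j, s j + (m + ∑ j, t j))) :=
  ⟨s j, fun x => Fin.castAdd _ (Fin.natAdd 0 (finSigmaFinEquiv ⟨j, x⟩))⟩

/-- The quantified variables for the parameters. -/
def paramVars (s t : Fin r → ℕ) (m : ℕ) : Fin m → Fin (0 + ∑ j, s j + (m + ∑ j, t j)) :=
  fun x => Fin.natAdd _ (Fin.castAdd _ x)

/-- The quantified variables for the `j`-th auxiliary tuple. -/
def auxVars (s t : Fin r → ℕ) (m : ℕ) (j : Fin r) :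
    Tup (Fin (0 + ∑ j, s j + (m + ∑ j, t j))) :=
  ⟨t j, fun x => Fin.natAdd _ (Fin.natAdd m (finSigmaFinEquiv ⟨j, x⟩))⟩

variable {B : Type w} {s t : Fin r → ℕ}

theorem map_tupVars (p : Fin 0 → B) (x : ∀ j, Fin (s j) → B) (z : Fin (m + ∑ j, t j) → B)
    (j : Fin r) :
    (tupVars s t m j).map (Fin.append (Fin.append p (concat x)) z) = ⟨s j, x j⟩ := by
  simp [Tup.map, tupVars, Function.comp_def, concat_finSigmaFinEquiv, -Fin.natAdd_zero]

theorem append_comp_paramVars (a : Fin (0 + ∑ j, s j) → B) (e : Fin m → B)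
    (y : ∀ j, Fin (t j) → B) :
    Fin.append a (Fin.append e (concat y)) ∘ paramVars s t m = e := by
  funext i
  simp [paramVars]

theorem map_auxVars (a : Fin (0 + ∑ j, s j) → B) (e : Fin m → B)
    (y : ∀ j, Fin (t j) → B) (j : Fin r) :
    (auxVars s t m j).map (Fin.append a (Fin.append e (concat y))) = ⟨t j, y j⟩ := by
  simp [Tup.map, auxVars, Function.comp_def, concat_finSigmaFinEquiv]

theorem exists_append_concat (z : Fin (m + ∑ j, t j) → B) :
    ∃ (e : Fin m → B) (y : ∀ j, Fin (t j) → B), z = Fin.append e (concat y) := by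
  obtain ⟨y, hy⟩ := exists_eq_concat fun i => z (Fin.natAdd m i)
  exact ⟨fun i => z (Fin.castAdd _ i), y, by rw [← hy, Fin.append_castAdd_natAdd]⟩

end Variables

section ParameterFree

variable {B : Type w} {m r : ℕ}

/-- The relation on tuples `(c, x)`, with `c` in `O` and `x` in `D c`, that is induced by the
relations `S e` along the correspondences `F`. -/
def parameterFree (O : Set (Fin m → B)) (D : (Fin m → B) → Set (Tup B))
    (F : Set (Fin 4 → Tup B)) (S : (Fin m → B) → Set (Fin r → Tup B)) : Set (Fin r → Tup B) :=
  {z | ∃ e ∈ O, ∃ y ∈ S e, ∀ j, ∃ h : m ≤ (z j).1, (z j).head m h ∈ O ∧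
    (z j).tail m ∈ D ((z j).head m h) ∧
    ![⟨m, (z j).head m h⟩, ⟨m, e⟩, (z j).tail m, y j] ∈ F}

theorem parameterFree_congr {O : Set (Fin m → B)} {D D' : (Fin m → B) → Set (Tup B)}
    (F : Set (Fin 4 → Tup B)) {S S' : (Fin m → B) → Set (Fin r → Tup B)}
    (hD : ∀ c ∈ O, D c = D' c) (hS : ∀ c ∈ O, S c = S' c) :
    parameterFree O D F S = parameterFree O D' F S' := by
  ext z
  refine exists_congr fun e => and_congr_right fun he => ?_
  rw [hS e he]
  refine exists_congr fun y => and_congr_right fun _ => forall_congr' fun j =>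
    exists_congr fun h => and_congr_right fun hc => ?_
  rw [hD _ hc]

/-- The condition that the definition of `parameterFree O D F S` imposes on the `j`-th tuple, in
terms of the variables for tuples of lengths `s` and auxiliary tuples of lengths `t`. -/
def parameterFreeConjunct (O : Set (Fin m → B)) (D : (Fin m → B) → Set (Tup B))
    (F : Set (Fin 4 → Tup B)) (s t : Fin r → ℕ) (j : Fin r) (hs : m ≤ s j) :
    Set (Fin (0 + ∑ j, s j + (m + ∑ j, t j)) → B) :=
  let c := (tupVars s t m j).head m hs
  let x := (tupVars s t m j).tail m
  ({w | w ∘ c ∈ O} ∩ {w | x.map w ∈ D (w ∘ c)}) ∩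
    {w | (fun k => (![⟨m, c⟩, ⟨m, paramVars s t m⟩, x, auxVars s t m j] k).map w) ∈ F}

/-- The part of the definition of `parameterFree O D F S` that follows the quantifiers, in terms of
the variables for tuples of lengths `s` and auxiliary tuples of lengths `t`. -/
def parameterFreeMatrix (O : Set (Fin m → B)) (D : (Fin m → B) → Set (Tup B))
    (F : Set (Fin 4 → Tup B)) (S : (Fin m → B) → Set (Fin r → Tup B)) (s t : Fin r → ℕ)
    (hs : ∀ j, m ≤ s j) : Set (Fin (0 + ∑ j, s j + (m + ∑ j, t j)) → B) :=
  ({w | w ∘ paramVars s t m ∈ O} ∩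
    {w | (fun j => (auxVars s t m j).map w) ∈ S (w ∘ paramVars s t m)}) ∩
  ⋂ j, parameterFreeConjunct O D F s t j (hs j)

variable {O : Set (Fin m → B)} {D : (Fin m → B) → Set (Tup B)} {F : Set (Fin 4 → Tup B)}
  {S : (Fin m → B) → Set (Fin r → Tup B)} {s : Fin r → ℕ}

theorem append_mem_parameterFreeMatrix_iff (hs : ∀ j, m ≤ s j) {t : Fin r → ℕ}
    (x : ∀ j, Fin (s j) → B) (e : Fin m → B) (y : ∀ j, Fin (t j) → B) :
    Fin.append (Fin.append ![] (concat x)) (Fin.append e (concat y)) ∈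
        parameterFreeMatrix O D F S s t hs ↔
      (e ∈ O ∧ (fun j => ⟨t j, y j⟩) ∈ S e) ∧ ∀ j,
        (Tup.head m ⟨s j, x j⟩ (hs j) ∈ O ∧
          Tup.tail m ⟨s j, x j⟩ ∈ D (Tup.head m ⟨s j, x j⟩ (hs j))) ∧
        ![⟨m, Tup.head m ⟨s j, x j⟩ (hs j)⟩, ⟨m, e⟩, Tup.tail m ⟨s j, x j⟩, ⟨t j, y j⟩] ∈ F := by
  set w := Fin.append (Fin.append ![] (concat x)) (Fin.append e (concat y))
  have hparam : w ∘ paramVars s t m = e := append_comp_paramVars _ _ _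
  have haux : ∀ j, (auxVars s t m j).map w = ⟨t j, y j⟩ := map_auxVars _ _ _
  have hhead : ∀ j, w ∘ (tupVars s t m j).head m (hs j) = Tup.head m ⟨s j, x j⟩ (hs j) := by
    intro j
    obtain ⟨_, h⟩ := Sigma.mk.inj_iff.1 (map_tupVars ![] x (Fin.append e (concat y)) j)
    exact funext fun i => congrFun (eq_of_heq h) (Fin.castLE (hs j) i)
  have htail : ∀ j, ((tupVars s t m j).tail m).map w = Tup.tail m ⟨s j, x j⟩ := fun j =>
    congrArg (Tup.tail m) (map_tupVars ![] x (Fin.append e (concat y)) j)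
  have hvec : ∀ j, (fun k => (![⟨m, (tupVars s t m j).head m (hs j)⟩, ⟨m, paramVars s t m⟩,
      (tupVars s t m j).tail m, auxVars s t m j] k).map w) =
      ![⟨m, Tup.head m ⟨s j, x j⟩ (hs j)⟩, ⟨m, e⟩, Tup.tail m ⟨s j, x j⟩, ⟨t j, y j⟩] := by
    intro j
    rw [← hparam, ← haux, ← htail, ← hhead]
    funext k
    fin_cases k <;> rfl
  simp only [parameterFreeMatrix, parameterFreeConjunct, Set.mem_inter_iff, Set.mem_ofPred_eq,
    Set.mem_iInter, hparam, haux, hhead, htail, hvec]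

theorem mem_parameterFree_iff (hs : ∀ j, m ≤ s j) (x : ∀ j, Fin (s j) → B) :
    (fun j => ⟨s j, x j⟩) ∈ parameterFree O D F S ↔ ∃ t : Fin r → ℕ, ∃ z,
      Fin.append (Fin.append ![] (concat x)) z ∈ parameterFreeMatrix O D F S s t hs := by
  constructor
  · rintro ⟨e, he, y, hy, hz⟩
    refine ⟨fun j => (y j).1, Fin.append e (concat fun j => (y j).2),
      (append_mem_parameterFreeMatrix_iff hs x e _).2 ⟨⟨he, hy⟩, fun j => ?_⟩⟩
    obtain ⟨_, hc, hd, hf⟩ := hz j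
    exact ⟨⟨hc, hd⟩, hf⟩
  · rintro ⟨t, z, hz⟩
    obtain ⟨e, y, rfl⟩ := exists_append_concat z
    obtain ⟨⟨he, hy⟩, hz⟩ := (append_mem_parameterFreeMatrix_iff hs x e y).1 hz
    exact ⟨e, he, _, hy, fun j => ⟨hs j, (hz j).1.1, (hz j).1.2, (hz j).2⟩⟩

end ParameterFree

section UniformParameterFree

variable {L : FirstOrder.Language.{u, v}} {B : Type w} [L.Structure B]
  [Encodable (Σ k, L.Functions k)] [Encodable (Σ k, L.Relations k)] {ι ι' κ κ' : Type*}
  [Primcodable κ] [Primcodable κ'] {X : Set ℕ} {code : ι → κ} {m : ℕ}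

/-- The generalized formulas `Φ i` have their components in `Γ` and are `X`-computable uniformly in
`code i`. -/
def GenForm.IsUniform (Γ : FormClass L) (X : Set ℕ) (code : ι → κ) {r : ι → ℕ}
    (Φ : ∀ i, GenForm L m (r i)) : Prop :=
  (∀ i s, Γ _ (Φ i s)) ∧
    LabelComputable X (fun q : Σ i, Fin (r i) → ℕ => (code q.1, List.ofFn q.2)) fun q => Φ q.1 q.2

theorem GenForm.IsUniform.uniformlyDefinable {Γ : FormClass L} (hΓ : RenameClosed Γ)
    {r : ι' → ℕ} {code' : ι' → κ'} {Φ : ∀ i, GenForm L m (r i)}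
    (hΦ : GenForm.IsUniform Γ X code' Φ)
    {e : ι → ι'} (he : ComputableVia X code fun i => code' (e i)) {M : ι → ℕ}
    (hM : ComputableVia X code M) {p : ∀ i, Fin m → Fin (M i)}
    (hp : ComputableVia X code fun i => List.ofFn fun y => ((p i y : Fin (M i)) : ℕ))
    {x : ∀ i, Fin (r (e i)) → Tup (Fin (M i))}
    (hx : ComputableVia X code fun i =>
      List.ofFn fun j => List.ofFn fun y => (((x i j).2 y : Fin (M i)) : ℕ)) :
    UniformlyDefinable Γ X code fun i =>
      {w : Fin (M i) → B | (Φ (e i)).Realize (w ∘ p i) fun j => (x i j).map w} := by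
  have hcomponents : UniformlyDefinable Γ X
      (fun q : Σ i, Fin (r i) → ℕ => (code' q.1, List.ofFn q.2))
      fun q => {v : Fin (m + ∑ j, q.2 j) → B | (Φ q.1 q.2).Realize v} :=
    ⟨fun q => Φ q.1 q.2, fun q => hΦ.1 q.1 q.2, fun _ _ => Iff.rfl, hΦ.2⟩
  have hlengths : ComputableVia X code fun i => List.ofFn fun j => (x i j).1 :=
    .congr (.primrec_comp (Primrec.list_map .id (Primrec.list_length.comp .snd).to₂) hx)
      fun i => by simp [List.map_ofFn, Function.comp_def]
  have hrenaming : ComputableVia X code fun i => List.ofFn fun y =>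
      ((Fin.append (p i) (concat fun j => (x i j).2) y : Fin (M i)) : ℕ) :=
    .congr (.primrec₂_comp Primrec.list_append hp (.primrec_comp Primrec.list_flatten hx))
      fun i => by
        rw [← ofFn_concat, ← List.ofFn_fin_append]
        exact congrArg _ (comp_append Fin.val (p i) (concat fun j => (x i j).2)).symm
  refine cast (congrArg _ (funext fun i => Set.ext fun w => ?_))
    (hcomponents.comap hΓ (e := fun i => ⟨e i, fun j => (x i j).1⟩) (he.pair hlengths) hM hrenaming)
  exact (Φ (e i)).realize_map w (p i) (x i)

theorem prefixSum_ofFn {k : ℕ} (s : Fin k → ℕ) (j : ℕ) (hj : j ≤ k) :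
    prefixSum (fun i => (List.ofFn s).getD i 0) j = ∑ i : Fin j, s (Fin.castLE hj i) := by
  rw [prefixSum_eq_sum]
  refine Finset.sum_congr rfl fun i _ => ?_
  have hi : (i : ℕ) < k := i.2.trans_le hj
  simp [hi, Fin.castLE]

theorem computableVia_ofFn {σ : Type*} [Primcodable σ] {N : ι → ℕ} (hN : ComputableVia X code N)
    {f : ∀ i, Fin (N i) → σ}
    (hf : ComputableVia X (fun q : Σ i, Fin (N i) => (code q.1, (q.2 : ℕ))) fun q => f q.1 q.2) :
    ComputableVia X code fun i => List.ofFn (f i) := by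
  obtain ⟨g, hg, hgf⟩ := hf
  obtain ⟨k, hk, hkN⟩ := hN
  refine ⟨_, computableIn_comp (computableIn_map_range hg)
    (computableIn_pair Primrec.id.computableIn hk), fun i => ?_⟩
  rw [hkN, ← ofFn_val_eq_map_range]
  exact congrArg _ (funext fun j => hgf ⟨i, j⟩)

section Lists

variable {r : ι → ℕ} {s t : ∀ i, Fin (r i) → ℕ} {j : ∀ i, Fin (r i)}
  (hs : ComputableVia X code fun i => List.ofFn (s i))
  (ht : ComputableVia X code fun i => List.ofFn (t i))

include hs

theorem computableVia_apply (hj : ComputableVia X code fun i => (j i : ℕ)) :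
    ComputableVia X code fun i => s i (j i) :=
  .congr (.primrec₂_comp (Primrec.list_getD 0) hs hj) fun i => by simp

theorem computableVia_prefixSum {j : ι → ℕ} (hj : ComputableVia X code j) (hjr : ∀ i, j i ≤ r i) :
    ComputableVia X code fun i => ∑ a : Fin (j i), s i (Fin.castLE (hjr i) a) :=
  .congr (.primrec₂_comp (prefixSum_primrec (Primrec.list_getD 0)) hs hj)
    fun _ => prefixSum_ofFn _ _ _

theorem computableVia_arity : ComputableVia X code r :=
  .congr (.primrec_comp Primrec.list_length hs) fun i => by simp

theorem computableVia_sum : ComputableVia X code fun i => ∑ a, s i a :=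
  computableVia_prefixSum hs (computableVia_arity hs) fun _ => le_rfl

theorem computableVia_ofFn_head_tupVars (hj : ComputableVia X code fun i => (j i : ℕ))
    (hm : ∀ i, m ≤ s i (j i)) :
    ComputableVia X code fun i => List.ofFn fun y =>
      ((tupVars (s i) (t i) m (j i)).head m (hm i) y).val :=
  .congr (.primrec_comp (varBlock_primrec.comp .id (.const m))
    (computableVia_prefixSum hs hj fun i => (j i).2.le))
    fun i => .symm <| ofFn_eq_varBlock fun y => by simp [tupVars, Tup.head, -Fin.natAdd_zero]

theorem computableVia_ofFn_tail_tupVars (hj : ComputableVia X code fun i => (j i : ℕ)) :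
    ComputableVia X code fun i => List.ofFn fun y =>
      (((tupVars (s i) (t i) m (j i)).tail m).2 y : ℕ) :=
  .congr (.primrec₂_comp varBlock_primrec
    (.primrec_comp (Primrec.nat_add.comp .id (.const m))
      (computableVia_prefixSum hs hj fun i => (j i).2.le))
    (.primrec_comp (Primrec.nat_sub.comp .id (.const m)) (computableVia_apply hs hj)))
    fun i => .symm <| ofFn_eq_varBlock fun y => by
      simp [tupVars, Tup.tail, -Fin.natAdd_zero, add_assoc]

theorem computableVia_ofFn_paramVars :
    ComputableVia X code fun i => List.ofFn fun y => (paramVars (s i) (t i) m y : ℕ) :=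
  .congr (.primrec_comp (varBlock_primrec.comp .id (.const m)) (computableVia_sum hs))
    fun i => .symm <| ofFn_eq_varBlock fun y => by simp [paramVars]

include ht

theorem computableVia_ofFn_auxVars (hj : ComputableVia X code fun i => (j i : ℕ)) :
    ComputableVia X code fun i => List.ofFn fun y =>
      ((auxVars (s i) (t i) m (j i)).2 y : ℕ) :=
  .congr (.primrec₂_comp varBlock_primrec
    (.primrec₂_comp Primrec.nat_add
      (.primrec_comp (Primrec.nat_add.comp .id (.const m)) (computableVia_sum hs))
      (computableVia_prefixSum ht hj fun i => (j i).2.le)) (computableVia_apply ht hj))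
    fun i => .symm <| ofFn_eq_varBlock fun y => by simp [auxVars, add_assoc]

theorem computableVia_ofFn_ofFn_auxVars :
    ComputableVia X code fun i => List.ofFn fun j => List.ofFn fun y =>
      ((auxVars (s i) (t i) m j).2 y : ℕ) :=
  have hfst : ComputableVia X (fun q : Σ i, Fin (r i) => (code q.1, (q.2 : ℕ)))
      fun q => code q.1 := .of_primrec .fst fun _ => rfl
  computableVia_ofFn (computableVia_arity hs)
    (computableVia_ofFn_auxVars (j := fun q : Σ i, Fin (r i) => q.2)
      (hs.reindex (e := Sigma.fst) hfst) (ht.reindex (e := Sigma.fst) hfst)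
      (.of_primrec .snd fun _ => rfl))

theorem computableVia_arity_matrix :
    ComputableVia X code fun i => 0 + ∑ j, s i j + (m + ∑ j, t i j) :=
  .primrec₂_comp Primrec.nat_add
    (.primrec_comp (Primrec.nat_add.comp (.const 0) .id) (computableVia_sum hs))
    (.primrec_comp (Primrec.nat_add.comp (.const m) .id) (computableVia_sum ht))

end Lists

section Formulas

variable {o : Option Ordinal.{0}} {O : Set (Fin m → B)} {Δ : GenForm L m 1} {Φ : GenForm L 0 4}
  (ho : ∀ α ∈ o, 1 ≤ α)
  (hO : UniformlyDefinable (n := fun _ => m) (sigmaClass L o) X (id : Unit → Unit) fun _ => O)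
  (hΔ : GenForm.IsUniform (sigmaClass L o) X (id : Unit → Unit) fun _ => Δ)
  (hΦ : GenForm.IsUniform (sigmaClass L o) X (id : Unit → Unit) fun _ => Φ)

include ho hO hΔ hΦ

theorem uniformlyDefinable_parameterFreeConjunct {r : ι → ℕ} {s t : ∀ i, Fin (r i) → ℕ}
    (hs : ComputableVia X code fun i => List.ofFn (s i))
    (ht : ComputableVia X code fun i => List.ofFn (t i)) {j : ∀ i, Fin (r i)}
    (hj : ComputableVia X code fun i => (j i : ℕ)) (hm : ∀ i, m ≤ s i (j i)) :
    UniformlyDefinable (sigmaClass L o) X code fun i =>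
      parameterFreeConjunct O (fun c => {x | Δ.Realize c ![x]}) {x | Φ.Realize ![] x}
        (s i) (t i) (j i) (hm i) := by
  have hM : ComputableVia X code fun i => 0 + ∑ j, s i j + (m + ∑ j, t i j) :=
    computableVia_arity_matrix hs ht
  have hc := computableVia_ofFn_head_tupVars (t := t) hs hj hm
  have hx := computableVia_ofFn_tail_tupVars (t := t) (m := m) hs hj
  have he := computableVia_ofFn_paramVars (t := t) (m := m) hs
  have hy := computableVia_ofFn_auxVars (m := m) hs ht hj
  have hunit : ComputableVia X code fun _ => id () := .of_primrec (.const ()) fun _ => rfl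
  have hcons : Primrec₂ (List.cons (α := List ℕ)) := Primrec.list_cons
  have hsingleton : Primrec fun l : List ℕ => [l] := hcons.comp .id (.const [])
  refine .inter ho hM (.inter ho hM ?_ ?_) ?_
  · exact hO.comap renameClosed_sigmaClass (e := fun _ => ()) hunit hM hc
  · refine cast (congrArg _ (funext fun i => Set.ext fun w => ?_))
      (hΔ.uniformlyDefinable (B := B) renameClosed_sigmaClass (e := fun _ => ()) hunit hM hc
        (x := fun i => ![(tupVars (s i) (t i) m (j i)).tail m])
        (.congr (.primrec_comp hsingleton hx) fun i => by simp))
    rw [Set.mem_ofPred_eq, Tup.map_vec_one]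
    rfl
  · refine cast (congrArg _ (funext fun i => Set.ext fun w => ?_))
      (hΦ.uniformlyDefinable (B := B) renameClosed_sigmaClass (e := fun _ => ()) hunit hM
        (p := fun _ => ![]) (.of_primrec (.const []) fun _ => by simp)
        (x := fun i => ![⟨m, (tupVars (s i) (t i) m (j i)).head m (hm i)⟩,
          ⟨m, paramVars (s i) (t i) m⟩, (tupVars (s i) (t i) m (j i)).tail m,
          auxVars (s i) (t i) m (j i)])
        (.congr (.primrec₂_comp hcons hc (.primrec₂_comp hcons he (.primrec₂_comp hcons hx
          (.primrec_comp hsingleton hy)))) fun i => by simp [List.ofFn_succ]))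
    rw [Set.mem_ofPred_eq, Subsingleton.elim (w ∘ ![]) (![] : Fin 0 → B)]
    rfl

variable {r : ι' → ℕ} {code' : ι' → κ'} {Ψ : ∀ a, GenForm L m (r a)}
  (hΨ : GenForm.IsUniform (sigmaClass L o) X code' Ψ)

include hΨ

theorem uniformlyDefinable_parameterFreeMatrix {e : ι → ι'}
    (he : ComputableVia X code fun i => code' (e i)) {s t : ∀ i, Fin (r (e i)) → ℕ}
    (hs : ComputableVia X code fun i => List.ofFn (s i))
    (ht : ComputableVia X code fun i => List.ofFn (t i)) (hm : ∀ i j, m ≤ s i j) :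
    UniformlyDefinable (sigmaClass L o) X code fun i =>
      parameterFreeMatrix O (fun c => {x | Δ.Realize c ![x]}) {x | Φ.Realize ![] x}
        (fun c => {y | (Ψ (e i)).Realize c y}) (s i) (t i) (hm i) := by
  have hM : ComputableVia X code fun i => 0 + ∑ j, s i j + (m + ∑ j, t i j) :=
    computableVia_arity_matrix hs ht
  have hparam := computableVia_ofFn_paramVars (t := t) (m := m) hs
  have hunit : ComputableVia X code fun _ => id () := .of_primrec (.const ()) fun _ => rfl
  have hfst : ComputableVia X (fun q : Σ i, Fin (r (e i)) => (code q.1, (q.2 : ℕ)))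
      fun q => code q.1 := .of_primrec .fst fun _ => rfl
  refine .inter ho hM (.inter ho hM ?_ ?_) (.iInter
    (T := fun q : Σ i, Fin (r (e i)) => parameterFreeConjunct O (fun c => {x | Δ.Realize c ![x]})
      {x | Φ.Realize ![] x} (s q.1) (t q.1) q.2 (hm q.1 q.2)) ho hM (computableVia_arity hs) ?_)
  · exact hO.comap renameClosed_sigmaClass (e := fun _ => ()) hunit hM hparam
  · exact hΨ.uniformlyDefinable renameClosed_sigmaClass he hM hparam
      (computableVia_ofFn_ofFn_auxVars hs ht)
  · exact uniformlyDefinable_parameterFreeConjunct ho hO hΔ hΦ (hs.reindex (e := Sigma.fst) hfst)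
      (ht.reindex (e := Sigma.fst) hfst) (j := fun q : Σ i, Fin (r (e i)) => q.2)
      (.of_primrec .snd fun _ => rfl) fun q => hm q.1 q.2

theorem uniformlyDefinable_exists_parameterFreeMatrix :
    UniformlyDefinable (sigmaClass L o) X
      (fun q : {q : Σ a, Fin (r a) → ℕ // ∀ j, m ≤ q.2 j} => (code' q.1.1, List.ofFn q.1.2))
      fun q => {v | ∃ t z, Fin.append v z ∈ parameterFreeMatrix O
        (fun c => {x | Δ.Realize c ![x]}) {x | Φ.Realize ![] x}
        (fun c => {y | (Ψ q.1.1).Realize c y}) q.1.2 (fun j => codedEntry t j) q.2} := by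
  let J := {q : Σ a, Fin (r a) → ℕ // ∀ j, m ≤ q.2 j}
  let code : J → κ' × List ℕ := fun q => (code' q.1.1, List.ofFn q.1.2)
  have hs : ComputableVia X code fun q => List.ofFn q.1.2 := .of_primrec .snd fun _ => rfl
  have hs' : ComputableVia X (fun q : J × ℕ => (code q.1, q.2)) fun q => List.ofFn q.1.1.2 :=
    hs.reindex (.of_primrec .fst fun _ => rfl)
  have ht : ComputableVia X (fun q : J × ℕ => (code q.1, q.2))
      fun q => List.ofFn fun j : Fin (r q.1.1.1) => codedEntry q.2 j :=
    computableVia_ofFn (computableVia_arity hs') (.of_primrec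
      (codedEntry_primrec.comp (Primrec.snd.comp .fst) .snd) fun _ => rfl)
  have hn : ComputableVia X code fun q => 0 + ∑ j, q.1.2 j :=
    .primrec_comp (Primrec.nat_add.comp (.const 0) .id) (computableVia_sum hs)
  have hk : ComputableVia X (fun q : J × ℕ => (code q.1, q.2))
      fun q => m + ∑ j : Fin (r q.1.1.1), codedEntry q.2 j :=
    .primrec_comp (Primrec.nat_add.comp (.const m) .id) (computableVia_sum ht)
  exact .exists_append (code := code) (n := fun q => 0 + ∑ j, q.1.2 j)
    (k := fun q t => m + ∑ j : Fin (r q.1.1), codedEntry t j)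
    (T := fun q : J × ℕ => parameterFreeMatrix O (fun c => {x | Δ.Realize c ![x]})
      {x | Φ.Realize ![] x} (fun c => {y | (Ψ q.1.1.1).Realize c y}) q.1.1.2
      (fun j => codedEntry q.2 j) q.1.2) ho hn hk
    (uniformlyDefinable_parameterFreeMatrix ho hO hΔ hΦ hΨ (e := fun q : J × ℕ => q.1.1.1)
      (.of_primrec (Primrec.fst.comp .fst) fun _ => rfl) hs' ht fun q => q.1.2)

theorem exists_isUniform_parameterFree :
    ∃ Θ : ∀ a, GenForm L 0 (r a), GenForm.IsUniform (sigmaClass L o) X code' Θ ∧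
      ∀ a z, z ∈ parameterFree O (fun c => {x | Δ.Realize c ![x]}) {x | Φ.Realize ![] x}
        (fun c => {y | (Ψ a).Realize c y}) ↔ (Θ a).Realize ![] z := by
  obtain ⟨_, hguard⟩ : PrimrecPred fun q : κ' × List ℕ => ∀ x ∈ q.2, m ≤ x :=
    (Primrec.nat_le.comp (.const m) .id).forall_mem_list.comp .snd
  have hlengths : ComputableVia X (fun q : Σ a, Fin (r a) → ℕ => (code' q.1, List.ofFn q.2))
      fun q => decide (∀ j, m ≤ q.2 j) :=
    .of_primrec hguard fun q => by simp
  obtain ⟨Θ, hΘΓ, hΘ, hΘX⟩ := UniformlyDefinable.dite (L := L) (B := B)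
    (n := fun q : Σ a, Fin (r a) → ℕ => 0 + ∑ j, q.2 j)
    (S := fun q => {v | ∃ t z, Fin.append v z ∈ parameterFreeMatrix O
      (fun c => {x | Δ.Realize c ![x]}) {x | Φ.Realize ![] x}
      (fun c => {y | (Ψ q.1.1).Realize c y}) q.1.2 (fun j => codedEntry t j) q.2}) hlengths
    (uniformlyDefinable_exists_parameterFreeMatrix ho hO hΔ hΦ hΨ) (uniformlyDefinable_empty ho)
  refine ⟨fun a s => Θ ⟨a, s⟩, ⟨fun a s => hΘΓ ⟨a, s⟩, hΘX⟩, fun a z => ?_⟩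
  refine Iff.trans ?_ (hΘ ⟨a, fun j => (z j).1⟩ (Fin.append ![] (concat fun j => (z j).2)))
  dsimp only
  by_cases h : ∀ j, m ≤ (z j).1
  · rw [dif_pos h]
    refine (mem_parameterFree_iff h fun j => (z j).2).trans ⟨fun ⟨t, ht⟩ => ?_, fun ⟨t, ht⟩ =>
      ⟨_, ht⟩⟩
    obtain ⟨t', rfl⟩ : ∃ t', (fun j : Fin (r a) => codedEntry t' j) = t :=
      (exists_codedEntry_eq t).imp fun _ => funext
    exact ⟨t', ht⟩
  · rw [dif_neg h]
    exact ⟨fun ⟨_, _, _, _, hz⟩ => h fun j => (hz j).1, False.elim⟩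

end Formulas

end UniformParameterFree

section Equivariant

variable {L : FirstOrder.Language.{u, v}} {B : Type w} [L.Structure B] {m r : ℕ}

/-- Families of relations that are preserved by the automorphisms of `B`, which act on the
parameters and on the arguments simultaneously. -/
def Equivariant (L : FirstOrder.Language.{u, v}) {B : Type w} [L.Structure B] {m r : ℕ}
    (S : (Fin m → B) → Set (Fin r → Tup B)) : Prop :=
  ∀ (σ : B ≃[L] B) (c : Fin m → B) (x : Fin r → Tup B),
    x ∈ S c ↔ (fun j => (x j).map σ) ∈ S (σ ∘ c)

theorem Tup.exists_map_eq (σ : B ≃[L] B) (x : Tup B) : ∃ y : Tup B, y.map σ = x :=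
  ⟨x.map σ.symm, Sigma.ext rfl (heq_of_eq (funext fun _ => σ.apply_symm_apply _))⟩

theorem GenForm.realize_equiv (Φ : GenForm L m r) (σ : B ≃[L] B) (p : Fin m → B)
    (x : Fin r → Tup B) : (Φ.Realize (σ ∘ p) fun j => (x j).map σ) ↔ Φ.Realize p x := by
  refine Iff.trans ?_ (InfForm.realize_equiv σ _ _)
  rw [comp_append, comp_concat]
  rfl

theorem mem_tupOrbit_iff {b c : Fin m → B} : c ∈ tupOrbit L b ↔ ∃ σ : B ≃[L] B, σ ∘ b = c := by
  simp [tupOrbit, funext_iff]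

variable {S : (Fin m → B) → Set (Fin r → Tup B)} {b c : Fin m → B}

theorem Equivariant.mem_iff_realize_at (hS : Equivariant L S) {s : Fin r → ℕ}
    {φ : InfForm L (m + ∑ j, s j)}
    (hφ : ∀ y : ∀ j, Fin (s j) → B, (fun j => (⟨s j, y j⟩ : Tup B)) ∈ S b ↔
      φ.Realize (Fin.append b (concat y)))
    (hc : c ∈ tupOrbit L b) (y : ∀ j, Fin (s j) → B) :
    (fun j => (⟨s j, y j⟩ : Tup B)) ∈ S c ↔ φ.Realize (Fin.append c (concat y)) := by
  obtain ⟨σ, rfl⟩ := mem_tupOrbit_iff.1 hc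
  obtain ⟨y, rfl⟩ : ∃ y', (fun j => σ ∘ y' j) = y :=
    ⟨fun j => σ.symm ∘ y j, funext fun j => funext fun i => by simp⟩
  refine (hS σ b fun j => ⟨s j, y j⟩).symm.trans ((hφ y).trans ?_)
  rw [← InfForm.realize_equiv σ, comp_append, comp_concat]

theorem Equivariant.mem_iff_realize (hS : Equivariant L S) {Φ : GenForm L m r}
    (hΦ : ∀ x, x ∈ S b ↔ Φ.Realize b x) (hc : c ∈ tupOrbit L b) (x : Fin r → Tup B) :
    x ∈ S c ↔ Φ.Realize c x :=
  hS.mem_iff_realize_at (φ := Φ fun j => (x j).1) (fun _ => hΦ _) hc fun j => (x j).2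

end Equivariant

section XDefinable

variable {L : FirstOrder.Language.{u, v}} {B : Type w} [L.Structure B]
  [Encodable (Σ k, L.Functions k)] [Encodable (Σ k, L.Relations k)] {m : ℕ} {X : Set ℕ}
  {Γ : FormClass L}

theorem GenForm.IsUniform.reindex {ι ι' κ κ' : Type*} [Primcodable κ] [Primcodable κ']
    {code : ι → κ} {code' : ι' → κ'} {r : ι → ℕ} {Φ : ∀ i, GenForm L m (r i)}
    (hΦ : GenForm.IsUniform Γ X code Φ) {e : ι' → ι}
    (he : ComputableVia X code' fun i => code (e i)) :
    GenForm.IsUniform Γ X code' fun i => Φ (e i) :=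
  ⟨fun _ _ => hΦ.1 _ _, hΦ.2.reindex (e := fun q : Σ i, Fin (r (e i)) → ℕ => ⟨e q.1, q.2⟩)
    ((he.reindex (e := Sigma.fst) (.of_primrec .fst fun _ => rfl)).pair
      (.of_primrec .snd fun _ => rfl))⟩

theorem xGenDefinableFamily_iff {ι : Type*} [Encodable ι] {p : Fin m → B} {r : ι → ℕ}
    {S : ∀ i, Set (Fin (r i) → Tup B)} :
    XGenDefinableFamily X Γ p r S ↔ ∃ Φ : ∀ i, GenForm L m (r i),
      GenForm.IsUniform Γ X Encodable.encode Φ ∧ ∀ i x, x ∈ S i ↔ (Φ i).Realize p x := by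
  constructor
  · rintro ⟨Φ, hΓ, hΦ, g, hg, hgΦ⟩
    exact ⟨Φ, ⟨hΓ, fun q => g (q.1.1, q.1.2, q.2), computableIn_comp_primrec hg
      ((Primrec.fst.comp .fst).pair ((Primrec.snd.comp .fst).pair .snd)),
      fun q => hgΦ q.1.1 q.1.2 q.2⟩, hΦ⟩
  · rintro ⟨Φ, ⟨hΓ, g, hg, hgΦ⟩, hΦ⟩
    exact ⟨Φ, hΓ, hΦ, fun q => g ((q.1, q.2.1), q.2.2), computableIn_comp_primrec hg
      ((Primrec.fst.pair (Primrec.fst.comp .snd)).pair (Primrec.snd.comp .snd)),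
      fun i s pos => hgΦ (⟨i, s⟩, pos)⟩

theorem XGenDefinable.exists_isUniform {p : Fin m → B} {r : ℕ} {S : Set (Fin r → Tup B)}
    (hS : XGenDefinable X Γ p r S) : ∃ Φ : GenForm L m r,
      GenForm.IsUniform Γ X (id : Unit → Unit) (fun _ => Φ) ∧ ∀ x, x ∈ S ↔ Φ.Realize p x := by
  obtain ⟨Φ, hΦ, hSΦ⟩ := xGenDefinableFamily_iff.1 hS
  exact ⟨Φ (), hΦ.reindex (.of_primrec (.const (Encodable.encode ())) fun _ => rfl), hSΦ ()⟩

theorem XSetDefinable.uniformlyDefinable {O : Set (Fin m → B)} (hO : XSetDefinable X Γ O) :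
    UniformlyDefinable (n := fun _ => m) Γ X (id : Unit → Unit) fun _ => O := by
  obtain ⟨φ, hΓ, hφX, hφ⟩ := hO
  exact ⟨fun _ => φ, fun _ => hΓ, fun _ => hφ, fun q => φ.label q.2,
    computableIn_comp_primrec hφX .snd, fun _ => rfl⟩

theorem xGenDefinableFamily_parameterFree {o : Option Ordinal.{0}} (ho : ∀ α ∈ o, 1 ≤ α)
    {b : Fin m → B} {D : (Fin m → B) → Set (Tup B)} {F : Set (Fin 4 → Tup B)} {ι : Type*}
    [Encodable ι] {r : ι → ℕ} {S : ∀ i, (Fin m → B) → Set (Fin (r i) → Tup B)}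
    (hD : Equivariant L fun c => {x : Fin 1 → Tup B | x 0 ∈ D c}) (hS : ∀ i, Equivariant L (S i))
    (hOdef : XSetDefinable X (sigmaClass L o) (tupOrbit L b))
    (hFdef : XGenDefinable X (sigmaClass L o) ![] 4 F)
    (hDdef : XGenDefinable X (sigmaClass L o) b 1 {x | x 0 ∈ D b})
    (hSdef : XGenDefinableFamily X (sigmaClass L o) b r fun i => S i b) :
    XGenDefinableFamily X (sigmaClass L o) ![] r
      fun i => parameterFree (tupOrbit L b) D F (S i) := by
  obtain ⟨Φ, hΦ, hFΦ⟩ := hFdef.exists_isUniform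
  obtain ⟨Δ, hΔ, hDΔ⟩ := hDdef.exists_isUniform
  obtain ⟨Ψ, hΨ, hSΨ⟩ := xGenDefinableFamily_iff.1 hSdef
  obtain ⟨Θ, hΘ, hmem⟩ := exists_isUniform_parameterFree ho hOdef.uniformlyDefinable hΔ hΦ hΨ
  refine xGenDefinableFamily_iff.2 ⟨Θ, hΘ, fun i z => (Set.ext_iff.1 ?_ z).trans (hmem i z)⟩
  obtain rfl : F = {x | Φ.Realize ![] x} := Set.ext hFΦ
  exact parameterFree_congr _ (fun c hc => Set.ext fun x => hD.mem_iff_realize hDΔ hc ![x])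
    fun c hc => Set.ext ((hS i).mem_iff_realize (hSΨ i) hc)

end XDefinable

section Oracle

variable {L : FirstOrder.Language.{u, v}} [Encodable (Σ k, L.Functions k)]
  [Encodable (Σ k, L.Relations k)]

theorem exists_isXComputable (S : Set (Σ n, InfForm L n)) (hS : S.Countable) :
    ∃ X : Set ℕ, ∀ φ ∈ S, φ.2.IsXComputable X := by
  rcases S.eq_empty_or_nonempty with rfl | hne
  · exact ⟨∅, fun _ h => h.elim⟩
  · obtain ⟨φ, rfl⟩ := hS.exists_eq_range hne
    obtain ⟨X, hX⟩ := exists_forall_xComputable fun i => (φ i).2.label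
    exact ⟨X, Set.forall_mem_range.2 hX⟩

/-- The label at position `q.2` of the component of `Φ` for tuples with list of lengths `q.1`: the
function that an oracle has to compute for `Φ` to be computable. -/
def GenForm.codedLabel {m r : ℕ} (Φ : GenForm L m r) (q : List ℕ × List ℕ) : ℕ :=
  (Φ fun j => q.1.getD j 0).label q.2

variable {B : Type w} [L.Structure B] {m : ℕ} {X : Set ℕ}

theorem GenForm.xGenDefinable {Γ : FormClass L} {p : Fin m → B} {r : ℕ} {S : Set (Fin r → Tup B)}
    {Φ : GenForm L m r} (hΓ : ∀ s, Γ _ (Φ s)) (hΦ : ∀ x, x ∈ S ↔ Φ.Realize p x)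
    (hX : XComputable X Φ.codedLabel) : XGenDefinable X Γ p r S := by
  refine ⟨fun _ => Φ, fun _ => hΓ, fun _ => hΦ, fun q => Φ.codedLabel q.2,
    computableIn_comp_primrec hX .snd, fun _ s pos => ?_⟩
  have hs : (fun j : Fin r => (List.ofFn s).getD j 0) = s := funext fun j => by simp
  exact congrArg (fun s => (Φ s).label pos) hs

theorem XGenDefinable.genDefinable {Γ : FormClass L} {p : Fin m → B} {r : ℕ}
    {S : Set (Fin r → Tup B)} (h : XGenDefinable X Γ p r S) : GenDefinable Γ p r S := by
  obtain ⟨Φ, hΓ, hΦ, _⟩ := h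
  exact ⟨Φ (), hΓ (), hΦ ()⟩

theorem genDefinable_parameterFree {o : Option Ordinal.{0}} (ho : ∀ α ∈ o, 1 ≤ α) {b : Fin m → B}
    {D : (Fin m → B) → Set (Tup B)} {F : Set (Fin 4 → Tup B)}
    {r : ℕ} {S : (Fin m → B) → Set (Fin r → Tup B)}
    (hD : Equivariant L fun c => {x : Fin 1 → Tup B | x 0 ∈ D c}) (hS : Equivariant L S)
    (hOdef : SetDefinable (sigmaClass L o) (tupOrbit L b))
    (hFdef : GenDefinable (sigmaClass L o) ![] 4 F)
    (hDdef : GenDefinable (sigmaClass L o) b 1 {x | x 0 ∈ D b})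
    (hSdef : GenDefinable (sigmaClass L o) b r (S b)) :
    GenDefinable (sigmaClass L o) ![] r (parameterFree (tupOrbit L b) D F S) := by
  obtain ⟨φ, hφΓ, hφ⟩ := hOdef
  obtain ⟨Φ, hΦΓ, hΦ⟩ := hFdef
  obtain ⟨Δ, hΔΓ, hΔ⟩ := hDdef
  obtain ⟨Ψ, hΨΓ, hΨ⟩ := hSdef
  obtain ⟨X, hX⟩ := exists_forall_xComputable fun i =>
    [fun q : List ℕ × List ℕ => φ.label q.2, Φ.codedLabel, Δ.codedLabel,
      Ψ.codedLabel].getD i fun _ => 0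
  have hφX : φ.IsXComputable X := computableIn_comp_primrec
    (f := fun q : List ℕ × List ℕ => φ.label q.2) (hX 0) ((Primrec.const []).pair .id)
  exact XGenDefinable.genDefinable (xGenDefinableFamily_parameterFree (S := fun _ => S) ho hD
    (fun _ => hS) ⟨φ, hφΓ, hφX, hφ⟩ (GenForm.xGenDefinable hΦΓ hΦ (hX 1))
    (GenForm.xGenDefinable hΔΓ hΔ (hX 2)) (GenForm.xGenDefinable hΨΓ hΨ (hX 3)))

end Oracle

section Finitary

variable {L : FirstOrder.Language.{u, v}} {B : Type w} [L.Structure B] {m r k M : ℕ}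

theorem GenDefinable.definableAt {Γ : FormClass L} {p : Fin m → B} {S : Set (Fin r → Tup B)}
    (hS : GenDefinable Γ p r S) (s : Fin r → ℕ) : DefinableAt Γ p s S := by
  obtain ⟨Φ, hΓ, hΦ⟩ := hS
  exact ⟨Φ s, hΓ s, fun _ => hΦ _⟩

theorem setDefinable_finitary_comp {T : Set (Fin k → B)}
    (hT : SetDefinable (finitaryForms L) T) (f : Fin k → Fin M) :
    SetDefinable (finitaryForms L) {w : Fin M → B | w ∘ f ∈ T} := by
  obtain ⟨φ, hfin, hφ⟩ := hT
  exact ⟨φ.rename f, IsFinitary.rename f hfin, fun w => by rw [realize_rename]; exact hφ _⟩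

theorem setDefinable_finitary_inter {T T' : Set (Fin k → B)}
    (hT : SetDefinable (finitaryForms L) T) (hT' : SetDefinable (finitaryForms L) T') :
    SetDefinable (finitaryForms L) (T ∩ T') := by
  obtain ⟨φ, hfin, hφ⟩ := hT
  obtain ⟨ψ, hfin', hψ⟩ := hT'
  exact ⟨and φ ψ, ⟨hfin, hfin'⟩, fun w => and_congr (hφ w) (hψ w)⟩

theorem setDefinable_finitary_iInter {T : Fin r → Set (Fin k → B)}
    (hT : ∀ j, SetDefinable (finitaryForms L) (T j)) :
    SetDefinable (finitaryForms L) (⋂ j, T j) := by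
  choose φ hfin hφ using hT
  refine ⟨finAnd φ, isFinitary_finAnd φ hfin, fun w => ?_⟩
  simp only [Set.mem_iInter, realize_finAnd, hφ]

theorem setDefinable_finitary_exists_append {T : Set (Fin (k + M) → B)}
    (hT : SetDefinable (finitaryForms L) T) :
    SetDefinable (finitaryForms L) {v | ∃ z : Fin M → B, Fin.append v z ∈ T} := by
  obtain ⟨φ, hfin, hφ⟩ := hT
  exact ⟨exs M φ, IsFinitary.exs M hfin, fun v => by
    simp only [realize_exs, Set.mem_ofPred_eq, hφ]⟩

variable {b : Fin m → B} {s : Fin r → ℕ}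

theorem DefinableAt.setDefinable {S : Set (Fin r → Tup B)}
    (hS : DefinableAt (finitaryForms L) ![] s S) {x : Fin r → Tup (Fin M)}
    (hx : ∀ j, s j = (x j).1) :
    SetDefinable (finitaryForms L) {w : Fin M → B | (fun j => (x j).map w) ∈ S} := by
  obtain ⟨φ, hfin, hφ⟩ := hS
  obtain ⟨x, rfl⟩ := Tup.exists_eq_mk hx
  refine ⟨φ.rename (Fin.append ![] (concat x)), hfin.rename _, fun w => ?_⟩
  rw [realize_rename, comp_append, Subsingleton.elim (w ∘ ![]) (![] : Fin 0 → B)]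
  exact hφ fun j => w ∘ x j

theorem Equivariant.setDefinable {S : (Fin m → B) → Set (Fin r → Tup B)} (hS : Equivariant L S)
    (hO : SetDefinable (finitaryForms L) (tupOrbit L b))
    (hSdef : DefinableAt (finitaryForms L) b s (S b)) (p : Fin m → Fin M)
    {x : Fin r → Tup (Fin M)} (hx : ∀ j, s j = (x j).1) :
    SetDefinable (finitaryForms L)
      ({w : Fin M → B | w ∘ p ∈ tupOrbit L b} ∩ {w | (fun j => (x j).map w) ∈ S (w ∘ p)}) := by
  obtain ⟨φ, hfin, hφ⟩ := hSdef
  obtain ⟨x, rfl⟩ := Tup.exists_eq_mk hx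
  have hren : SetDefinable (finitaryForms L)
      {w : Fin M → B | φ.Realize (w ∘ Fin.append p (concat x))} :=
    ⟨φ.rename _, hfin.rename _, fun w => (realize_rename _ _ _).symm⟩
  obtain ⟨χ, hχ, hχ_iff⟩ := setDefinable_finitary_inter (setDefinable_finitary_comp hO p) hren
  refine ⟨χ, hχ, fun w => (and_congr_right fun hw => ?_).trans (hχ_iff w)⟩
  change _ ↔ φ.Realize (w ∘ Fin.append p (concat x))
  rw [comp_append]
  exact hS.mem_iff_realize_at hφ hw fun j => w ∘ x j

theorem setDefinable_parameterFreeMatrix {D : (Fin m → B) → Set (Tup B)}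
    {F : Set (Fin 4 → Tup B)} {n : ℕ} {S : (Fin m → B) → Set (Fin r → Tup B)}
    (hD : Equivariant L fun c => {x : Fin 1 → Tup B | x 0 ∈ D c}) (hS : Equivariant L S)
    (hOdef : SetDefinable (finitaryForms L) (tupOrbit L b))
    (hFdef : DefinableAt (finitaryForms L) ![] ![m, m, n, n] F)
    (hDdef : DefinableAt (finitaryForms L) b (fun _ => n) {x : Fin 1 → Tup B | x 0 ∈ D b})
    (hSdef : DefinableAt (finitaryForms L) b (fun _ => n) (S b)) :
    SetDefinable (finitaryForms L) (parameterFreeMatrix (tupOrbit L b) D F S (fun _ => n + m)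
      (fun _ => n) fun _ => Nat.le_add_left m n) := by
  have hn : n = n + m - m := (Nat.add_sub_cancel n m).symm
  refine setDefinable_finitary_inter (hS.setDefinable hOdef hSdef _ fun _ => rfl)
    (setDefinable_finitary_iInter fun j => setDefinable_finitary_inter ?_ (hFdef.setDefinable ?_))
  · exact hD.setDefinable hOdef hDdef _
      (x := fun _ => (tupVars (fun _ => n + m) (fun _ => n) m j).tail m) fun _ => hn
  · intro k
    fin_cases k
    exacts [rfl, rfl, hn, rfl]

theorem definableAt_parameterFree {D : (Fin m → B) → Set (Tup B)} {F : Set (Fin 4 → Tup B)}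
    {n : ℕ} {S : (Fin m → B) → Set (Fin r → Tup B)}
    (hD : Equivariant L fun c => {x : Fin 1 → Tup B | x 0 ∈ D c}) (hS : Equivariant L S)
    (hSn : ∀ c ∈ tupOrbit L b, ∀ y ∈ S c, ∀ j, (y j).1 = n)
    (hOdef : SetDefinable (finitaryForms L) (tupOrbit L b))
    (hFdef : DefinableAt (finitaryForms L) ![] ![m, m, n, n] F)
    (hDdef : DefinableAt (finitaryForms L) b (fun _ => n) {x : Fin 1 → Tup B | x 0 ∈ D b})
    (hSdef : DefinableAt (finitaryForms L) b (fun _ => n) (S b)) :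
    DefinableAt (finitaryForms L) ![] (fun _ => n + m) (parameterFree (tupOrbit L b) D F S) := by
  obtain ⟨φ, hfin, hφ⟩ := setDefinable_finitary_exists_append
    (setDefinable_parameterFreeMatrix hD hS hOdef hFdef hDdef hSdef)
  refine ⟨φ, hfin, fun x => Iff.trans ?_ (hφ _)⟩
  refine (mem_parameterFree_iff (fun _ => Nat.le_add_left m n) x).trans
    ⟨fun ⟨t, z, hz⟩ => ?_, fun hz => ⟨_, hz⟩⟩
  obtain ⟨e, y, rfl⟩ := exists_append_concat z
  obtain rfl : t = fun _ => n :=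
    have ⟨⟨he, hy⟩, _⟩ := (append_mem_parameterFreeMatrix_iff _ x e y).1 hz
    funext (hSn e he _ hy)
  exact ⟨_, hz⟩

end Finitary

section Tup

variable {B : Type w}

theorem Tup.ext_cast {k k' : ℕ} {g : Fin k' → B} {y : Fin k → B} (h : k' = k)
    (hg : ∀ i, g i = y (Fin.cast h i)) : (⟨k', g⟩ : Tup B) = ⟨k, y⟩ := by
  subst h
  exact congrArg _ (funext hg)

theorem Tup.tail_append {m k : ℕ} (c : Fin m → B) (y : Fin k → B) :
    Tup.tail m ⟨m + k, Fin.append c y⟩ = ⟨k, y⟩ := by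
  refine Tup.ext_cast (Nat.add_sub_cancel_left m k) fun i => ?_
  exact Fin.append_right c y (Fin.cast (Nat.add_sub_cancel_left m k) i)

theorem Tup.head_append {m k : ℕ} (c : Fin m → B) (y : Fin k → B) (h : m ≤ m + k) :
    Tup.head m ⟨m + k, Fin.append c y⟩ h = c :=
  funext fun i => Fin.append_left c y i

theorem Tup.map_vec_two {C : Type*} (f : B → C) (x y : Tup B) :
    (fun j : Fin 2 => (![x, y] j).map f) = ![x.map f, y.map f] :=
  funext <| Fin.forall_fin_two.2 ⟨rfl, rfl⟩

end Tup

section Transport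

variable {L : FirstOrder.Language.{u, v}} {LA : FirstOrder.Language.{u', v'}}
  {B : Type w} [L.Structure B] {m : ℕ} (I : InterpForms LA L m) (σ : B ≃[L] B) (c : Fin m → B)

theorem InterpForms.dom_map (x : Tup B) :
    x.map σ ∈ (I.at (σ ∘ c)).dom ↔ x ∈ (I.at c).dom := by
  refine Iff.trans ?_ (I.dom.realize_equiv σ c ![x])
  rw [Tup.map_vec_one]
  rfl

theorem InterpForms.eqv_map (x y : Tup B) :
    (I.at (σ ∘ c)).eqv (x.map σ) (y.map σ) ↔ (I.at c).eqv x y := by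
  refine Iff.trans ?_ (I.eqv.realize_equiv σ c ![x, y])
  rw [Tup.map_vec_two]
  rfl

theorem InterpForms.rel_map {k : ℕ} (R : LA.Relations k) (x : Fin k → Tup B) :
    (fun j => (x j).map σ) ∈ (I.at (σ ∘ c)).rel R ↔ x ∈ (I.at c).rel R :=
  (I.rel R).realize_equiv σ c x

theorem InterpForms.equivariant_dom (I : InterpForms LA L m) :
    Equivariant L fun c => {x : Fin 1 → Tup B | x 0 ∈ (I.at c).dom} :=
  fun σ c x => (I.dom_map σ c (x 0)).symm

theorem InterpForms.equivariant_eqv (I : InterpForms LA L m) :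
    Equivariant L fun c : Fin m → B => (I.at c).eqvRel :=
  fun σ c x => (I.eqv_map σ c (x 0) (x 1)).symm

theorem InterpForms.equivariant_neqv (I : InterpForms LA L m) :
    Equivariant L fun c : Fin m → B => (I.at c).neqvRel :=
  fun σ c x => (and_congr (I.dom_map σ c (x 0)) (and_congr (I.dom_map σ c (x 1))
    (not_congr (I.eqv_map σ c (x 0) (x 1))))).symm

theorem InterpForms.equivariant_rel (I : InterpForms LA L m) {k : ℕ} (R : LA.Relations k) :
    Equivariant L fun c : Fin m → B => (I.at c).rel R :=
  fun σ c x => (I.rel_map σ c R x).symm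

theorem InterpForms.equivariant_nrel (I : InterpForms LA L m) {k : ℕ} (R : LA.Relations k) :
    Equivariant L fun c : Fin m → B => (I.at c).nrel R :=
  fun σ c x => (and_congr (forall_congr' fun j => I.dom_map σ c (x j))
    (not_congr (I.rel_map σ c R x))).symm

/-- `≡` is an equivalence relation on `D`, and the `R*` are relations on `D` that respect `≡`. -/
structure TupPresentation.IsCongruence (P : TupPresentation LA B) : Prop where
  eqv_dom : ∀ x y, P.eqv x y → x ∈ P.dom ∧ y ∈ P.dom
  eqv_refl : ∀ x ∈ P.dom, P.eqv x x
  eqv_symm : ∀ x y, P.eqv x y → P.eqv y x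
  eqv_trans : ∀ x y z, P.eqv x y → P.eqv y z → P.eqv x z
  rel_dom : ∀ (k : ℕ) (R : LA.Relations k), ∀ x ∈ P.rel R, ∀ j, x j ∈ P.dom
  rel_congr : ∀ (k : ℕ) (R : LA.Relations k) (x y : Fin k → Tup B),
    (∀ j, P.eqv (x j) (y j)) → x ∈ P.rel R → y ∈ P.rel R

theorem TupPresentation.Interprets.isCongruence [LA.IsRelational] {A : Type w'} [LA.Structure A]
    {P : TupPresentation LA B} (h : P.Interprets A) : P.IsCongruence :=
  ⟨h.eqv_dom, h.eqv_refl, h.eqv_symm, h.eqv_trans, h.rel_dom, h.rel_congr⟩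

variable {I}

theorem TupPresentation.IsCongruence.of_mem_tupOrbit {b : Fin m → B}
    (h : (I.at b).IsCongruence) {c : Fin m → B} (hc : c ∈ tupOrbit L b) :
    (I.at c).IsCongruence := by
  obtain ⟨σ, rfl⟩ := mem_tupOrbit_iff.1 hc
  have hsurj : Function.Surjective (Tup.map σ : Tup B → Tup B) := Tup.exists_map_eq σ
  have hsurj' (k : ℕ) : Function.Surjective fun (x : Fin k → Tup B) j => (x j).map σ :=
    hsurj.comp_left
  exact
    { eqv_dom := hsurj.forall₂.2 (by simpa only [I.eqv_map, I.dom_map] using h.eqv_dom)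
      eqv_refl := hsurj.forall.2 (by simpa only [I.eqv_map, I.dom_map] using h.eqv_refl)
      eqv_symm := hsurj.forall₂.2 (by simpa only [I.eqv_map] using h.eqv_symm)
      eqv_trans := hsurj.forall₃.2 (by simpa only [I.eqv_map] using h.eqv_trans)
      rel_dom := fun k R => (hsurj' k).forall.2
        (by simpa only [I.rel_map, I.dom_map] using h.rel_dom k R)
      rel_congr := fun k R => (hsurj' k).forall₂.2
        (by simpa only [I.eqv_map, I.rel_map] using h.rel_congr k R) }

theorem TupPresentation.DomIn.of_mem_tupOrbit {n : ℕ} {b : Fin m → B} (h : (I.at b).DomIn n)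
    {c : Fin m → B} (hc : c ∈ tupOrbit L b) : (I.at c).DomIn n := by
  obtain ⟨σ, rfl⟩ := mem_tupOrbit_iff.1 hc
  intro x hx
  obtain ⟨y, rfl⟩ := Tup.exists_map_eq σ x
  exact h y ((I.dom_map σ b y).1 hx)

theorem TupPresentation.IsCongruence.cls_eq_iff {P : TupPresentation LA B} (h : P.IsCongruence)
    (x y : P.dom) : P.cls x = P.cls y ↔ P.eqv x y := by
  refine ⟨fun hxy => ?_, fun hxy => Quot.sound hxy⟩
  have he : Equivalence fun x y : P.dom => P.eqv x y :=
    ⟨fun x => h.eqv_refl _ x.2, fun hxy => h.eqv_symm _ _ hxy,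
      fun hxy hyz => h.eqv_trans _ _ _ hxy hyz⟩
  exact he.eqvGen_iff.1 (Quot.eqvGen_exact hxy)

theorem TupPresentation.IsCongruence.relMap_cls_iff [LA.IsRelational] {P : TupPresentation LA B}
    (h : P.IsCongruence) {k : ℕ} (R : LA.Relations k) (y : Fin k → P.dom) :
    FirstOrder.Language.Structure.RelMap R (fun j => P.cls (y j)) ↔
      (fun j => (y j : Tup B)) ∈ P.rel R :=
  ⟨fun ⟨_, hx, hR⟩ => h.rel_congr k R _ _ (fun j => (h.cls_eq_iff _ _).1 (hx j)) hR,
    fun hR => ⟨y, fun _ => rfl, hR⟩⟩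

/-- The parameter-free presentation `(D', ∼, R')`: each component is obtained from the
corresponding component of the presentations with parameters in the orbit of `b`. -/
def InterpForms.parameterFree (I : InterpForms LA L m) (b : Fin m → B)
    (F : Set (Fin 4 → Tup B)) : TupPresentation LA B where
  dom := {z | ![z] ∈ _root_.parameterFree (tupOrbit L b) (fun c => (I.at c).dom) F
    fun c => (I.at c).domRel}
  eqv z w := ![z, w] ∈ _root_.parameterFree (tupOrbit L b) (fun c => (I.at c).dom) F
    fun c => (I.at c).eqvRel
  rel R := _root_.parameterFree (tupOrbit L b) (fun c => (I.at c).dom) F fun c => (I.at c).rel R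

theorem domRel_parameterFree (I : InterpForms LA L m) (b : Fin m → B) (F : Set (Fin 4 → Tup B)) :
    (I.parameterFree b F).domRel =
      parameterFree (tupOrbit L b) (fun c => (I.at c).dom) F fun c => (I.at c).domRel := by
  ext x
  obtain ⟨z, rfl⟩ : ∃ z, ![z] = x := ⟨x 0, funext (Fin.forall_fin_one.2 rfl)⟩
  rfl

theorem eqvRel_parameterFree (I : InterpForms LA L m) (b : Fin m → B) (F : Set (Fin 4 → Tup B)) :
    (I.parameterFree b F).eqvRel =
      parameterFree (tupOrbit L b) (fun c => (I.at c).dom) F fun c => (I.at c).eqvRel := by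
  ext x
  obtain ⟨z, w, rfl⟩ : ∃ z w, ![z, w] = x := ⟨x 0, x 1, funext (Fin.forall_fin_two.2 ⟨rfl, rfl⟩)⟩
  rfl

end Transport

section Coherent

variable {L : FirstOrder.Language.{u, v}} {LA : FirstOrder.Language.{u', v'}} [LA.IsRelational]
  {B : Type w} [L.Structure B] {m : ℕ}

/-- A coherent family of isomorphisms `f c d : A_c ≃ A_d`, defined by `F`, between the structures
`A_c` that `I` interprets with the parameters `c` in the orbit of `b`. -/
structure CoherentIso (I : InterpForms LA L m) (b : Fin m → B) (F : Set (Fin 4 → Tup B)) where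
  f : ∀ c d : tupOrbit L b, (I.at c.1).Carrier ≃[LA] (I.at d.1).Carrier
  isCongruence : (I.at b).IsCongruence
  spec : ∀ (c d : tupOrbit L b) (x : (I.at c.1).dom) (y : (I.at d.1).dom),
    f c d ((I.at c.1).cls x) = (I.at d.1).cls y ↔ ![⟨m, c.1⟩, ⟨m, d.1⟩, x.1, y.1] ∈ F
  id : ∀ (c : tupOrbit L b) (q : (I.at c.1).Carrier), f c c q = q
  comp : ∀ (c d e : tupOrbit L b) (q : (I.at c.1).Carrier), f d e (f c d q) = f c e q

theorem self_mem_tupOrbit (b : Fin m → B) : b ∈ tupOrbit L b :=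
  ⟨FirstOrder.Language.Equiv.refl L B, fun _ => rfl⟩

namespace CoherentIso

variable {I : InterpForms LA L m} {b : Fin m → B} {F : Set (Fin 4 → Tup B)}
  (C : CoherentIso I b F)

/-- The class of `x ∈ D_c`, moved to the structure with parameters `b`. -/
def toBase {c : Fin m → B} (hc : c ∈ tupOrbit L b) {x : Tup B} (hx : x ∈ (I.at c).dom) :
    (I.at b).Carrier :=
  C.f ⟨c, hc⟩ ⟨b, self_mem_tupOrbit b⟩ ((I.at c).cls ⟨x, hx⟩)

theorem toBase_eq_iff {c d : Fin m → B} (hc : c ∈ tupOrbit L b) (hd : d ∈ tupOrbit L b)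
    {x y : Tup B} (hx : x ∈ (I.at c).dom) (hy : y ∈ (I.at d).dom) :
    C.toBase hc hx = C.toBase hd hy ↔ ![⟨m, c⟩, ⟨m, d⟩, x, y] ∈ F := by
  rw [← C.spec ⟨c, hc⟩ ⟨d, hd⟩ ⟨x, hx⟩ ⟨y, hy⟩, toBase, toBase, ← C.comp ⟨c, hc⟩ ⟨d, hd⟩]
  exact (C.f ⟨d, hd⟩ _).injective.eq_iff

theorem toBase_eq_iff_eqv {c : Fin m → B} (hc : c ∈ tupOrbit L b)
    {x y : Tup B} (hx : x ∈ (I.at c).dom) (hy : y ∈ (I.at c).dom) :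
    C.toBase hc hx = C.toBase hc hy ↔ (I.at c).eqv x y :=
  (C.f ⟨c, hc⟩ _).injective.eq_iff.trans
    ((C.isCongruence.of_mem_tupOrbit hc).cls_eq_iff ⟨x, hx⟩ ⟨y, hy⟩)

theorem toBase_congr {c d : Fin m → B} (hc : c ∈ tupOrbit L b) (hd : d ∈ tupOrbit L b)
    {x y : Tup B} (hx : x ∈ (I.at c).dom) (hy : y ∈ (I.at d).dom) (hcd : c = d) (hxy : x = y) :
    C.toBase hc hx = C.toBase hd hy := by
  subst hcd hxy
  rfl

theorem toBase_self {x : Tup B} (hx : x ∈ (I.at b).dom) :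
    C.toBase (self_mem_tupOrbit b) hx = (I.at b).cls ⟨x, hx⟩ :=
  C.id _ _

theorem relMap_toBase_iff {c : Fin m → B} (hc : c ∈ tupOrbit L b) {k : ℕ} (R : LA.Relations k)
    {y : Fin k → Tup B} (hy : ∀ j, y j ∈ (I.at c).dom) :
    Language.Structure.RelMap R (fun j => C.toBase hc (hy j)) ↔ y ∈ (I.at c).rel R :=
  ((C.f ⟨c, hc⟩ _).map_rel R fun j => (I.at c).cls ⟨y j, hy j⟩).trans
    ((C.isCongruence.of_mem_tupOrbit hc).relMap_cls_iff R fun j => ⟨y j, hy j⟩)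

/-- The tuples `(c, x)` with `c` in the orbit of `b` and `x ∈ D_c`. -/
def IsPoint (I : InterpForms LA L m) (b : Fin m → B) (z : Tup B) : Prop :=
  ∃ h : m ≤ z.1, z.head m h ∈ tupOrbit L b ∧ z.tail m ∈ (I.at (z.head m h)).dom

/-- The element of the structure with parameters `b` that `(c, x)` stands for. -/
def point {z : Tup B} (hz : IsPoint I b z) : (I.at b).Carrier :=
  C.toBase hz.choose_spec.1 hz.choose_spec.2

theorem mem_parameterFree_iff {r : ℕ} {S : (Fin m → B) → Set (Fin r → Tup B)}
    {Q : Set (Fin r → (I.at b).Carrier)}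
    (hS : ∀ (e : Fin m → B) (he : e ∈ tupOrbit L b) (y : Fin r → Tup B), y ∈ S e ↔
      ∃ h : ∀ j, y j ∈ (I.at e).dom, (fun j => C.toBase he (h j)) ∈ Q) (z : Fin r → Tup B) :
    z ∈ parameterFree (tupOrbit L b) (fun c => (I.at c).dom) F S ↔
      ∃ h : ∀ j, IsPoint I b (z j), (fun j => C.point (h j)) ∈ Q := by
  constructor
  · rintro ⟨e, he, y, hy, hz⟩
    obtain ⟨hyD, hyQ⟩ := (hS e he y).1 hy
    refine ⟨fun j => (hz j).imp fun _ h => ⟨h.1, h.2.1⟩, ?_⟩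
    convert hyQ using 2 with j
    obtain ⟨_, hc, hx, hxy⟩ := hz j
    exact (C.toBase_eq_iff hc he hx (hyD j)).2 hxy
  · rintro ⟨h, hQ⟩
    have hb : b ∈ tupOrbit L b := self_mem_tupOrbit b
    choose y hy using fun j => Quot.exists_rep (C.point (h j))
    have hy' : ∀ j, C.toBase hb (y j).2 = C.point (h j) := fun j => (C.toBase_self _).trans (hy j)
    refine ⟨b, hb, fun j => y j,
      (hS b hb _).2 ⟨fun j => (y j).2, by simpa only [hy'] using hQ⟩, fun j => ?_⟩
    obtain ⟨hm, hc, hx⟩ := h j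
    exact ⟨hm, hc, hx, (C.toBase_eq_iff hc hb hx (y j).2).1 (hy' j).symm⟩

theorem mem_domRel_iff (e : Fin m → B) (he : e ∈ tupOrbit L b) (y : Fin 1 → Tup B) :
    y ∈ {x : Fin 1 → Tup B | x 0 ∈ (I.at e).dom} ↔
      ∃ h : ∀ j, y j ∈ (I.at e).dom, (fun j => C.toBase he (h j)) ∈ Set.univ := by
  simp only [Set.mem_ofPred_eq, Fin.forall_fin_one, Set.mem_univ, exists_prop, and_true]

theorem mem_eqvRel_iff (e : Fin m → B) (he : e ∈ tupOrbit L b) (y : Fin 2 → Tup B) :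
    y ∈ (I.at e).eqvRel ↔ ∃ h : ∀ j, y j ∈ (I.at e).dom,
      (fun j => C.toBase he (h j)) ∈ {q : Fin 2 → (I.at b).Carrier | q 0 = q 1} := by
  simp only [Set.mem_ofPred_eq, toBase_eq_iff_eqv, exists_prop, Fin.forall_fin_two]
  exact ⟨fun h => ⟨(C.isCongruence.of_mem_tupOrbit he).eqv_dom _ _ h, h⟩, fun h => h.2⟩

theorem mem_neqvRel_iff (e : Fin m → B) (he : e ∈ tupOrbit L b) (y : Fin 2 → Tup B) :
    y ∈ (I.at e).neqvRel ↔ ∃ h : ∀ j, y j ∈ (I.at e).dom,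
      (fun j => C.toBase he (h j)) ∈ {q : Fin 2 → (I.at b).Carrier | q 0 ≠ q 1} := by
  simp only [Set.mem_ofPred_eq, ne_eq, toBase_eq_iff_eqv, exists_prop, Fin.forall_fin_two,
    and_assoc]
  rfl

theorem mem_rel_iff {k : ℕ} (R : LA.Relations k) (e : Fin m → B) (he : e ∈ tupOrbit L b)
    (y : Fin k → Tup B) : y ∈ (I.at e).rel R ↔ ∃ h : ∀ j, y j ∈ (I.at e).dom,
      (fun j => C.toBase he (h j)) ∈ {q : Fin k → (I.at b).Carrier |
        Language.Structure.RelMap R q} := by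
  simp only [Set.mem_ofPred_eq, relMap_toBase_iff, exists_prop]
  exact ⟨fun h => ⟨(C.isCongruence.of_mem_tupOrbit he).rel_dom _ _ _ h, h⟩, fun h => h.2⟩

theorem mem_nrel_iff {k : ℕ} (R : LA.Relations k) (e : Fin m → B) (he : e ∈ tupOrbit L b)
    (y : Fin k → Tup B) : y ∈ (I.at e).nrel R ↔ ∃ h : ∀ j, y j ∈ (I.at e).dom,
      (fun j => C.toBase he (h j)) ∈ {q : Fin k → (I.at b).Carrier |
        ¬ Language.Structure.RelMap R q} := by
  simp only [Set.mem_ofPred_eq, relMap_toBase_iff, exists_prop]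
  rfl

theorem mem_dom_iff (C : CoherentIso I b F) (z : Tup B) :
    z ∈ (I.parameterFree b F).dom ↔ IsPoint I b z := by
  refine (C.mem_parameterFree_iff C.mem_domRel_iff ![z]).trans ?_
  simp only [Set.mem_univ, exists_prop, and_true, Fin.forall_fin_one, Matrix.cons_val_fin_one]

theorem eqv_iff (C : CoherentIso I b F) (z w : Tup B) : (I.parameterFree b F).eqv z w ↔
    ∃ (hz : IsPoint I b z) (hw : IsPoint I b w), C.point hz = C.point hw := by
  refine (C.mem_parameterFree_iff C.mem_eqvRel_iff ![z, w]).trans ?_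
  exact ⟨fun ⟨h, h'⟩ => ⟨h 0, h 1, h'⟩, fun ⟨h, h', e⟩ => ⟨Fin.forall_fin_two.2 ⟨h, h'⟩, e⟩⟩

theorem parameterFree_rel_iff (C : CoherentIso I b F) {k : ℕ} (R : LA.Relations k)
    (z : Fin k → Tup B) :
    z ∈ (I.parameterFree b F).rel R ↔ ∃ h : ∀ j, IsPoint I b (z j),
      Language.Structure.RelMap R fun j => C.point (h j) :=
  C.mem_parameterFree_iff (C.mem_rel_iff R) z

theorem neqvRel_eq (C : CoherentIso I b F) : (I.parameterFree b F).neqvRel =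
    parameterFree (tupOrbit L b) (fun c => (I.at c).dom) F fun c => (I.at c).neqvRel := by
  ext x
  refine Iff.trans ?_ (C.mem_parameterFree_iff C.mem_neqvRel_iff x).symm
  simp only [TupPresentation.neqvRel, Set.mem_ofPred_eq, C.mem_dom_iff, C.eqv_iff]
  exact ⟨fun ⟨h0, h1, h⟩ => ⟨Fin.forall_fin_two.2 ⟨h0, h1⟩, fun e => h ⟨h0, h1, e⟩⟩,
    fun ⟨h, h'⟩ => ⟨h 0, h 1, fun ⟨_, _, e⟩ => h' e⟩⟩

theorem nrel_eq (C : CoherentIso I b F) {k : ℕ} (R : LA.Relations k) :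
    (I.parameterFree b F).nrel R =
      parameterFree (tupOrbit L b) (fun c => (I.at c).dom) F fun c => (I.at c).nrel R := by
  ext x
  refine Iff.trans ?_ (C.mem_parameterFree_iff (C.mem_nrel_iff R) x).symm
  simp only [TupPresentation.nrel, Set.mem_ofPred_eq, C.mem_dom_iff, C.parameterFree_rel_iff]
  exact ⟨fun ⟨h, h'⟩ => ⟨h, fun e => h' ⟨h, e⟩⟩, fun ⟨h, h'⟩ => ⟨h, fun ⟨_, e⟩ => h' e⟩⟩

theorem exists_point_eq (C : CoherentIso I b F) (q : (I.at b).Carrier) :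
    ∃ (z : Tup B) (hz : IsPoint I b z), C.point hz = q := by
  obtain ⟨⟨y, hy⟩, rfl⟩ := Quot.exists_rep q
  let z : Tup B := ⟨m + y.1, Fin.append b y.2⟩
  have hm : m ≤ z.1 := Nat.le_add_right m y.1
  have hhead : z.head m hm = b := Tup.head_append b y.2 hm
  have htail : z.tail m = y := Tup.tail_append b y.2
  have hz : IsPoint I b z := ⟨hm, by rw [hhead]; exact self_mem_tupOrbit b, by rwa [hhead, htail]⟩
  exact ⟨z, hz, (C.toBase_congr _ (self_mem_tupOrbit b) _ hy hhead htail).trans (C.toBase_self hy)⟩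

theorem isCongruence_parameterFree (C : CoherentIso I b F) :
    (I.parameterFree b F).IsCongruence where
  eqv_dom x y h := by
    obtain ⟨hx, hy, -⟩ := (C.eqv_iff x y).1 h
    exact ⟨(C.mem_dom_iff x).2 hx, (C.mem_dom_iff y).2 hy⟩
  eqv_refl x hx :=
    have h := (C.mem_dom_iff x).1 hx
    (C.eqv_iff x x).2 ⟨h, h, rfl⟩
  eqv_symm x y h := by
    obtain ⟨hx, hy, h⟩ := (C.eqv_iff x y).1 h
    exact (C.eqv_iff y x).2 ⟨hy, hx, h.symm⟩
  eqv_trans x y z h h' := by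
    obtain ⟨hx, hy, h⟩ := (C.eqv_iff x y).1 h
    obtain ⟨_, hz, h'⟩ := (C.eqv_iff y z).1 h'
    exact (C.eqv_iff x z).2 ⟨hx, hz, h.trans h'⟩
  rel_dom k R x h j := (C.mem_dom_iff _).2 (((C.parameterFree_rel_iff R x).1 h).choose j)
  rel_congr k R x y hxy h := by
    obtain ⟨hx, h⟩ := (C.parameterFree_rel_iff R x).1 h
    refine (C.parameterFree_rel_iff R y).2
      ⟨fun j => ((C.eqv_iff _ _).1 (hxy j)).choose_spec.choose, ?_⟩
    convert h using 2 with j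
    exact ((C.eqv_iff _ _).1 (hxy j)).choose_spec.choose_spec.symm

/-- The map of the parameter-free quotient to the structure with parameters `b`. -/
def fromParameterFree (C : CoherentIso I b F) :
    (I.parameterFree b F).Carrier → (I.at b).Carrier :=
  Quot.lift (fun x => C.point ((C.mem_dom_iff _).1 x.2))
    fun _ _ h => ((C.eqv_iff _ _).1 h).choose_spec.choose_spec

theorem bijective_fromParameterFree (C : CoherentIso I b F) :
    Function.Bijective C.fromParameterFree := by
  constructor
  · rintro ⟨x⟩ ⟨y⟩ h
    exact Quot.sound ((C.eqv_iff _ _).2 ⟨(C.mem_dom_iff _).1 x.2, (C.mem_dom_iff _).1 y.2, h⟩)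
  · intro q
    obtain ⟨z, hz, rfl⟩ := C.exists_point_eq q
    exact ⟨(I.parameterFree b F).cls ⟨z, (C.mem_dom_iff z).2 hz⟩, rfl⟩

theorem nonempty_equiv (C : CoherentIso I b F) :
    Nonempty ((I.parameterFree b F).Carrier ≃[LA] (I.at b).Carrier) := by
  refine ⟨⟨Equiv.ofBijective _ C.bijective_fromParameterFree, fun g => isEmptyElim g,
    fun {k} R q => ?_⟩⟩
  choose y hy using fun j => Quot.exists_rep (q j)
  obtain rfl : (fun j => (I.parameterFree b F).cls (y j)) = q := funext hy
  rw [C.isCongruence_parameterFree.relMap_cls_iff, C.parameterFree_rel_iff]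
  exact ⟨fun h => ⟨fun j => (C.mem_dom_iff _).1 (y j).2, h⟩, fun ⟨_, h⟩ => h⟩

theorem interprets_parameterFree (C : CoherentIso I b F) {A : Type w'} [LA.Structure A]
    (h : Nonempty ((I.at b).Carrier ≃[LA] A)) : (I.parameterFree b F).Interprets A :=
  have ⟨e⟩ := C.nonempty_equiv
  have ⟨e'⟩ := h
  have hJ := C.isCongruence_parameterFree
  ⟨hJ.eqv_dom, hJ.eqv_refl, hJ.eqv_symm, hJ.eqv_trans, hJ.rel_dom, hJ.rel_congr, ⟨e'.comp e⟩⟩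

theorem domIn_parameterFree (C : CoherentIso I b F) {n : ℕ} (h : (I.at b).DomIn n) :
    (I.parameterFree b F).DomIn (n + m) := by
  intro z hz
  obtain ⟨hm, hc, ht⟩ := (C.mem_dom_iff z).1 hz
  have hlen : z.1 - m = n := h.of_mem_tupOrbit hc _ ht
  omega

end CoherentIso

end Coherent

section Scott

variable {L : FirstOrder.Language.{u, v}} {B : Type w} [L.Structure B]

/-- The two tuples of coordinates of `g` satisfy the same formulas of `L_{ω₁ω}`: the condition that
`g` is a finite partial isomorphism of the back-and-forth argument. -/
def SameType (L : FirstOrder.Language.{u, v}) [L.Structure B] {k : ℕ} (g : Fin k → B × B) : Prop :=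
  ∀ φ : InfForm L k, φ.Realize (Prod.fst ∘ g) ↔ φ.Realize (Prod.snd ∘ g)

theorem exists_realize_not_realize_of_not_sameType {k : ℕ} {g : Fin k → B × B}
    (h : ¬ SameType L g) :
    ∃ φ : InfForm L k, φ.Realize (Prod.fst ∘ g) ∧ ¬ φ.Realize (Prod.snd ∘ g) := by
  obtain ⟨φ, hφ⟩ := not_forall.1 h
  by_cases hfst : φ.Realize (Prod.fst ∘ g)
  · exact ⟨φ, hfst, fun hsnd => hφ (iff_of_true hfst hsnd)⟩
  · exact ⟨φ.neg, hfst, fun hsnd => hφ (iff_of_false hfst hsnd)⟩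

theorem SameType.comp {k k' : ℕ} {g : Fin k → B × B} (h : SameType L g) (ρ : Fin k' → Fin k) :
    SameType L (g ∘ ρ) := fun φ => by
  simpa only [realize_rename, Function.comp_assoc] using h (φ.rename ρ)

theorem SameType.of_range_subset {k k' : ℕ} {g : Fin k → B × B} (h : SameType L g)
    {g' : Fin k' → B × B} (hg : ∀ i, g' i ∈ Set.range g) : SameType L g' := by
  choose ρ hρ using hg
  obtain rfl : g ∘ ρ = g' := funext hρ
  exact h.comp ρ

theorem SameType.swap {k : ℕ} {g : Fin k → B × B} (h : SameType L g) :
    SameType L (Prod.swap ∘ g) := fun φ => (h φ).symm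

theorem SameType.exists_snoc [Countable B] {k : ℕ} {g : Fin k → B × B} (h : SameType L g) (x : B) :
    ∃ y, SameType L (Fin.snoc g (x, y) : Fin (k + 1) → B × B) := by
  by_contra! hne
  choose φ hfst hsnd using fun y => exists_realize_not_realize_of_not_sameType (hne y)
  simp only [Fin.comp_snoc] at hfst hsnd
  have : Nonempty B := ⟨x⟩
  obtain ⟨e, he⟩ := exists_surjective_nat B
  obtain ⟨y, hy⟩ := (h (ex (iConj fun i => φ (e i)))).1 ⟨x, fun i => hfst (e i)⟩
  obtain ⟨i, rfl⟩ := he y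
  exact hsnd (e i) (hy i)

theorem SameType.exists_extend [Countable B] {k : ℕ} {g : Fin k → B × B} (h : SameType L g)
    (x : B) : ∃ (k' : ℕ) (g' : Fin k' → B × B), SameType L g' ∧ Set.range g ⊆ Set.range g' ∧
      (∃ y, (x, y) ∈ Set.range g') ∧ ∃ y, (y, x) ∈ Set.range g' := by
  obtain ⟨y, hy⟩ := h.exists_snoc x
  obtain ⟨z, hz⟩ := hy.swap.exists_snoc x
  refine ⟨_, _, hz.swap, ?_, ⟨y, (Fin.last k).castSucc, ?_⟩, ⟨z, Fin.last _, ?_⟩⟩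
  · rintro _ ⟨i, rfl⟩
    exact ⟨i.castSucc.castSucc, by simp⟩
  · simp
  · simp

theorem SameType.exists_backAndForth [Countable B] {k : ℕ} {g : Fin k → B × B} (h : SameType L g) :
    ∃ R : Set (B × B), Set.range g ⊆ R ∧ (∀ x, ∃ y, (x, y) ∈ R) ∧ (∀ y, ∃ x, (x, y) ∈ R) ∧
      ∀ (l : ℕ) (p : Fin l → B × B), (∀ i, p i ∈ R) → SameType L p := by
  rcases isEmpty_or_nonempty B with hB | hB
  · exact ⟨Set.range g, subset_rfl, isEmptyElim, isEmptyElim, fun l p hp => h.of_range_subset hp⟩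
  obtain ⟨e, he⟩ := exists_surjective_nat B
  choose k' g' hg' hsub hl hr using fun (s : {g : Tup (B × B) // SameType L g.2}) (x : B) =>
    s.2.exists_extend x
  let G : ℕ → {g : Tup (B × B) // SameType L g.2} := fun n =>
    Nat.rec ⟨⟨k, g⟩, h⟩ (fun i s => ⟨⟨k' s (e i), g' s (e i)⟩, hg' s (e i)⟩) n
  have hmono : Monotone fun n => Set.range (G n).1.2 :=
    monotone_nat_of_le_succ fun n => hsub (G n) (e n)
  refine ⟨⋃ n, Set.range (G n).1.2, Set.subset_iUnion (fun n => Set.range (G n).1.2) 0, fun x => ?_,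
    fun y => ?_, fun l p hp => ?_⟩
  · obtain ⟨i, rfl⟩ := he x
    exact (hl (G i) (e i)).imp fun _ h => Set.mem_iUnion.2 ⟨i + 1, h⟩
  · obtain ⟨i, rfl⟩ := he y
    exact (hr (G i) (e i)).imp fun _ h => Set.mem_iUnion.2 ⟨i + 1, h⟩
  · choose n hn using fun i => Set.mem_iUnion.1 (hp i)
    exact (G (Finset.univ.sup n)).2.of_range_subset fun i =>
      hmono (Finset.le_sup (Finset.mem_univ i)) (hn i)

theorem exists_equiv_of_forall_sameType {R : Set (B × B)} (hleft : ∀ x, ∃ y, (x, y) ∈ R)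
    (hright : ∀ y, ∃ x, (x, y) ∈ R)
    (hR : ∀ (l : ℕ) (p : Fin l → B × B), (∀ i, p i ∈ R) → SameType L p) :
    ∃ σ : B ≃[L] B, ∀ p ∈ R, σ p.1 = p.2 := by
  choose f hf using hleft
  choose f' hf' using hright
  have heq_iff : ∀ {p q : B × B}, p ∈ R → q ∈ R → (p.1 = q.1 ↔ p.2 = q.2) := fun {p q} hp hq => by
    simpa [Realize] using hR 2 ![p, q] (Fin.forall_fin_two.2 ⟨hp, hq⟩) (equal (.var 0) (.var 1))
  refine ⟨⟨⟨f, f', fun x => (heq_iff (hf' _) (hf x)).2 rfl,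
    fun y => (heq_iff (hf _) (hf' y)).1 rfl⟩, fun {n} F x => ?_, fun {n} S x => ?_⟩,
    fun p hp => (heq_iff (hf _) hp).1 rfl⟩
  · have hgraph := hR (n + 1) (Fin.snoc (fun i => (x i, f (x i)))
        (Language.Structure.funMap F x, f (Language.Structure.funMap F x)))
      (fun i => by refine Fin.lastCases ?_ (fun j => ?_) i <;> simp [hf])
      (equal (.func F fun i => .var i.castSucc) (.var (Fin.last n)))
    simp only [Realize, Language.Term.realize_func, Language.Term.realize_var, Function.comp_apply,
      Fin.snoc_castSucc, Fin.snoc_last, true_iff] at hgraph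
    exact hgraph.symm
  · exact (hR n (fun i => (x i, f (x i))) (fun i => hf _) (rel S fun i => .var i)).symm

theorem SameType.exists_equiv [Countable B] {k : ℕ} {g : Fin k → B × B} (h : SameType L g) :
    ∃ σ : B ≃[L] B, ∀ i, σ (g i).1 = (g i).2 := by
  obtain ⟨R, hg, hleft, hright, hR⟩ := h.exists_backAndForth
  obtain ⟨σ, hσ⟩ := exists_equiv_of_forall_sameType hleft hright hR
  exact ⟨σ, fun i => hσ _ (hg ⟨i, rfl⟩)⟩

theorem setDefinable_tupOrbit [Countable B] {m : ℕ} (b : Fin m → B) :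
    SetDefinable (allForms L) (tupOrbit L b) := by
  have hsep : ∀ c : Fin m → B, ∃ φ : InfForm L m,
      φ.Realize b ∧ (φ.Realize c → c ∈ tupOrbit L b) := fun c => by
    by_cases hc : c ∈ tupOrbit L b
    · exact ⟨falsum.neg, fun h => h, fun _ => hc⟩
    · obtain ⟨φ, hφb, hφc⟩ := exists_realize_not_realize_of_not_sameType
        (g := fun i => (b i, c i)) fun h => hc h.exists_equiv
      exact ⟨φ, hφb, fun h => absurd h hφc⟩
  choose φ hb hc using hsep
  have : Nonempty (Fin m → B) := ⟨b⟩
  obtain ⟨e, he⟩ := exists_surjective_nat (Fin m → B)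
  refine ⟨iConj fun i => φ (e i), trivial, fun c => ⟨fun hcb i => ?_, fun h => ?_⟩⟩
  · obtain ⟨σ, rfl⟩ := mem_tupOrbit_iff.1 hcb
    simpa only [realize_equiv] using hb (e i)
  · obtain ⟨i, rfl⟩ := he c
    exact hc _ (h i)

end Scott

section Main

variable {L : FirstOrder.Language.{u, v}} {LA : FirstOrder.Language.{u', v'}}
  {B : Type w} [L.Structure B] {m : ℕ} {I : InterpForms LA L m} {b : Fin m → B}
  {F : Set (Fin 4 → Tup B)} {Q Q' : ∀ r : ℕ, Set (Fin r → Tup B) → Prop}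

theorem TupPresentation.Each.imp {P : TupPresentation LA B}
    (h : ∀ r S, Q r S → Q' r S) (hQ : P.Each Q) : P.Each Q' :=
  ⟨h _ _ hQ.1, h _ _ hQ.2.1, fun k R => h k _ (hQ.2.2 k R)⟩

theorem each_parameterFree
    (h : Q 1 (I.at b).domRel → ∀ (r : ℕ) (S : (Fin m → B) → Set (Fin r → Tup B)),
      Equivariant L S → (∀ c ∈ tupOrbit L b, ∀ y ∈ S c, ∀ j, y j ∈ (I.at c).dom) → Q r (S b) →
      Q' r (parameterFree (tupOrbit L b) (fun c => (I.at c).dom) F S))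
    (hI : (I.at b).IsCongruence) (hQ : (I.at b).Each Q) : (I.parameterFree b F).Each Q' := by
  obtain ⟨hdom, heqv, hrel⟩ := hQ
  refine ⟨?_, ?_, fun k R => h hdom k _ (I.equivariant_rel R)
    (fun c hc => (hI.of_mem_tupOrbit hc).rel_dom k R) (hrel k R)⟩
  · rw [domRel_parameterFree]
    exact h hdom 1 _ I.equivariant_dom (fun c _ y hy => Fin.forall_fin_one.2 hy) hdom
  · rw [eqvRel_parameterFree]
    exact h hdom 2 _ I.equivariant_eqv (fun c hc y hy =>
      Fin.forall_fin_two.2 ((hI.of_mem_tupOrbit hc).eqv_dom _ _ hy)) heqv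

theorem CoherentIso.eachPM_parameterFree [LA.IsRelational] (C : CoherentIso I b F)
    (h : Q 1 (I.at b).domRel → ∀ (r : ℕ) (S : (Fin m → B) → Set (Fin r → Tup B)),
      Equivariant L S → Q r (S b) →
      Q' r (parameterFree (tupOrbit L b) (fun c => (I.at c).dom) F S))
    (hQ : (I.at b).EachPM Q) : (I.parameterFree b F).EachPM Q' := by
  obtain ⟨heach, hneqv, hnrel⟩ := hQ
  refine ⟨each_parameterFree (fun hdom r S hS _ => h hdom r S hS) C.isCongruence heach, ?_,
    fun k R => ?_⟩
  · rw [C.neqvRel_eq]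
    exact h heach.1 2 _ I.equivariant_neqv hneqv
  · rw [C.nrel_eq]
    exact h heach.1 k _ (I.equivariant_nrel R) (hnrel k R)

theorem InterpForms.each_genDefinable (I : InterpForms LA L m) (b : Fin m → B) :
    (I.at b).Each (GenDefinable (allForms L) b) := by
  refine ⟨⟨I.dom, fun _ => trivial, fun x => ?_⟩, ⟨I.eqv, fun _ => trivial, fun x => ?_⟩,
    fun k R => ⟨I.rel R, fun _ => trivial, fun x => Iff.rfl⟩⟩
  · obtain ⟨z, rfl⟩ : ∃ z, ![z] = x := ⟨x 0, funext (Fin.forall_fin_one.2 rfl)⟩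
    rfl
  · obtain ⟨z, w, rfl⟩ : ∃ z w, ![z, w] = x :=
      ⟨x 0, x 1, funext (Fin.forall_fin_two.2 ⟨rfl, rfl⟩)⟩
    rfl

theorem each_definableAt_finitary_parameterFree {n : ℕ} (hI : (I.at b).IsCongruence)
    (hn : (I.at b).DomIn n) (hFdef : DefinableAt (finitaryForms L) ![] ![m, m, n, n] F)
    (hOdef : SetDefinable (finitaryForms L) (tupOrbit L b)) :
    ((I.at b).Each fun _ S => DefinableAt (finitaryForms L) b (fun _ => n) S) →
      (I.parameterFree b F).Each fun _ S =>
        DefinableAt (finitaryForms L) ![] (fun _ => n + m) S :=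
  each_parameterFree (fun hDdef _ _ hS hSD hSdef => definableAt_parameterFree I.equivariant_dom hS
    (fun c hc y hy j => hn.of_mem_tupOrbit hc _ (hSD c hc y hy j)) hOdef hFdef hDdef hSdef) hI

theorem exists_eq_sigmaClass {Γ : FormClass L}
    (hΓ : Γ = allForms L ∨ ∃ α : Ordinal.{0}, 1 ≤ α ∧ α < Ordinal.omega 1 ∧ Γ = sigmaForms L α) :
    ∃ o : Option Ordinal.{0}, (∀ α ∈ o, 1 ≤ α) ∧ Γ = sigmaClass L o := by
  obtain rfl | ⟨α, hα, -, rfl⟩ := hΓ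
  · exact ⟨none, by simp, rfl⟩
  · exact ⟨some α, by simpa using hα, rfl⟩

variable [Encodable (Σ k, L.Functions k)] [Encodable (Σ k, L.Relations k)]
  {X : Set ℕ} {o : Option Ordinal.{0}}

theorem each_genDefinable_parameterFree (ho : ∀ α ∈ o, 1 ≤ α) (hI : (I.at b).IsCongruence)
    (hFdef : GenDefinable (sigmaClass L o) ![] 4 F)
    (hOdef : SetDefinable (sigmaClass L o) (tupOrbit L b)) :
    (I.at b).Each (GenDefinable (sigmaClass L o) b) →
      (I.parameterFree b F).Each (GenDefinable (sigmaClass L o) ![]) :=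
  each_parameterFree (fun hDdef _ _ hS _ hSdef =>
    genDefinable_parameterFree ho I.equivariant_dom hS hOdef hFdef hDdef hSdef) hI

theorem CoherentIso.eachPM_genDefinable_parameterFree [LA.IsRelational] (C : CoherentIso I b F)
    (ho : ∀ α ∈ o, 1 ≤ α) (hFdef : GenDefinable (sigmaClass L o) ![] 4 F)
    (hOdef : SetDefinable (sigmaClass L o) (tupOrbit L b)) :
    (I.at b).EachPM (GenDefinable (sigmaClass L o) b) →
      (I.parameterFree b F).EachPM (GenDefinable (sigmaClass L o) ![]) :=
  C.eachPM_parameterFree fun hDdef _ _ hS hSdef =>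
    genDefinable_parameterFree ho I.equivariant_dom hS hOdef hFdef hDdef hSdef

theorem xGenDefinable_parameterFree (ho : ∀ α ∈ o, 1 ≤ α)
    (hFdef : XGenDefinable X (sigmaClass L o) ![] 4 F)
    (hOdef : XSetDefinable X (sigmaClass L o) (tupOrbit L b))
    (hDdef : XGenDefinable X (sigmaClass L o) b 1 (I.at b).domRel) (r : ℕ)
    (S : (Fin m → B) → Set (Fin r → Tup B)) (hS : Equivariant L S)
    (hSdef : XGenDefinable X (sigmaClass L o) b r (S b)) :
    XGenDefinable X (sigmaClass L o) ![] r
      (parameterFree (tupOrbit L b) (fun c => (I.at c).dom) F S) :=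
  xGenDefinableFamily_parameterFree (ι := Unit) (r := fun _ => r) (S := fun _ => S) ho
    I.equivariant_dom (fun _ => hS) hOdef hFdef hDdef hSdef

variable [Encodable (Σ k, LA.Relations k)]

theorem uniformlyX_parameterFree (ho : ∀ α ∈ o, 1 ≤ α)
    (hFdef : XGenDefinable X (sigmaClass L o) ![] 4 F)
    (hOdef : XSetDefinable X (sigmaClass L o) (tupOrbit L b))
    (h : (I.at b).UniformlyX X (sigmaClass L o) b) :
    (I.parameterFree b F).UniformlyX X (sigmaClass L o) ![] := by
  obtain ⟨hdom, heqv, hrel⟩ := h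
  refine ⟨?_, ?_, xGenDefinableFamily_parameterFree
    (S := fun (R : Σ k, LA.Relations k) c => (I.at c).rel R.2) ho I.equivariant_dom
    (fun R => I.equivariant_rel R.2) hOdef hFdef hdom hrel⟩
  · rw [domRel_parameterFree]
    exact xGenDefinable_parameterFree ho hFdef hOdef hdom 1 _ I.equivariant_dom hdom
  · rw [eqvRel_parameterFree]
    exact xGenDefinable_parameterFree ho hFdef hOdef hdom 2 _ I.equivariant_eqv heqv

theorem CoherentIso.uniformlyXPM_parameterFree [LA.IsRelational] (C : CoherentIso I b F)
    (ho : ∀ α ∈ o, 1 ≤ α) (hFdef : XGenDefinable X (sigmaClass L o) ![] 4 F)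
    (hOdef : XSetDefinable X (sigmaClass L o) (tupOrbit L b))
    (h : (I.at b).UniformlyXPM X (sigmaClass L o) b) :
    (I.parameterFree b F).UniformlyXPM X (sigmaClass L o) ![] := by
  obtain ⟨huniform, hneqv, hnrel⟩ := h
  refine ⟨uniformlyX_parameterFree ho hFdef hOdef huniform, ?_, ?_⟩
  · rw [C.neqvRel_eq]
    exact xGenDefinable_parameterFree ho hFdef hOdef huniform.1 2 _ I.equivariant_neqv hneqv
  · simp only [C.nrel_eq]
    exact xGenDefinableFamily_parameterFree
      (S := fun (R : Σ k, LA.Relations k) c => (I.at c).nrel R.2) ho I.equivariant_dom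
      (fun R => I.equivariant_nrel R.2) hOdef hFdef huniform.1 hnrel

end Main

theorem mainTheorem5
    {L : FirstOrder.Language.{u, v}} [Encodable (Σ k, L.Functions k)] [Encodable (Σ k, L.Relations k)]
    {LA : FirstOrder.Language.{u', v'}} [LA.IsRelational] [Encodable (Σ k, LA.Relations k)]
    {A : Type w'} [LA.Structure A] {B : Type w} [L.Structure B] [Countable B]
    {m : ℕ} (b : Fin m → B)
    -- an interpretation of `A` in `(B, b)` by generalized `L_{ω₁ω}` formulas
    (I : InterpForms LA L m) (hI : (I.at b).Interprets A)
    -- a definable relation `F` that defines the isomorphisms `f c d` from `A_c` onto `A_d`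
    (F : Set (Fin 4 → Tup B)) (hF : GenDefinable (allForms L) ![] 4 F)
    (f : ∀ c d : tupOrbit L b, (I.at c.1).Carrier ≃[LA] (I.at d.1).Carrier)
    (hfF : ∀ (c d : tupOrbit L b) (x : (I.at c.1).dom) (y : (I.at d.1).dom),
      f c d ((I.at c.1).cls x) = (I.at d.1).cls y ↔ ![⟨m, c.1⟩, ⟨m, d.1⟩, x.1, y.1] ∈ F)
    (hid : ∀ (c : tupOrbit L b) (q : (I.at c.1).Carrier), f c c q = q)
    (hcomp : ∀ (c d e : tupOrbit L b) (q : (I.at c.1).Carrier), f d e (f c d q) = f c e q) :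
    -- every countable set of formulas is computed by some `X`
    (∀ S : Set (Σ n, InfForm L n), S.Countable → ∃ X : Set ℕ, ∀ φ ∈ S, φ.2.IsXComputable X) ∧
    -- there is an interpretation of `A` in `B` without parameters
    ∃ J : TupPresentation LA B, J.Interprets A ∧
      J.Each (GenDefinable (allForms L) ![]) ∧
      -- `Σ_α` formulas
      (∀ α : Ordinal.{0}, 1 ≤ α → α < Ordinal.omega 1 →
        (I.at b).Each (GenDefinable (sigmaForms L α) b) →
        GenDefinable (sigmaForms L α) ![] 4 F →
        SetDefinable (sigmaForms L α) (tupOrbit L b) →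
        J.Each (GenDefinable (sigmaForms L α) ![])) ∧
      -- `Σ_α` formulas, including complements
      (∀ α : Ordinal.{0}, 1 ≤ α → α < Ordinal.omega 1 →
        (I.at b).EachPM (GenDefinable (sigmaForms L α) b) →
        GenDefinable (sigmaForms L α) ![] 4 F →
        SetDefinable (sigmaForms L α) (tupOrbit L b) →
        J.EachPM (GenDefinable (sigmaForms L α) ![])) ∧
      -- `X`-computable formulas, and `X`-computable `Σ_α` formulas
      (∀ (X : Set ℕ) (Γ : FormClass L),
        (Γ = allForms L ∨ ∃ α : Ordinal.{0}, 1 ≤ α ∧ α < Ordinal.omega 1 ∧ Γ = sigmaForms L α) →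
        XGenDefinable X Γ ![] 4 F →
        XSetDefinable X Γ (tupOrbit L b) →
        ((I.at b).Each (XGenDefinable X Γ b) → J.Each (XGenDefinable X Γ ![])) ∧
        ((I.at b).EachPM (XGenDefinable X Γ b) → J.EachPM (XGenDefinable X Γ ![])) ∧
        ((I.at b).UniformlyX X Γ b → J.UniformlyX X Γ ![]) ∧
        ((I.at b).UniformlyXPM X Γ b → J.UniformlyXPM X Γ ![])) ∧
      -- non-generalized formulas
      (∀ n : ℕ, (I.at b).DomIn n →
        J.DomIn (n + m) ∧ J.Each fun _ S => DefinableAt (allForms L) ![] (fun _ => n + m) S) ∧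
      -- finitary formulas
      (∀ n : ℕ, (I.at b).DomIn n →
        ((I.at b).Each fun _ S => DefinableAt (finitaryForms L) b (fun _ => n) S) →
        DefinableAt (finitaryForms L) ![] ![m, m, n, n] F →
        SetDefinable (finitaryForms L) (tupOrbit L b) →
        J.Each fun _ S => DefinableAt (finitaryForms L) ![] (fun _ => n + m) S) := by
  let C : CoherentIso I b F := ⟨f, hI.isCongruence, hfF, hid, hcomp⟩
  have hI' := hI.isCongruence
  have hgen : (I.parameterFree b F).Each (GenDefinable (allForms L) ![]) :=
    each_genDefinable_parameterFree (o := none) (by simp) hI' hF (setDefinable_tupOrbit b)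
      (I.each_genDefinable b)
  refine ⟨exists_isXComputable, I.parameterFree b F, C.interprets_parameterFree hI.iso, hgen,
    fun α hα _ h hFα hOα => ?_, fun α hα _ h hFα hOα => ?_, fun X Γ hΓ hFX hOX => ?_,
    fun n hn => ⟨C.domIn_parameterFree hn, hgen.imp fun _ _ hS => hS.definableAt _⟩,
    fun n hn h hFn hO => each_definableAt_finitary_parameterFree hI' hn hFn hO h⟩
  · exact each_genDefinable_parameterFree (o := some α) (by simpa using hα) hI' hFα hOα h
  · exact C.eachPM_genDefinable_parameterFree (o := some α) (by simpa using hα) hFα hOα h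
  · obtain ⟨o, ho, rfl⟩ := exists_eq_sigmaClass hΓ
    have htransfer := xGenDefinable_parameterFree (I := I) ho hFX hOX
    exact ⟨each_parameterFree (fun hD r S hS _ => htransfer hD r S hS) hI',
      C.eachPM_parameterFree htransfer, uniformlyX_parameterFree ho hFX hOX,
      C.uniformlyXPM_parameterFree ho hFX hOX⟩
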